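/- Let $\Lambda=\mathbb Z b_0+\mathbb Z b_1\subset\mathbb R^2$, where $b_0,b_1$ are linearly independent vectors of the Euclidean plane, let $\mathbb T=\mathbb R^2/\Lambda$ be the corresponding flat torus with projection $\rho:\mathbb R^2\to\mathbb T$, and let $V\subset\mathbb T$ be a nonempty finite set. A *geometric triangulation* of $\mathbb T$ with vertex set $V$ consists of finitely many edges and finitely many faces which, together with the points of $V$, partition $\mathbb T$. Each edge is an embedded open locally geodesic segment (the injective image under $\rho$ of an open straight segment) with endpoints in $V$. Each face is the injective image under $\rho$ of the interior of a nondegenerate triangle in $\mathbb R^2$ whose corners project to points of $V$ and whose open sides project to edges. Loops and multiple edges are allowed. Two geometric triangulations with vertex set $V$ are *related by a flip* if one is obtained from the other as follows: take two distinct lifted triangles $v_1v_2v_3$ and $v_2v_1v_4$ in $\mathbb R^2$ sharing the side $v_1v_2$, replace the projected edge $v_1v_2$ by the projection of the other diagonal $v_3v_4$, and replace the two projected triangles by the projections of $v_3v_4v_2$ and $v_4v_3v_1$. The *geometric flip graph* has as vertices the geometric triangulations of $\mathbb T$ with vertex set $V$, two of them being adjacent if and only if they are related by a flip. Then the geometric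 flip graph of $\mathbb T$ with vertex set $V$ is connected (in particular, it is nonempty). -/

import Mathlib

/-- The Euclidean plane. -/
abbrev EPlane : Type := EuclideanSpace ℝ (Fin 2)

/-- The flat torus `ℝ² / (ℤ b₀ + ℤ b₁)`: the quotient of the Euclidean plane by the group
generated by the translations along two linearly independent vectors `b 0`, `b 1`. -/
abbrev FlatTorus (b : Module.Basis (Fin 2) ℝ EPlane) : Type :=
  EPlane ⧸ (Submodule.span ℤ (Set.range b)).toAddSubgroup

namespace FlatTorus

/-- The universal covering projection `ℝ² → ℝ² / (ℤ b₀ + ℤ b₁)`. It is a local isometry, so the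
locally geodesic segments of the torus are the images of the straight segments of the plane. -/
def proj (b : Module.Basis (Fin 2) ℝ EPlane) (x : EPlane) : FlatTorus b :=
  QuotientAddGroup.mk x

/-- The locally geodesic segment of the torus, without its endpoints, which is the image of the
straight segment with endpoints `x` and `y`. -/
def geodesic (b : Module.Basis (Fin 2) ℝ EPlane) (x y : EPlane) : Set (FlatTorus b) :=
  proj b '' openSegment ℝ x y

/-- The open triangle of the plane with corners `x`, `y`, `z`. -/
def openTriangle (x y z : EPlane) : Set EPlane :=
  interior (convexHull ℝ {x, y, z})

/-- The image in the torus of the open triangle with corners `x`, `y`, `z`. -/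
def triangle (b : Module.Basis (Fin 2) ℝ EPlane) (x y z : EPlane) : Set (FlatTorus b) :=
  proj b '' openTriangle x y z

/-- A geometric triangulation of the flat torus with vertex set `V`: finitely many edges and
faces which, together with the vertices, partition the torus. The edges are embedded (open)
locally geodesic segments with endpoints in `V`; the faces are embedded open geodesic triangles
whose corners are vertices and whose sides are edges. The three corners of a face, or the two
endpoints of an edge, need not be distinct on the torus, and several edges may have the same
endpoints. -/
@[ext]
structure GeometricTriangulation (b : Module.Basis (Fin 2) ℝ EPlane)
    (V : Set (FlatTorus b)) where
  /-- the (open) edges, as subsets of the torus -/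
  edges : Set (Set (FlatTorus b))
  /-- the (open) faces, as subsets of the torus -/
  faces : Set (Set (FlatTorus b))
  finite_edges : edges.Finite
  finite_faces : faces.Finite
  edge_geodesic : ∀ e ∈ edges, ∃ x y : EPlane, x ≠ y ∧ proj b x ∈ V ∧ proj b y ∈ V ∧
    Set.InjOn (proj b) (openSegment ℝ x y) ∧ e = geodesic b x y
  face_triangle : ∀ f ∈ faces, ∃ x y z : EPlane, AffineIndependent ℝ ![x, y, z] ∧
    proj b x ∈ V ∧ proj b y ∈ V ∧ proj b z ∈ V ∧
    geodesic b x y ∈ edges ∧ geodesic b y z ∈ edges ∧ geodesic b z x ∈ edges ∧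
    Set.InjOn (proj b) (openTriangle x y z) ∧ f = triangle b x y z
  isPartition : Setoid.IsPartition ((fun v => ({v} : Set (FlatTorus b))) '' V ∪ edges ∪ faces)

/-- `T'` is obtained from `T` by flipping one edge. There are two distinct triangles `v₁ v₂ v₃`
and `v₂ v₁ v₄` of the plane which are lifts of faces of `T` and share the side `v₁ v₂`, a lift of
an edge of `T`. In the quadrilateral they form, the diagonal `v₁ v₂` is replaced by the other
diagonal `v₃ v₄`, and the two triangles by `v₃ v₄ v₂` and `v₄ v₃ v₁`; everything is then projected
to the torus. -/
def IsFlip {b : Module.Basis (Fin 2) ℝ EPlane} {V : Set (FlatTorus b)}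
    (T T' : GeometricTriangulation b V) : Prop :=
  ∃ v₁ v₂ v₃ v₄ : EPlane, v₃ ≠ v₄ ∧
    geodesic b v₁ v₂ ∈ T.edges ∧
    triangle b v₁ v₂ v₃ ∈ T.faces ∧ triangle b v₂ v₁ v₄ ∈ T.faces ∧
    T'.edges = (T.edges \ {geodesic b v₁ v₂}) ∪ {geodesic b v₃ v₄} ∧
    T'.faces = (T.faces \ {triangle b v₁ v₂ v₃, triangle b v₂ v₁ v₄}) ∪
      {triangle b v₃ v₄ v₂, triangle b v₄ v₃ v₁}

/-- The geometric flip graph: its vertices are the geometric triangulations of the flat torus with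
vertex set `V`; two of them are adjacent if and only if they are related by a flip. -/
def geometricFlipGraph (b : Module.Basis (Fin 2) ℝ EPlane) (V : Set (FlatTorus b)) :
    SimpleGraph (GeometricTriangulation b V) :=
  SimpleGraph.fromRel IsFlip

end FlatTorus

open Set Filter Topology

namespace FlatTorus

variable {b : Module.Basis (Fin 2) ℝ EPlane} {V : Set (FlatTorus b)}

/-! Segments, triangles and flips are affine notions, so "Delaunay" may be taken with respect to any
positive definite quadratic form q instead of the Euclidean one. In the family `quad s`, all but
countably many s are generic: no four vertices in the plane lie on a common q-circle
(`exists_generic`). For such q the Delaunay triangles tile the plane and project to a triangulation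
of the torus (`isComplex_isDelaunay`, `toTriangulation`), and no other triangulation has only
Delaunay faces (`eq_of_isDelaunay`). It remains to reach it by flips from any triangulation.

Lift a triangulation to the plane and let its height be the function that equals q at the vertices
and is affine on each triangle. At an edge that is not locally Delaunay the two adjacent triangles
form a strictly convex quadrilateral, and the flip lowers the height somewhere and raises it nowhere
(`exists_improving_flip`). Height minus q is bounded above, and at the midpoint of an edge it is a
quarter of the squared q-length of that edge; hence only finitely many triangulations lie below a
given height (`finite_height_le`). A minimal one among those reachable by flips is therefore locally
Delaunay. Locally Delaunay implies Delaunay because the height is convex along suitable segments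
from a triangle to a vertex (`IsComplex.interp_le`).

A recurring device is an identity quantified over all f : ℝ²→ℝ between weighted sums of f at
corners. It says that two formal combinations of points agree as finitely supported signed measures,
so corners can be recovered from it with indicator functions. `IsComplex.uniq` uses it to state in
one formula that closed triangles meet only along common faces. -/

/-! ### Signed areas, barycentric coordinates and open triangles. -/

theorem ext_coord {p q : EPlane} (h0 : p 0 = q 0) (h1 : p 1 = q 1) : p = q := by
  ext i; fin_cases i <;> assumption

theorem comb_coord (x y z : EPlane) (a b c : ℝ) (i : Fin 2) :
    (a • x + b • y + c • z) i = a * x i + b * y i + c * z i := by simp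

/-- Twice the signed area of the triangle with corners `x`, `y`, `z`. -/
def det3 (x y z : EPlane) : ℝ :=
  (y 0 - x 0) * (z 1 - x 1) - (y 1 - x 1) * (z 0 - x 0)

theorem det3_rot (x y z : EPlane) : det3 y z x = det3 x y z := by unfold det3; ring

theorem det3_swap (x y z : EPlane) : det3 y x z = - det3 x y z := by unfold det3; ring

theorem det3_add (x y z v : EPlane) : det3 (x + v) (y + v) (z + v) = det3 x y z := by
  simp [det3]

theorem det3_comb {x y z : EPlane} {a b c : ℝ} (h : a + b + c = 1) :
    det3 x y (a • x + b • y + c • z) = c * det3 x y z := by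
  obtain rfl : a = 1 - b - c := by linarith
  simp only [det3, comb_coord]; ring

theorem exists_comb {x y z : EPlane} (h : det3 x y z ≠ 0) (p : EPlane) :
    ∃ a b c : ℝ, a + b + c = 1 ∧ p = a • x + b • y + c • z := by
  refine ⟨det3 p y z / det3 x y z, det3 x p z / det3 x y z, det3 x y p / det3 x y z, ?_, ?_⟩
  · field_simp; unfold det3; ring
  · apply ext_coord <;> rw [comb_coord] <;> field_simp <;> unfold det3 <;> ring

theorem comb_eq_zero {x y z : EPlane} (h : det3 x y z ≠ 0) {a b c : ℝ}
    (hs : a + b + c = 0) (he : a • x + b • y + c • z = 0) : a = 0 ∧ b = 0 ∧ c = 0 := by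
  have h0 := congrArg (fun v : EPlane => v 0) he
  have h1 := congrArg (fun v : EPlane => v 1) he
  simp only [comb_coord, PiLp.zero_apply] at h0 h1
  obtain rfl : a = -b - c := by linarith
  have hb : b * det3 x y z = 0 := by
    unfold det3; linear_combination (z 1 - x 1) * h0 - (z 0 - x 0) * h1
  have hc : c * det3 x y z = 0 := by
    unfold det3; linear_combination (y 0 - x 0) * h1 - (y 1 - x 1) * h0
  have hb := (mul_eq_zero.1 hb).resolve_right h
  have hc := (mul_eq_zero.1 hc).resolve_right h
  subst hb hc; simp

theorem comb_inj {x y z : EPlane} (h : det3 x y z ≠ 0) {a b c a' b' c' : ℝ}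
    (hs : a + b + c = a' + b' + c')
    (he : a • x + b • y + c • z = a' • x + b' • y + c' • z) : a = a' ∧ b = b' ∧ c = c' := by
  have := comb_eq_zero (a := a - a') (b := b - b') (c := c - c') h (by linarith) (by
    rw [← sub_eq_zero] at he; rw [← he]; module)
  simpa only [sub_eq_zero] using this

theorem affineIndependent_iff_det3 {x y z : EPlane} :
    AffineIndependent ℝ ![x, y, z] ↔ det3 x y z ≠ 0 := by
  constructor
  · intro h h0
    rw [affineIndependent_iff_not_collinear_set] at h
    apply h
    rw [collinear_iff_of_mem (p₀ := x) (by simp)]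
    by_cases hxy : x = y
    · subst hxy
      refine ⟨z - x, ?_⟩
      rintro p (rfl | rfl | rfl)
      · exact ⟨0, by simp⟩
      · exact ⟨0, by simp⟩
      · exact ⟨1, by simp⟩
    · have hn : (y 0 - x 0) ^ 2 + (y 1 - x 1) ^ 2 ≠ 0 := by
        intro h
        apply hxy
        apply ext_coord <;> nlinarith [sq_nonneg (y 0 - x 0), sq_nonneg (y 1 - x 1)]
      refine ⟨y - x, ?_⟩
      rintro p (rfl | rfl | rfl)
      · exact ⟨0, by simp⟩
      · exact ⟨1, by simp⟩
      · refine ⟨((y 0 - x 0) * (p 0 - x 0) + (y 1 - x 1) * (p 1 - x 1)) /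
          ((y 0 - x 0) ^ 2 + (y 1 - x 1) ^ 2), ?_⟩
        unfold det3 at h0
        apply ext_coord <;> simp <;> field_simp
        · linear_combination (-(y 1 - x 1)) * h0
        · linear_combination (y 0 - x 0) * h0
  · intro h
    rw [affineIndependent_iff]
    intro s w hw he
    have hs : ∀ (f : Fin 3 → EPlane), ∑ e ∈ s, w e • f e
        = ∑ e, (if e ∈ s then w e else 0) • f e := by
      intro f; simp [Finset.sum_ite_mem, ite_smul]
    have hs' : ∑ e ∈ s, w e = ∑ e, (if e ∈ s then w e else 0) := by
      simp [Finset.sum_ite_mem]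
    rw [hs'] at hw
    rw [hs] at he
    rw [Fin.sum_univ_three] at hw he
    have := comb_eq_zero h hw (by simpa using he)
    intro i hi
    fin_cases i <;> simp_all

theorem mem_convexHull_triple {x y z p : EPlane} :
    p ∈ convexHull ℝ {x, y, z} ↔ ∃ a b c : ℝ, 0 ≤ a ∧ 0 ≤ b ∧ 0 ≤ c ∧ a + b + c = 1 ∧
      p = a • x + b • y + c • z := by
  constructor
  · intro hp
    refine convexHull_min (t := {p | ∃ a b c : ℝ, 0 ≤ a ∧ 0 ≤ b ∧ 0 ≤ c ∧ a + b + c = 1 ∧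
      p = a • x + b • y + c • z}) ?_ ?_ hp
    · rintro p (rfl | rfl | rfl)
      · exact ⟨1, 0, 0, by simp⟩
      · exact ⟨0, 1, 0, by simp⟩
      · exact ⟨0, 0, 1, by simp⟩
    · rintro _ ⟨a, b, c, ha, hb, hc, h1, rfl⟩ _ ⟨a', b', c', ha', hb', hc', h1', rfl⟩ s t hs ht hst
      refine ⟨s * a + t * a', s * b + t * b', s * c + t * c', by positivity, by positivity,
        by positivity, ?_, by module⟩
      linear_combination s * h1 + t * h1' + hst
  · rintro ⟨a, b, c, ha, hb, hc, h1, rfl⟩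
    have hC := convex_convexHull ℝ ({x, y, z} : Set EPlane)
    have h := hC.sum_mem (t := Finset.univ) (w := ![a, b, c]) (z := ![x, y, z])
      (by intro i _; fin_cases i <;> assumption) (by simpa [Fin.sum_univ_three] using h1)
      (by intro i _; apply subset_convexHull; fin_cases i <;> simp)
    simpa [Fin.sum_univ_three] using h

theorem continuous_det3 (y z : EPlane) : Continuous fun p => det3 p y z := by
  unfold det3; fun_prop

/-- From an interior point one can still move a little in a direction that lowers a chosen
coordinate, so no coordinate is zero. Conversely, the coordinates are quotients of signed areas,
hence continuous, and their positivity is an open condition. -/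
theorem mem_openTriangle {x y z p : EPlane} (h : det3 x y z ≠ 0) :
    p ∈ openTriangle x y z ↔ ∃ a b c : ℝ, 0 < a ∧ 0 < b ∧ 0 < c ∧ a + b + c = 1 ∧
      p = a • x + b • y + c • z := by
  constructor
  · intro hp
    obtain ⟨a, b, c, -, -, -, h1, rfl⟩ := mem_convexHull_triple.1 (interior_subset hp)
    have key : ∀ d : EPlane, ∃ ε > (0 : ℝ), a • x + b • y + c • z + ε • d ∈ convexHull ℝ {x, y, z} := by
      intro d
      have hc : Continuous fun ε : ℝ => a • x + b • y + c • z + ε • d := by fun_prop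
      have hm : ∀ᶠ ε in 𝓝 (0 : ℝ), a • x + b • y + c • z + ε • d ∈ openTriangle x y z :=
        hc.continuousAt.eventually_mem (isOpen_interior.mem_nhds (by simpa [openTriangle] using hp))
      obtain ⟨ε, he, h0⟩ := ((hm.filter_mono nhdsWithin_le_nhds).and
        (self_mem_nhdsWithin (s := Ioi (0 : ℝ)))).exists
      exact ⟨ε, h0, interior_subset he⟩
    refine ⟨a, b, c, ?_, ?_, ?_, h1, rfl⟩
    · obtain ⟨ε, h0, he⟩ := key (y - x)
      obtain ⟨a', b', c', ha, hb, hc, h1', he⟩ := mem_convexHull_triple.1 he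
      have := comb_inj (a := a - ε) (b := b + ε) (c := c) h (by linarith : _ = a' + b' + c') (by rw [← he]; module)
      linarith
    · obtain ⟨ε, h0, he⟩ := key (x - y)
      obtain ⟨a', b', c', ha, hb, hc, h1', he⟩ := mem_convexHull_triple.1 he
      have := comb_inj (a := a + ε) (b := b - ε) (c := c) h (by linarith : _ = a' + b' + c') (by rw [← he]; module)
      linarith
    · obtain ⟨ε, h0, he⟩ := key (x - z)
      obtain ⟨a', b', c', ha, hb, hc, h1', he⟩ := mem_convexHull_triple.1 he
      have := comb_inj (a := a + ε) (b := b) (c := c - ε) h (by linarith : _ = a' + b' + c') (by rw [← he]; module)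
      linarith
  · rintro ⟨a, b, c, ha, hb, hc, h1, rfl⟩
    have hform : ∀ a b c : ℝ, a + b + c = 1 →
        det3 (a • x + b • y + c • z) y z / det3 x y z = a ∧
        det3 (a • x + b • y + c • z) z x / det3 x y z = b ∧
        det3 (a • x + b • y + c • z) x y / det3 x y z = c := by
      intro a b c h1
      obtain rfl : a = 1 - b - c := by linarith
      refine ⟨?_, ?_, ?_⟩ <;> field_simp <;> simp only [det3, comb_coord] <;> ring
    rw [openTriangle, mem_interior]
    refine ⟨{p | 0 < det3 p y z / det3 x y z ∧ 0 < det3 p z x / det3 x y z ∧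
      0 < det3 p x y / det3 x y z}, ?_, ?_, ?_⟩
    · rintro p ⟨h1, h2, h3⟩
      obtain ⟨a, b, c, hs, rfl⟩ := exists_comb h p
      obtain ⟨e1, e2, e3⟩ := hform a b c hs
      rw [e1] at h1; rw [e2] at h2; rw [e3] at h3
      exact mem_convexHull_triple.2 ⟨a, b, c, h1.le, h2.le, h3.le, hs, rfl⟩
    · refine IsOpen.inter ?_ (IsOpen.inter ?_ ?_)
      all_goals exact isOpen_lt continuous_const ((continuous_det3 _ _).div_const _)
    · obtain ⟨e1, e2, e3⟩ := hform a b c h1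
      exact ⟨by rwa [e1], by rwa [e2], by rwa [e3]⟩

theorem isCompact_convexHull_triple (x y z : EPlane) : IsCompact (convexHull ℝ {x, y, z}) :=
  (Set.toFinite _).isCompact_convexHull ℝ

theorem isOpen_openTriangle (x y z : EPlane) : IsOpen (openTriangle x y z) := isOpen_interior

theorem isPreconnected_openTriangle (x y z : EPlane) : IsPreconnected (openTriangle x y z) :=
  (convex_convexHull ℝ _).interior.isPreconnected

theorem openTriangle_nonempty {x y z : EPlane} (h : det3 x y z ≠ 0) :
    (openTriangle x y z).Nonempty :=
  ⟨_, (mem_openTriangle h).2 ⟨1 / 3, 1 / 3, 1 / 3, by norm_num, by norm_num, by norm_num,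
    by norm_num, rfl⟩⟩

theorem closure_openTriangle {x y z : EPlane} (h : det3 x y z ≠ 0) :
    closure (openTriangle x y z) = convexHull ℝ {x, y, z} := by
  rw [openTriangle, (convex_convexHull ℝ _).closure_interior_eq_closure_of_nonempty_interior
    (openTriangle_nonempty h), (isCompact_convexHull_triple x y z).isClosed.closure_eq]

theorem openTriangle_congr {x y z x' y' z' : EPlane}
    (h : ({x, y, z} : Set EPlane) = {x', y', z'}) : openTriangle x y z = openTriangle x' y' z' := by
  rw [openTriangle, h, openTriangle]

theorem openTriangle_rot (x y z : EPlane) : openTriangle y z x = openTriangle x y z :=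
  openTriangle_congr (by ext; simp; tauto)

theorem openTriangle_swap (x y z : EPlane) : openTriangle y x z = openTriangle x y z :=
  openTriangle_congr (by ext; simp; tauto)

theorem mem_extremePoints_triple {x y z : EPlane} (h : det3 x y z ≠ 0) :
    x ∈ (convexHull ℝ {x, y, z}).extremePoints ℝ := by
  rw [mem_extremePoints]
  refine ⟨subset_convexHull ℝ _ (by simp), ?_⟩
  have key : ∀ x₁ ∈ convexHull ℝ {x, y, z}, ∀ x₂ ∈ convexHull ℝ {x, y, z},
      x ∈ openSegment ℝ x₁ x₂ → x₁ = x := by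
    intro x₁ h₁ x₂ h₂ hx
    obtain ⟨a, b, c, ha, hb, hc, h1, rfl⟩ := mem_convexHull_triple.1 h₁
    obtain ⟨a', b', c', ha', hb', hc', h1', rfl⟩ := mem_convexHull_triple.1 h₂
    obtain ⟨s, t, hs, ht, hst, he⟩ := hx
    obtain ⟨-, e2, e3⟩ := comb_inj (a := s * a + t * a') (b := s * b + t * b')
      (c := s * c + t * c') (a' := 1) (b' := 0) (c' := 0) h
      (by linear_combination s * h1 + t * h1' + hst) (by
        rw [one_smul, zero_smul, zero_smul, add_zero, add_zero]
        refine Eq.trans ?_ he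
        module)
    have hb0 : b = 0 := by
      have : 0 ≤ t * b' := by positivity
      have : 0 ≤ s * b := by positivity
      have : s * b = 0 := by linarith
      exact (mul_eq_zero.1 this).resolve_left hs.ne'
    have hc0 : c = 0 := by
      have : 0 ≤ t * c' := by positivity
      have : 0 ≤ s * c := by positivity
      have : s * c = 0 := by linarith
      exact (mul_eq_zero.1 this).resolve_left hs.ne'
    subst hb0 hc0
    obtain rfl : a = 1 := by linarith
    simp
  intro x₁ h₁ x₂ h₂ hx
  exact ⟨key x₁ h₁ x₂ h₂ hx, key x₂ h₂ x₁ h₁ (by rwa [openSegment_symm])⟩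

theorem triple_rot (x y z : EPlane) : ({y, z, x} : Set EPlane) = {x, y, z} := by
  ext; simp; tauto

theorem triple_swap (x y z : EPlane) : ({y, x, z} : Set EPlane) = {x, y, z} := by
  ext; simp; tauto

theorem extremePoints_triple {x y z : EPlane} (h : det3 x y z ≠ 0) :
    (convexHull ℝ {x, y, z}).extremePoints ℝ = {x, y, z} := by
  apply subset_antisymm extremePoints_convexHull_subset
  rintro p (rfl | rfl | rfl)
  · exact mem_extremePoints_triple h
  · rw [← triple_rot]
    exact mem_extremePoints_triple (by rwa [det3_rot])
  · rw [← triple_rot, ← triple_rot]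
    exact mem_extremePoints_triple (by rwa [det3_rot, det3_rot])

/-- The corners are the extreme points of the closure. -/
theorem vertices_eq_of_openTriangle_eq {x y z x' y' z' : EPlane} (h : det3 x y z ≠ 0)
    (h' : det3 x' y' z' ≠ 0) (he : openTriangle x y z = openTriangle x' y' z') :
    ({x, y, z} : Set EPlane) = {x', y', z'} := by
  rw [← extremePoints_triple h, ← extremePoints_triple h', ← closure_openTriangle h,
    ← closure_openTriangle h', he]

/-- Test the identity on the indicator of the complement of `{x', y', z'}`: the right side vanishes,
while on the left nothing can cancel the mass `a` at `x`. -/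
theorem mem_triple_of_comb {x y z x' y' z' : EPlane} {a b c a' b' c' : ℝ} (ha : 0 < a)
    (hb : 0 ≤ b) (hc : 0 ≤ c)
    (h : ∀ f : EPlane → ℝ, a * f x + b * f y + c * f z = a' * f x' + b' * f y' + c' * f z') :
    x ∈ ({x', y', z'} : Set EPlane) := by
  classical
  by_contra hx
  have := h (fun v => if v ∈ ({x', y', z'} : Set EPlane) then 0 else 1)
  simp only [hx, mem_insert_iff, true_or, or_true, mem_singleton_iff, if_true, if_false] at this
  have h1 : 0 ≤ b * (if y = x' ∨ y = y' ∨ y = z' then (0 : ℝ) else 1) := by positivity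
  have h2 : 0 ≤ c * (if z = x' ∨ z = y' ∨ z = z' then (0 : ℝ) else 1) := by positivity
  simp only [mem_insert_iff, mem_singleton_iff] at hx
  linarith

theorem exists_comb_of_mem_triple {x y z v : EPlane} (h : v ∈ ({x, y, z} : Set EPlane)) :
    ∃ a b c : ℝ, ∀ f : EPlane → ℝ, f v = a * f x + b * f y + c * f z := by
  rcases h with rfl | rfl | rfl
  · exact ⟨1, 0, 0, by simp⟩
  · exact ⟨0, 1, 0, by simp⟩
  · exact ⟨0, 0, 1, by simp⟩

theorem comb_eq_of_comb {x y z x' y' z' : EPlane} {a b c a' b' c' : ℝ}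
    (h : ∀ f : EPlane → ℝ, a * f x + b * f y + c * f z = a' * f x' + b' * f y' + c' * f z') :
    a • x + b • y + c • z = a' • x' + b' • y' + c' • z' := by
  apply ext_coord <;> simp only [comb_coord]
  · exact h fun v => v 0
  · exact h fun v => v 1

/-- Barycentric coordinates with respect to the same affinely independent set agree. -/
theorem comb_congr {x y z x' y' z' : EPlane} (h : det3 x y z ≠ 0) {a b c a' b' c' : ℝ}
    (hv : ({x', y', z'} : Set EPlane) ⊆ {x, y, z}) (hs : a + b + c = a' + b' + c')
    (he : a • x + b • y + c • z = a' • x' + b' • y' + c' • z') (f : EPlane → ℝ) :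
    a * f x + b * f y + c * f z = a' * f x' + b' * f y' + c' * f z' := by
  obtain ⟨a₁, b₁, c₁, h₁⟩ := exists_comb_of_mem_triple (hv (by simp : x' ∈ _))
  obtain ⟨a₂, b₂, c₂, h₂⟩ := exists_comb_of_mem_triple (hv (by simp : y' ∈ _))
  obtain ⟨a₃, b₃, c₃, h₃⟩ := exists_comb_of_mem_triple (hv (by simp : z' ∈ _))
  have key : ∀ f : EPlane → ℝ, a' * f x' + b' * f y' + c' * f z' =
      (a' * a₁ + b' * a₂ + c' * a₃) * f x + (a' * b₁ + b' * b₂ + c' * b₃) * f y +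
      (a' * c₁ + b' * c₂ + c' * c₃) * f z := by
    intro f; rw [h₁ f, h₂ f, h₃ f]; ring
  obtain ⟨e1, e2, e3⟩ := comb_inj h (by have := key 1; simp at this; linarith)
    (he.trans (comb_eq_of_comb key))
  rw [key, e1, e2, e3]

/-! ### The lattice, the lifted vertices, and points off all lines through two of them. -/

/-- The lattice of translations which defines the torus. -/
abbrev lattice (b : Module.Basis (Fin 2) ℝ EPlane) : Submodule ℤ EPlane :=
  Submodule.span ℤ (Set.range b)


theorem proj_eq_iff {x y : EPlane} : proj b x = proj b y ↔ ∃ v ∈ lattice b, y = x + v := by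
  unfold proj
  rw [QuotientAddGroup.eq]
  constructor
  · intro h; exact ⟨_, h, by abel⟩
  · rintro ⟨v, hv, rfl⟩; simpa using hv

theorem proj_add {x v : EPlane} (hv : v ∈ lattice b) : proj b (x + v) = proj b x :=
  (proj_eq_iff.2 ⟨v, hv, rfl⟩).symm

theorem proj_surjective : Function.Surjective (proj b) := QuotientAddGroup.mk_surjective

theorem finite_lattice (R : ℝ) : {v | v ∈ lattice b ∧ ‖v‖ ≤ R}.Finite := by
  refine (ZSpan.setFinite_inter b (Metric.isBounded_closedBall (x := (0 : EPlane)) (r := R))).subset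
    ?_
  rintro v ⟨hv, h⟩
  exact ⟨by simpa using h, hv⟩

theorem finite_preimage_norm (hfin : V.Finite) (p : EPlane) (R : ℝ) :
    {x | proj b x ∈ V ∧ ‖x - p‖ ≤ R}.Finite := by
  have : {x | proj b x ∈ V ∧ ‖x - p‖ ≤ R} = ⋃ v ∈ V, {x | proj b x = v ∧ ‖x - p‖ ≤ R} := by
    ext x; simp
  rw [this]
  refine hfin.biUnion fun v _ => ?_
  obtain ⟨u, rfl⟩ := proj_surjective v
  refine ((finite_lattice (b := b) (R + ‖p - u‖)).image (fun w => u + w)).subset ?_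
  rintro x ⟨hx, hR⟩
  obtain ⟨w, hw, rfl⟩ := proj_eq_iff.1 hx.symm
  refine ⟨w, ⟨hw, ?_⟩, rfl⟩
  calc ‖w‖ = ‖(u + w - p) + (p - u)‖ := by congr 1; abel
    _ ≤ _ := (norm_add_le _ _).trans (by gcongr)

theorem countable_preimage (hfin : V.Finite) : (proj b ⁻¹' V).Countable := by
  have : proj b ⁻¹' V ⊆ ⋃ n : ℕ, {x | proj b x ∈ V ∧ ‖x - 0‖ ≤ (n : ℝ)} := by
    intro x hx
    obtain ⟨n, hn⟩ := exists_nat_ge ‖x - 0‖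
    exact mem_iUnion.2 ⟨n, hx, hn⟩
  refine Set.Countable.mono this (countable_iUnion fun n : ℕ => ?_)
  exact (finite_preimage_norm hfin 0 n).countable

theorem exists_preimage_near (hne : V.Nonempty) :
    ∃ R : ℝ, 0 < R ∧ ∀ p, ∃ x, proj b x ∈ V ∧ ‖x - p‖ ≤ R := by
  obtain ⟨v, hv⟩ := hne
  obtain ⟨u, rfl⟩ := proj_surjective v
  refine ⟨∑ i, ‖b i‖ + 1, by positivity, fun p => ⟨u + ZSpan.floor b (p - u), ?_, ?_⟩⟩
  · rwa [proj_add (ZSpan.floor b (p - u)).2]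
  · have h := ZSpan.norm_fract_le b (p - u)
    rw [ZSpan.fract_apply] at h
    rw [← norm_neg]
    refine le_trans (le_of_eq ?_) (h.trans (by linarith))
    congr 1; abel

/-- The points which do not lie on a line through two points of `P`. -/
def offLines (P : Set EPlane) : Set EPlane :=
  {p | ∀ x ∈ P, ∀ y ∈ P, x ≠ y → ∀ t : ℝ, p ≠ x + t • (y - x)}

/-- Countably many lines have measure zero. Such points serve as generic interior points of faces:
they avoid all vertices and edges. -/
theorem dense_offLines {P : Set EPlane} (hP : P.Countable) : Dense (offLines P) := by
  apply MeasureTheory.Measure.dense_of_ae (μ := MeasureTheory.volume)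
  rw [MeasureTheory.ae_ball_iff hP]
  intro x _
  rw [MeasureTheory.ae_ball_iff hP]
  intro y _
  by_cases hxy : x = y
  · simp [hxy]
  have h0 : MeasureTheory.volume (line[ℝ, x, y] : Set EPlane) = 0 := by
    apply MeasureTheory.Measure.addHaar_affineSubspace
    intro h
    have h1 : Module.finrank ℝ (line[ℝ, x, y]).direction = 2 := by
      rw [h, AffineSubspace.direction_top, finrank_top]; simp
    rw [direction_affineSpan] at h1
    have := finrank_vectorSpan_insert_le_set ℝ ({y} : Set EPlane) x
    simp [vectorSpan_singleton, h1] at this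
  filter_upwards [MeasureTheory.measure_eq_zero_iff_ae_notMem.1 h0] with p hp _ t ht
  apply hp
  rw [ht]
  have := AffineMap.lineMap_mem_affineSpan_pair t x y
  rwa [AffineMap.lineMap_apply, vsub_eq_sub, vadd_eq_add, add_comm] at this

theorem exists_of_det3_eq_zero {x y z : EPlane} (h0 : det3 x y z = 0) (hxy : x ≠ y) :
    ∃ t : ℝ, z = x + t • (y - x) := by
  have hn : (y 0 - x 0) ^ 2 + (y 1 - x 1) ^ 2 ≠ 0 := by
    intro h
    apply hxy
    apply ext_coord <;> nlinarith [sq_nonneg (y 0 - x 0), sq_nonneg (y 1 - x 1)]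
  refine ⟨((y 0 - x 0) * (z 0 - x 0) + (y 1 - x 1) * (z 1 - x 1)) /
    ((y 0 - x 0) ^ 2 + (y 1 - x 1) ^ 2), ?_⟩
  unfold det3 at h0
  apply ext_coord <;> simp <;> field_simp
  · linear_combination (-(y 1 - x 1)) * h0
  · linear_combination (y 0 - x 0) * h0

theorem ne_of_det3 {x y z : EPlane} (h : det3 x y z ≠ 0) : x ≠ y ∧ y ≠ z ∧ z ≠ x := by
  refine ⟨?_, ?_, ?_⟩ <;> rintro rfl <;> apply h <;> unfold det3 <;> ring

/-- A lifted vertex lies on the line joining it to its own translate by `b 0`. -/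
theorem notMem_of_mem_offLines {p : EPlane} (hp : p ∈ offLines (proj b ⁻¹' V)) :
    proj b p ∉ V := by
  intro h
  have hb : b 0 ∈ lattice b := Submodule.subset_span ⟨0, rfl⟩
  refine hp p h (p + b 0) ?_ ?_ 0 (by simp)
  · rwa [mem_preimage, proj_add hb]
  · simp [b.ne_zero]

theorem comb_ne_zero_of_mem_offLines {P : Set EPlane} {p x y z : EPlane} {a₁ a₂ a₃ : ℝ}
    (hp : p ∈ offLines P) (hx : x ∈ P) (hy : y ∈ P) (hxy : x ≠ y) (h1 : a₁ + a₂ + a₃ = 1)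
    (he : p = a₁ • x + a₂ • y + a₃ • z) : a₃ ≠ 0 := by
  rintro rfl
  refine hp x hx y hy hxy a₂ ?_
  obtain rfl : a₁ = 1 - a₂ := by linarith
  rw [he]; module

theorem det3_ne_zero_of_mem_offLines {p x y z : EPlane} {a₁ a₂ a₃ : ℝ}
    (hp : p ∈ offLines (proj b ⁻¹' V)) (hx : proj b x ∈ V) (hy : proj b y ∈ V)
    (hz : proj b z ∈ V) (h1 : a₁ + a₂ + a₃ = 1)
    (he : p = a₁ • x + a₂ • y + a₃ • z) : det3 x y z ≠ 0 := by
  intro h0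
  obtain rfl : a₁ = 1 - a₂ - a₃ := by linarith
  by_cases hxy : x = y
  · subst hxy
    by_cases hxz : x = z
    · subst hxz
      apply notMem_of_mem_offLines hp
      convert hx
      rw [he]; module
    · refine hp x hx z hz hxz a₃ ?_
      rw [he]; module
  · obtain ⟨t, rfl⟩ := exists_of_det3_eq_zero h0 hxy
    refine hp x hx y hy hxy (a₂ + a₃ * t) ?_
    rw [he]; module

/-- If the triangle were degenerate or some weight zero, the point would lie on a line through two
vertices or be a vertex itself. -/
theorem comb_pos_of_mem_offLines {p x y z : EPlane} {a₁ a₂ a₃ : ℝ}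
    (hp : p ∈ offLines (proj b ⁻¹' V)) (hx : proj b x ∈ V) (hy : proj b y ∈ V)
    (hz : proj b z ∈ V) (h₁ : 0 ≤ a₁) (h₂ : 0 ≤ a₂) (h₃ : 0 ≤ a₃) (h1 : a₁ + a₂ + a₃ = 1)
    (he : p = a₁ • x + a₂ • y + a₃ • z) :
    det3 x y z ≠ 0 ∧ 0 < a₁ ∧ 0 < a₂ ∧ 0 < a₃ := by
  have hd := det3_ne_zero_of_mem_offLines hp hx hy hz h1 he
  obtain ⟨n1, n2, n3⟩ := ne_of_det3 hd
  refine ⟨hd, h₁.lt_of_ne' ?_, h₂.lt_of_ne' ?_, h₃.lt_of_ne' ?_⟩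
  · exact comb_ne_zero_of_mem_offLines hp hy hz n2 (a₁ := a₂) (a₂ := a₃) (by linarith)
      (by rw [he]; abel)
  · exact comb_ne_zero_of_mem_offLines hp hz hx n3 (a₁ := a₃) (a₂ := a₁) (by linarith)
      (by rw [he]; abel)
  · exact comb_ne_zero_of_mem_offLines hp hx hy n1 (a₁ := a₁) (a₂ := a₂) (by linarith) he

/-! ### Periodic triangulations of the plane. -/

/-- A periodic triangulation of the plane, given by the predicate saying which triples of points
are the corners of a triangle. -/
structure IsComplex (b : Module.Basis (Fin 2) ℝ EPlane) (V : Set (FlatTorus b))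
    (F : EPlane → EPlane → EPlane → Prop) : Prop where
  det_ne : ∀ {x y z}, F x y z → det3 x y z ≠ 0
  mem : ∀ {x y z}, F x y z → proj b x ∈ V
  rot : ∀ {x y z}, F x y z → F y z x
  swap : ∀ {x y z}, F x y z → F y x z
  trans : ∀ {x y z v}, v ∈ lattice b → F x y z → F (x + v) (y + v) (z + v)
  bound : ∃ C, ∀ {x y z}, F x y z → ‖x - y‖ ≤ C
  cover : ∀ p, ∃ (x y z : EPlane) (a₁ a₂ a₃ : ℝ), F x y z ∧ 0 ≤ a₁ ∧ 0 ≤ a₂ ∧ 0 ≤ a₃ ∧ a₁ + a₂ + a₃ = 1 ∧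
    p = a₁ • x + a₂ • y + a₃ • z
  vertex : ∀ {v}, proj b v ∈ V → ∃ x y, F v x y
  uniq : ∀ {x y z x' y' z' : EPlane} {a₁ a₂ a₃ a₁' a₂' a₃' : ℝ}, F x y z → F x' y' z' →
    0 ≤ a₁ → 0 ≤ a₂ → 0 ≤ a₃ → a₁ + a₂ + a₃ = 1 →
    0 ≤ a₁' → 0 ≤ a₂' → 0 ≤ a₃' → a₁' + a₂' + a₃' = 1 →
    a₁ • x + a₂ • y + a₃ • z = a₁' • x' + a₂' • y' + a₃' • z' → ∀ f : EPlane → ℝ,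
    a₁ * f x + a₂ * f y + a₃ * f z = a₁' * f x' + a₂' * f y' + a₃' * f z'

/-- Splits a point of a closed triangle by the number of vanishing weights into vertex, relative
interior of a side, and interior; rotation brings the side into first position. -/
theorem normalForm {F : EPlane → EPlane → EPlane → Prop}
    (hmem : ∀ {x y z}, F x y z → proj b x ∈ V) (hrot : ∀ {x y z}, F x y z → F y z x)
    {x y z : EPlane} {a₁ a₂ a₃ : ℝ} (hF : F x y z) (h₁ : 0 ≤ a₁) (h₂ : 0 ≤ a₂) (h₃ : 0 ≤ a₃)
    (h1 : a₁ + a₂ + a₃ = 1) :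
    (∃ v, proj b v ∈ V ∧ ∀ f : EPlane → ℝ, a₁ * f x + a₂ * f y + a₃ * f z = f v) ∨
    (∃ u v w s t, 0 < s ∧ 0 < t ∧ s + t = 1 ∧ F u v w ∧
      ∀ f : EPlane → ℝ, a₁ * f x + a₂ * f y + a₃ * f z = s * f u + t * f v) ∨
    (0 < a₁ ∧ 0 < a₂ ∧ 0 < a₃) := by
  rcases h₁.eq_or_lt with rfl | h₁ <;> rcases h₂.eq_or_lt with rfl | h₂ <;>
    rcases h₃.eq_or_lt with rfl | h₃
  · norm_num at h1
  · obtain rfl : a₃ = 1 := by linarith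
    exact .inl ⟨z, hmem (hrot (hrot hF)), by simp⟩
  · obtain rfl : a₂ = 1 := by linarith
    exact .inl ⟨y, hmem (hrot hF), by simp⟩
  · exact .inr (.inl ⟨y, z, x, _, _, h₂, h₃, by linarith, hrot hF, fun f => by ring⟩)
  · obtain rfl : a₁ = 1 := by linarith
    exact .inl ⟨x, hmem hF, by simp⟩
  · exact .inr (.inl ⟨z, x, y, _, _, h₃, h₁, by linarith, hrot (hrot hF), fun f => by ring⟩)
  · exact .inr (.inl ⟨x, y, z, _, _, h₁, h₂, by linarith, hF, fun f => by ring⟩)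
  · exact .inr (.inr ⟨h₁, h₂, h₃⟩)

theorem norm_comb_sub_le {x y z p : EPlane} {a₁ a₂ a₃ C : ℝ} (h₁ : 0 ≤ a₁) (h₂ : 0 ≤ a₂)
    (h₃ : 0 ≤ a₃) (h1 : a₁ + a₂ + a₃ = 1) (hx : ‖x - p‖ ≤ C) (hy : ‖y - p‖ ≤ C)
    (hz : ‖z - p‖ ≤ C) : ‖a₁ • x + a₂ • y + a₃ • z - p‖ ≤ C := by
  have : a₁ • x + a₂ • y + a₃ • z - p = a₁ • (x - p) + a₂ • (y - p) + a₃ • (z - p) := by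
    obtain rfl : a₁ = 1 - a₂ - a₃ := by linarith
    module
  rw [this]
  calc _ ≤ ‖a₁ • (x - p)‖ + ‖a₂ • (y - p)‖ + ‖a₃ • (z - p)‖ := norm_add₃_le
    _ = a₁ * ‖x - p‖ + a₂ * ‖y - p‖ + a₃ * ‖z - p‖ := by
      rw [norm_smul_of_nonneg h₁, norm_smul_of_nonneg h₂, norm_smul_of_nonneg h₃]
    _ ≤ a₁ * C + a₂ * C + a₃ * C := by gcongr
    _ = C := by rw [← add_mul, ← add_mul, h1, one_mul]

theorem finite_triples (hfin : V.Finite) {F : EPlane → EPlane → EPlane → Prop}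
    (hmem : ∀ {x y z}, F x y z → proj b x ∈ V) (hrot : ∀ {x y z}, F x y z → F y z x)
    {C : ℝ} (hC : ∀ {x y z}, F x y z → ‖x - y‖ ≤ C) (p : EPlane) (R : ℝ) :
    {t : EPlane × EPlane × EPlane | F t.1 t.2.1 t.2.2 ∧ ‖t.1 - p‖ ≤ R}.Finite := by
  have hA := finite_preimage_norm hfin p (R + C)
  have hA' := finite_preimage_norm hfin p R
  refine (hA'.prod (hA.prod hA)).subset ?_
  rintro ⟨x, y, z⟩ ⟨hF, hx⟩
  refine ⟨⟨hmem hF, hx⟩, ⟨hmem (hrot hF), ?_⟩, ⟨hmem (hrot (hrot hF)), ?_⟩⟩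
  · have h := hC hF
    rw [norm_sub_rev] at h
    calc ‖y - p‖ = ‖(x - p) + (y - x)‖ := by congr 1; abel
      _ ≤ _ := (norm_add_le _ _).trans (add_le_add hx h)
  · have h := hC (hrot (hrot hF))
    calc ‖z - p‖ = ‖(x - p) + (z - x)‖ := by congr 1; abel
      _ ≤ _ := (norm_add_le _ _).trans (add_le_add hx h)

theorem norm_sub_le_of_comb {F : EPlane → EPlane → EPlane → Prop}
    (hrot : ∀ {x y z}, F x y z → F y z x)
    {C : ℝ} (hC : ∀ {x y z}, F x y z → ‖x - y‖ ≤ C) {x y z : EPlane} {a₁ a₂ a₃ : ℝ}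
    (hF : F x y z) (h₁ : 0 ≤ a₁) (h₂ : 0 ≤ a₂) (h₃ : 0 ≤ a₃) (h1 : a₁ + a₂ + a₃ = 1) :
    ‖a₁ • x + a₂ • y + a₃ • z - x‖ ≤ C := by
  have h := hC hF
  refine norm_comb_sub_le h₁ h₂ h₃ h1 ?_ (by rwa [norm_sub_rev]) (hC (hrot (hrot hF)))
  simpa using (norm_nonneg _).trans h

/-- Only finitely many triangles come near `p`, so their union is closed; if it missed `p`, it would
miss a point of the dense set close to `p`. -/
theorem cover_of_dense (hfin : V.Finite) {F : EPlane → EPlane → EPlane → Prop}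
    (hmem : ∀ {x y z}, F x y z → proj b x ∈ V) (hrot : ∀ {x y z}, F x y z → F y z x)
    (hC : ∃ C, ∀ {x y z}, F x y z → ‖x - y‖ ≤ C) {D : Set EPlane} (hD : Dense D)
    (hcov : ∀ p ∈ D, ∃ (x y z : EPlane) (a₁ a₂ a₃ : ℝ), F x y z ∧ 0 ≤ a₁ ∧ 0 ≤ a₂ ∧ 0 ≤ a₃ ∧ a₁ + a₂ + a₃ = 1 ∧
      p = a₁ • x + a₂ • y + a₃ • z) (p : EPlane) :
    ∃ (x y z : EPlane) (a₁ a₂ a₃ : ℝ), F x y z ∧ 0 ≤ a₁ ∧ 0 ≤ a₂ ∧ 0 ≤ a₃ ∧ a₁ + a₂ + a₃ = 1 ∧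
      p = a₁ • x + a₂ • y + a₃ • z := by
  obtain ⟨C, hC⟩ := hC
  -- A triangle meeting the unit ball around `p` has its first corner within `C + 1` of `p`.
  set S := {t : EPlane × EPlane × EPlane | F t.1 t.2.1 t.2.2 ∧ ‖t.1 - p‖ ≤ C + 1}
  have hS : S.Finite := finite_triples hfin hmem hrot hC p (C + 1)
  have hcl : IsClosed (⋃ t ∈ S, convexHull ℝ ({t.1, t.2.1, t.2.2} : Set EPlane)) :=
    hS.isClosed_biUnion fun t _ => (isCompact_convexHull_triple _ _ _).isClosed
  have hp : p ∈ ⋃ t ∈ S, convexHull ℝ ({t.1, t.2.1, t.2.2} : Set EPlane) := by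
    by_contra hp
    obtain ⟨d, hdD, hd⟩ := hD.exists_mem_open
      (hcl.isOpen_compl.inter (Metric.isOpen_ball (x := p) (ε := 1))) ⟨p, hp, by simp⟩
    obtain ⟨x, y, z, a₁, a₂, a₃, hF, h₁, h₂, h₃, h1, rfl⟩ := hcov d hdD
    apply hd.1
    refine mem_biUnion (x := (x, y, z)) ⟨hF, ?_⟩
      (mem_convexHull_triple.2 ⟨_, _, _, h₁, h₂, h₃, h1, rfl⟩)
    have h2 := norm_sub_le_of_comb hrot hC hF h₁ h₂ h₃ h1
    have h3 : ‖a₁ • x + a₂ • y + a₃ • z - p‖ < 1 := by simpa [dist_eq_norm] using hd.2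
    rw [norm_sub_rev] at h2
    calc ‖x - p‖ = ‖(x - (a₁ • x + a₂ • y + a₃ • z)) + (a₁ • x + a₂ • y + a₃ • z - p)‖ := by
          congr 1; abel
      _ ≤ _ := (norm_add_le _ _).trans (add_le_add h2 h3.le)
  obtain ⟨t, ht, hp⟩ := mem_iUnion₂.1 hp
  obtain ⟨a₁, a₂, a₃, h⟩ := mem_convexHull_triple.1 hp
  exact ⟨_, _, _, a₁, a₂, a₃, ht.1, h⟩

/-! ### Lifting a triangulation of the torus to the plane. -/

theorem geodesic_symm (x y : EPlane) : geodesic b x y = geodesic b y x := by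
  rw [geodesic, openSegment_symm, geodesic]

theorem geodesic_add {v : EPlane} (hv : v ∈ lattice b) (x y : EPlane) :
    geodesic b (x + v) (y + v) = geodesic b x y := by
  have : openSegment ℝ (x + v) (y + v) = (fun p => p + v) '' openSegment ℝ x y := by
    ext p
    constructor
    · rintro ⟨s, t, hs, ht, hst, rfl⟩
      refine ⟨_, ⟨s, t, hs, ht, hst, rfl⟩, ?_⟩
      obtain rfl : s = 1 - t := by linarith
      module
    · rintro ⟨_, ⟨s, t, hs, ht, hst, rfl⟩, rfl⟩
      refine ⟨s, t, hs, ht, hst, ?_⟩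
      obtain rfl : s = 1 - t := by linarith
      module
  rw [geodesic, this, image_image, geodesic]
  exact image_congr fun p _ => proj_add hv

theorem mem_openTriangle_add {x y z p v : EPlane} (h : det3 x y z ≠ 0)
    (hp : p ∈ openTriangle x y z) : p + v ∈ openTriangle (x + v) (y + v) (z + v) := by
  rw [mem_openTriangle (by rwa [det3_add])]
  obtain ⟨a₁, a₂, a₃, h₁, h₂, h₃, h1, rfl⟩ := (mem_openTriangle h).1 hp
  refine ⟨a₁, a₂, a₃, h₁, h₂, h₃, h1, ?_⟩
  obtain rfl : a₁ = 1 - a₂ - a₃ := by linarith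
  module

theorem triangle_add {x y z v : EPlane} (h : det3 x y z ≠ 0) (hv : v ∈ lattice b) :
    triangle b (x + v) (y + v) (z + v) = triangle b x y z := by
  ext q
  constructor
  · rintro ⟨p, hp, rfl⟩
    have := mem_openTriangle_add (v := -v) (by rwa [det3_add]) hp
    simp only [add_neg_cancel_right] at this
    exact ⟨_, this, proj_add (neg_mem hv)⟩
  · rintro ⟨p, hp, rfl⟩
    exact ⟨_, mem_openTriangle_add h hp, proj_add hv⟩

theorem triangle_rot (x y z : EPlane) : triangle b y z x = triangle b x y z := by
  rw [triangle, openTriangle_rot, triangle]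

theorem triangle_swap (x y z : EPlane) : triangle b y x z = triangle b x y z := by
  rw [triangle, openTriangle_swap, triangle]

theorem mem_openSegment {x y : EPlane} {s t : ℝ} (hs : 0 < s) (ht : 0 < t) (hst : s + t = 1) :
    s • x + t • y ∈ openSegment ℝ x y := ⟨s, t, hs, ht, hst, rfl⟩

namespace GeometricTriangulation

variable (T : GeometricTriangulation b V)

/-- The triangle `x y z` of the plane is a lift of a face. -/
structure IsFace (x y z : EPlane) : Prop where
  det_ne : det3 x y z ≠ 0
  memx : proj b x ∈ V
  memy : proj b y ∈ V
  memz : proj b z ∈ V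
  xy : geodesic b x y ∈ T.edges
  yz : geodesic b y z ∈ T.edges
  zx : geodesic b z x ∈ T.edges
  face : triangle b x y z ∈ T.faces

variable {T}

theorem IsFace.rot {x y z : EPlane} (h : T.IsFace x y z) : T.IsFace y z x :=
  ⟨by rw [det3_rot]; exact h.1, h.3, h.4, h.2, h.6, h.7, h.5, by rw [triangle_rot]; exact h.8⟩

theorem IsFace.swap {x y z : EPlane} (h : T.IsFace x y z) : T.IsFace y x z :=
  ⟨by rw [det3_swap, neg_ne_zero]; exact h.1, h.3, h.2, h.4, by rw [geodesic_symm]; exact h.5,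
    by rw [geodesic_symm]; exact h.7, by rw [geodesic_symm]; exact h.6,
    by rw [triangle_swap]; exact h.8⟩

theorem IsFace.trans {x y z v : EPlane} (hv : v ∈ lattice b) (h : T.IsFace x y z) :
    T.IsFace (x + v) (y + v) (z + v) := by
  refine ⟨?_, ?_, ?_, ?_, ?_, ?_, ?_, ?_⟩
  · rw [det3_add]; exact h.1
  · rw [proj_add hv]; exact h.2
  · rw [proj_add hv]; exact h.3
  · rw [proj_add hv]; exact h.4
  · rw [geodesic_add hv]; exact h.5
  · rw [geodesic_add hv]; exact h.6
  · rw [geodesic_add hv]; exact h.7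
  · rw [triangle_add h.1 hv]; exact h.8

theorem exists_isFace {f : Set (FlatTorus b)} (hf : f ∈ T.faces) :
    ∃ x y z, T.IsFace x y z ∧ InjOn (proj b) (openTriangle x y z) ∧ f = triangle b x y z := by
  obtain ⟨x, y, z, h, hx, hy, hz, e1, e2, e3, hi, rfl⟩ := T.face_triangle f hf
  exact ⟨x, y, z, ⟨affineIndependent_iff_det3.1 h, hx, hy, hz, e1, e2, e3, hf⟩, hi, rfl⟩

theorem cell_eq {s s' : Set (FlatTorus b)} {p : FlatTorus b}
    (hs : s ∈ (fun v => ({v} : Set (FlatTorus b))) '' V ∪ T.edges ∪ T.faces)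
    (hs' : s' ∈ (fun v => ({v} : Set (FlatTorus b))) '' V ∪ T.edges ∪ T.faces)
    (hp : p ∈ s) (hp' : p ∈ s') : s = s' :=
  (T.isPartition.2 p).unique ⟨hs, hp⟩ ⟨hs', hp'⟩

/-- Cells sharing a point are equal, but an embedded segment has more than one point and so is no
singleton. -/
theorem notMem_of_mem_edge {e : Set (FlatTorus b)} {p : FlatTorus b} (he : e ∈ T.edges)
    (hp : p ∈ e) : p ∉ V := by
  intro hV
  have h := T.cell_eq (.inl (.inr he)) (.inl (.inl ⟨p, hV, rfl⟩)) hp rfl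
  obtain ⟨x, y, hxy, -, -, hi, rfl⟩ := T.edge_geodesic e he
  have m1 := mem_openSegment (x := x) (y := y) (s := 1 / 2) (t := 1 / 2)
    (by norm_num) (by norm_num) (by norm_num)
  have m2 := mem_openSegment (x := x) (y := y) (s := 1 / 3) (t := 2 / 3)
    (by norm_num) (by norm_num) (by norm_num)
  have h1 : proj b _ = p := h.subset (mem_image_of_mem _ m1)
  have h2 : proj b _ = p := h.subset (mem_image_of_mem _ m2)
  have h3 := hi m1 m2 (h1.trans h2.symm)
  apply hxy
  have : (1 / 6 : ℝ) • (x - y) = 0 := by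
    rw [← sub_eq_zero] at h3
    rw [← h3]; module
  rw [smul_eq_zero] at this
  exact sub_eq_zero.1 (this.resolve_left (by norm_num))

theorem notMem_edge_of_mem_offLines {e : Set (FlatTorus b)} {p : EPlane} (he : e ∈ T.edges)
    (hp : p ∈ offLines (proj b ⁻¹' V)) : proj b p ∉ e := by
  intro hpe
  obtain ⟨x, y, hxy, hx, hy, -, rfl⟩ := T.edge_geodesic e he
  obtain ⟨q, ⟨s, t, hs, ht, hst, rfl⟩, hq⟩ := hpe
  obtain ⟨v, hv, rfl⟩ := proj_eq_iff.1 hq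
  refine hp (x + v) ?_ (y + v) ?_ (by simpa using hxy) t ?_
  · rwa [mem_preimage, proj_add hv]
  · rwa [mem_preimage, proj_add hv]
  · obtain rfl : s = 1 - t := by linarith
    module

theorem IsFace.exists_offLines (hfin : V.Finite) {x y z : EPlane} (h : T.IsFace x y z) :
    ∃ p ∈ openTriangle x y z, p ∈ offLines (proj b ⁻¹' V) := by
  obtain ⟨d, hd, hd'⟩ := (dense_offLines (countable_preimage hfin)).exists_mem_open
    (isOpen_openTriangle x y z) (openTriangle_nonempty h.det_ne)
  exact ⟨d, hd', hd⟩

/-- If they met, edge and face would be the same cell; but a face contains points whose lifts are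
off all lines through two vertices, and an edge contains none. -/
theorem notMem_face_of_mem_edge (hfin : V.Finite) {e f : Set (FlatTorus b)} {p : FlatTorus b}
    (he : e ∈ T.edges) (hf : f ∈ T.faces) (hp : p ∈ e) : p ∉ f := by
  intro hpf
  obtain rfl := T.cell_eq (.inl (.inr he)) (.inr hf) hp hpf
  obtain ⟨x, y, z, hF, -, rfl⟩ := exists_isFace hf
  obtain ⟨q, hq, hq'⟩ := hF.exists_offLines hfin
  exact notMem_edge_of_mem_offLines he hq' ⟨q, hq, rfl⟩

theorem notMem_face_of_mem (hfin : V.Finite) {f : Set (FlatTorus b)} {p : FlatTorus b}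
    (hf : f ∈ T.faces) (hp : p ∈ V) : p ∉ f := by
  intro hpf
  have h := T.cell_eq (.inr hf) (.inl (.inl ⟨p, hp, rfl⟩)) hpf rfl
  obtain ⟨x, y, z, hF, -, rfl⟩ := exists_isFace hf
  obtain ⟨q, hq, hq'⟩ := hF.exists_offLines hfin
  have h1 : proj b q = p := h.subset ⟨q, hq, rfl⟩
  exact notMem_of_mem_offLines hq' (h1 ▸ hp)

/-- The boundary of the second triangle projects to vertices and edges, which the first face avoids.
A connected set that meets an open set and avoids its boundary is contained in it. -/
theorem IsFace.subset_of_inter (hfin : V.Finite) {x y z x' y' z' : EPlane}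
    (h : T.IsFace x y z) (h' : T.IsFace x' y' z')
    (hne : (openTriangle x y z ∩ openTriangle x' y' z').Nonempty) :
    openTriangle x y z ⊆ openTriangle x' y' z' := by
  apply (isPreconnected_openTriangle x y z).subset_of_closure_inter_subset
    (isOpen_openTriangle _ _ _) hne
  rintro q ⟨hq', hq⟩
  rw [closure_openTriangle h'.det_ne] at hq'
  obtain ⟨a₁, a₂, a₃, h₁, h₂, h₃, h1, rfl⟩ := mem_convexHull_triple.1 hq'
  have hqf : proj b _ ∈ triangle b x y z := mem_image_of_mem _ hq
  rcases normalForm (F := T.IsFace) (fun h => h.memx) (fun h => h.rot) h' h₁ h₂ h₃ h1 with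
    ⟨v, hv, e⟩ | ⟨u, v, w, s, t, hs, ht, hst, hF, e⟩ | ⟨h₁, h₂, h₃⟩
  · have : a₁ • x' + a₂ • y' + a₃ • z' = v := by
      simpa using comb_eq_of_comb (x' := v) (y' := v) (z' := v) (a' := 1) (b' := 0) (c' := 0)
        (fun f => by rw [e f]; ring)
    rw [this] at hqf
    exact (notMem_face_of_mem hfin h.face hv hqf).elim
  · have : a₁ • x' + a₂ • y' + a₃ • z' = s • u + t • v := by
      simpa using comb_eq_of_comb (x' := u) (y' := v) (z' := v) (a' := s) (b' := t) (c' := 0)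
        (fun f => by rw [e f]; ring)
    rw [this] at hqf
    exact (notMem_face_of_mem_edge hfin hF.xy h.face
      (mem_image_of_mem _ (mem_openSegment hs ht hst)) hqf).elim
  · exact (mem_openTriangle h'.det_ne).2 ⟨_, _, _, h₁, h₂, h₃, h1, rfl⟩

theorem IsFace.vertices_eq (hfin : V.Finite) {x y z x' y' z' p : EPlane}
    (h : T.IsFace x y z) (h' : T.IsFace x' y' z')
    (hp : p ∈ openTriangle x y z) (hp' : p ∈ openTriangle x' y' z') :
    ({x, y, z} : Set EPlane) = {x', y', z'} :=
  vertices_eq_of_openTriangle_eq h.det_ne h'.det_ne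
    ((h.subset_of_inter hfin h' ⟨p, hp, hp'⟩).antisymm (h'.subset_of_inter hfin h ⟨p, hp', hp⟩))

theorem exists_isFace_of_mem {f : Set (FlatTorus b)} {p : EPlane} (hf : f ∈ T.faces)
    (hp : proj b p ∈ f) : ∃ x y z, T.IsFace x y z ∧ p ∈ openTriangle x y z ∧
      f = triangle b x y z := by
  obtain ⟨x, y, z, hF, -, rfl⟩ := exists_isFace hf
  obtain ⟨q, hq, hqp⟩ := hp
  obtain ⟨v, hv, rfl⟩ := proj_eq_iff.1 hqp
  exact ⟨_, _, _, hF.trans hv, mem_openTriangle_add hF.det_ne hq, (triangle_add hF.det_ne hv).symm⟩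

/-- There are finitely many faces, and all lifts of one face are lattice translates of each other up
to the order of the corners. -/
theorem exists_bound (hfin : V.Finite) (T : GeometricTriangulation b V) :
    ∃ C, ∀ {x y z}, T.IsFace x y z → ‖x - y‖ ≤ C := by
  have : ∀ f ∈ T.faces, ∃ C, ∀ x y z, T.IsFace x y z → triangle b x y z = f → ‖x - y‖ ≤ C := by
    intro f hf
    obtain ⟨x₀, y₀, z₀, h₀, -, rfl⟩ := exists_isFace hf
    refine ⟨Metric.diam ({x₀, y₀, z₀} : Set EPlane), fun x y z h hxyz => ?_⟩
    obtain ⟨p, hp⟩ := openTriangle_nonempty h.det_ne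
    have hp0 : proj b p ∈ triangle b x₀ y₀ z₀ := hxyz ▸ mem_image_of_mem _ hp
    obtain ⟨q, hq, hqp⟩ := hp0
    obtain ⟨v, hv, rfl⟩ := proj_eq_iff.1 hqp.symm
    have hs := (h.trans hv).vertices_eq hfin h₀ (mem_openTriangle_add h.det_ne hp) hq
    have hd := Metric.dist_le_diam_of_mem (s := ({x₀, y₀, z₀} : Set EPlane))
      (Set.toFinite _).isBounded (hs.subset (show x + v ∈ _ by simp))
      (hs.subset (show y + v ∈ _ by simp))
    simpa [dist_eq_norm] using hd
  choose! C hC using this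
  obtain ⟨M, hM⟩ := (T.finite_faces.image C).bddAbove
  exact ⟨M, fun {x y z} h => (hC _ h.face x y z h rfl).trans (hM ⟨_, h.face, rfl⟩)⟩

theorem cover (hfin : V.Finite) (T : GeometricTriangulation b V) (p : EPlane) :
    ∃ (x y z : EPlane) (a₁ a₂ a₃ : ℝ), T.IsFace x y z ∧ 0 ≤ a₁ ∧ 0 ≤ a₂ ∧ 0 ≤ a₃ ∧ a₁ + a₂ + a₃ = 1 ∧
      p = a₁ • x + a₂ • y + a₃ • z := by
  refine cover_of_dense hfin (fun h => h.memx) (fun h => h.rot) (T.exists_bound hfin)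
    (dense_offLines (countable_preimage hfin)) (fun p hp => ?_) p
  obtain ⟨s, ⟨(⟨v, hv, rfl⟩ | he) | hf, hps⟩, -⟩ := T.isPartition.2 (proj b p)
  · rw [mem_singleton_iff.1 hps.symm] at hv
    exact (notMem_of_mem_offLines hp hv).elim
  · exact (notMem_edge_of_mem_offLines he hp hps).elim
  · obtain ⟨x, y, z, hF, hp, -⟩ := exists_isFace_of_mem hf hps
    obtain ⟨a₁, a₂, a₃, h₁, h₂, h₃, h1, rfl⟩ := (mem_openTriangle hF.det_ne).1 hp
    exact ⟨_, _, _, _, _, _, hF, h₁.le, h₂.le, h₃.le, h1, rfl⟩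

end GeometricTriangulation

theorem segment_eq_of_comb {x y x' y' : EPlane} {s t s' t' : ℝ} (hs : 0 < s) (ht : 0 < t)
    (h : ∀ f : EPlane → ℝ, s * f x + t * f y = s' * f x' + t' * f y') :
    x ∈ ({x', y'} : Set EPlane) ∧ y ∈ ({x', y'} : Set EPlane) := by
  constructor
  · have := mem_triple_of_comb (y := y) (z := y) (z' := y') (c := 0) (c' := 0) hs ht.le le_rfl
      (fun f => by simpa using h f)
    simpa only [pair_eq_singleton] using this
  · have := mem_triple_of_comb (y := x) (z := x) (a' := s') (b' := t') (x' := x') (y' := y') (z' := y') (c := 0) (c' := 0) ht hs.le le_rfl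
      (fun f => by rw [add_comm (t * _), h f]; simp)
    simpa only [pair_eq_singleton] using this

theorem point_eq_of_comb {x y z v : EPlane} {a₁ a₂ a₃ : ℝ}
    (h : ∀ f : EPlane → ℝ, a₁ * f x + a₂ * f y + a₃ * f z = f v) :
    a₁ • x + a₂ • y + a₃ • z = v := by
  simpa using comb_eq_of_comb (x' := v) (y' := v) (z' := v) (a' := 1) (b' := 0) (c' := 0)
    (fun f => by rw [h f]; ring)

theorem segment_point_eq_of_comb {x y z u v : EPlane} {a₁ a₂ a₃ s t : ℝ}
    (h : ∀ f : EPlane → ℝ, a₁ * f x + a₂ * f y + a₃ * f z = s * f u + t * f v) :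
    a₁ • x + a₂ • y + a₃ • z = s • u + t • v := by
  simpa using comb_eq_of_comb (x' := u) (y' := v) (z' := v) (a' := s) (b' := t) (c' := 0)
    (fun f => by rw [h f]; ring)

namespace GeometricTriangulation

variable {T : GeometricTriangulation b V}

variable (T) in
/-- The segment with endpoints `x`, `y` is a lift of an edge. -/
structure IsEdge (x y : EPlane) : Prop where
  ne : x ≠ y
  memx : proj b x ∈ V
  memy : proj b y ∈ V
  edge : geodesic b x y ∈ T.edges

theorem IsFace.isEdge {x y z : EPlane} (h : T.IsFace x y z) : T.IsEdge x y :=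
  ⟨(ne_of_det3 h.det_ne).1, h.memx, h.memy, h.xy⟩

theorem IsEdge.symm {x y : EPlane} (h : T.IsEdge x y) : T.IsEdge y x :=
  ⟨h.ne.symm, h.memy, h.memx, geodesic_symm (b := b) x y ▸ h.edge⟩

theorem IsEdge.trans {x y v : EPlane} (hv : v ∈ lattice b) (h : T.IsEdge x y) :
    T.IsEdge (x + v) (y + v) :=
  ⟨by simpa using h.ne, by rw [proj_add hv]; exact h.memx, by rw [proj_add hv]; exact h.memy,
    by rw [geodesic_add hv]; exact h.edge⟩

theorem IsEdge.proj_notMem {x y : EPlane} {s t : ℝ} (h : T.IsEdge x y) (hs : 0 < s) (ht : 0 < t)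
    (hst : s + t = 1) : proj b (s • x + t • y) ∉ V :=
  notMem_of_mem_edge h.edge (mem_image_of_mem _ (mem_openSegment hs ht hst))

theorem IsEdge.proj_mem {x y : EPlane} {s t : ℝ} (_ : T.IsEdge x y) (hs : 0 < s) (ht : 0 < t)
    (hst : s + t = 1) : proj b (s • x + t • y) ∈ geodesic b x y :=
  mem_image_of_mem _ (mem_openSegment hs ht hst)

theorem IsFace.proj_mem {x y z : EPlane} {a₁ a₂ a₃ : ℝ} (h : T.IsFace x y z) (h₁ : 0 < a₁)
    (h₂ : 0 < a₂) (h₃ : 0 < a₃) (h1 : a₁ + a₂ + a₃ = 1) :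
    proj b (a₁ • x + a₂ • y + a₃ • z) ∈ triangle b x y z :=
  mem_image_of_mem _ ((mem_openTriangle h.det_ne).2 ⟨_, _, _, h₁, h₂, h₃, h1, rfl⟩)

/-- Otherwise, sliding the common point slightly along the edge towards `x'` would enter the open
face on the side of `z`. -/
theorem not_transverse (hfin : V.Finite) {x y z x' y' : EPlane} {s t s' t' α β γ : ℝ}
    (h : T.IsFace x y z) (h' : T.IsEdge x' y') (hs : 0 < s) (ht : 0 < t) (hst : s + t = 1)
    (hs' : 0 < s') (ht' : 0 < t') (hst' : s' + t' = 1)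
    (he : s • x + t • y = s' • x' + t' • y') (h0 : α + β + γ = 0)
    (hd : x' - y' = α • x + β • y + γ • z) : γ ≤ 0 := by
  by_contra! hγ
  have hpos : ∀ {a : ℝ} (c : ℝ), 0 < a → ∀ᶠ ε in 𝓝[>] (0 : ℝ), 0 < a + ε * c := by
    intro a c ha
    have : Continuous fun ε : ℝ => a + ε * c := by fun_prop
    exact (this.tendsto' 0 a (by simp)).eventually_const_lt ha |>.filter_mono nhdsWithin_le_nhds
  obtain ⟨ε, ⟨⟨⟨h1, h2⟩, h3⟩, h4⟩, h5⟩ := ((((hpos α hs).and (hpos β ht)).and (hpos 1 hs')).and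
    (hpos (-1) ht')).and (self_mem_nhdsWithin (s := Ioi (0 : ℝ))) |>.exists
  have m1 := h.proj_mem h1 h2 (mul_pos h5 hγ) (by linear_combination hst + ε * h0)
  have m2 := h'.proj_mem h3 h4 (by linear_combination hst')
  refine notMem_face_of_mem_edge hfin h'.edge h.face m2 ?_
  convert m1 using 2
  trans (s' • x' + t' • y') + ε • (x' - y')
  · module
  · rw [← he, hd]; module

/-- For overlapping parallel segments, no endpoint of one may lie in the interior of the other,
since edges contain no vertices. The four resulting inequalities on the weights force equality. -/
theorem edge_comb_aux {x y x' y' : EPlane} {s t s' t' α : ℝ}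
    (h : T.IsEdge x y) (h' : T.IsEdge x' y') (hs : 0 < s) (ht : 0 < t) (hst : s + t = 1)
    (hs' : 0 < s') (ht' : 0 < t') (hst' : s' + t' = 1)
    (he : s • x + t • y = s' • x' + t' • y') (hα : 0 < α)
    (hd : x' - y' = α • (x - y)) : s = s' ∧ t = t' ∧ x = x' ∧ y = y' := by
  have hst2 : s' = 1 - t' := by linarith
  have hst1 : s = 1 - t := by linarith
  have ex : x' = (s + t' * α) • x + (t - t' * α) • y := by
    calc x' = (s' • x' + t' • y') + t' • (x' - y') := by rw [hst2]; module
      _ = _ := by rw [← he, hd]; module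
  have ey : y' = (s - s' * α) • x + (t + s' * α) • y := by
    calc y' = (s' • x' + t' • y') - s' • (x' - y') := by rw [hst2]; module
      _ = _ := by rw [← he, hd]; module
  have hd' : x - y = α⁻¹ • (x' - y') := by rw [hd, smul_smul, inv_mul_cancel₀ hα.ne', one_smul]
  have ex' : x = (s' + t * α⁻¹) • x' + (t' - t * α⁻¹) • y' := by
    calc x = (s • x + t • y) + t • (x - y) := by rw [hst1]; module
      _ = _ := by rw [he, hd']; module
  have ey' : y = (s' - s * α⁻¹) • x' + (t' + s * α⁻¹) • y' := by
    calc y = (s • x + t • y) - s • (x - y) := by rw [hst1]; module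
      _ = _ := by rw [he, hd']; module
  have hα' : 0 < α⁻¹ := inv_pos.2 hα
  have c1 : t ≤ t' * α := by
    by_contra! hc
    exact h.proj_notMem (s := s + t' * α) (t := t - t' * α) (by positivity) (by linarith)
      (by linarith) (by rw [← ex]; exact h'.memx)
  have c2 : s ≤ s' * α := by
    by_contra! hc
    exact h.proj_notMem (s := s - s' * α) (t := t + s' * α) (by linarith) (by positivity)
      (by linarith) (by rw [← ey]; exact h'.memy)
  have c3 : t' ≤ t * α⁻¹ := by
    by_contra! hc
    exact h'.proj_notMem (s := s' + t * α⁻¹) (t := t' - t * α⁻¹) (by positivity) (by linarith)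
      (by linarith) (by rw [← ex']; exact h.memx)
  have c4 : s' ≤ s * α⁻¹ := by
    by_contra! hc
    exact h'.proj_notMem (s := s' - s * α⁻¹) (t := t' + s * α⁻¹) (by linarith) (by positivity)
      (by linarith) (by rw [← ey']; exact h.memy)
  rw [← div_eq_mul_inv, le_div_iff₀ hα] at c3 c4
  have e1 : t = t' * α := le_antisymm c1 c3
  have e2 : s = s' * α := le_antisymm c2 c4
  obtain rfl : α = 1 := by
    have : (s' + t') * α = 1 := by rw [add_mul, ← e1, ← e2, hst]
    rwa [hst', one_mul] at this
  rw [mul_one] at e1 e2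
  subst e1 e2
  refine ⟨rfl, rfl, ?_, ?_⟩
  · rw [ex, mul_one, sub_self, hst]; simp
  · rw [ey, mul_one, sub_self, add_comm t, hst]; simp

/-- A side of a face and an edge which meet are equal. -/
theorem edge_comb (hfin : V.Finite) {x y z x' y' : EPlane} {s t s' t' : ℝ}
    (h : T.IsFace x y z) (h' : T.IsEdge x' y') (hs : 0 < s) (ht : 0 < t) (hst : s + t = 1)
    (hs' : 0 < s') (ht' : 0 < t') (hst' : s' + t' = 1)
    (he : s • x + t • y = s' • x' + t' • y') (f : EPlane → ℝ) :
    s * f x + t * f y = s' * f x' + t' * f y' := by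
  -- The weight `a₃` is the component of the edge direction across the line `x y`; applying
  -- `not_transverse` to both orientations of the edge makes it zero, so the two segments are
  -- parallel.
  obtain ⟨a₁, a₂, a₃, h1, hd⟩ := exists_comb h.det_ne (x + (x' - y'))
  have hd' : x' - y' = (a₁ - 1) • x + a₂ • y + a₃ • z := by
    rw [← sub_eq_iff_eq_add'.2 hd]; module
  have g1 := not_transverse hfin h h' hs ht hst hs' ht' hst' he (by linarith) hd'
  have g2 := not_transverse (α := -(a₁ - 1)) (β := -a₂) (γ := -a₃) hfin h h'.symm hs ht hst
    ht' hs' (by linarith) (by rw [he]; abel) (by linarith)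
    (by rw [← neg_sub, hd']; module)
  obtain rfl : a₃ = 0 := by linarith
  obtain rfl : a₁ = 1 - a₂ := by linarith
  rcases lt_trichotomy a₂ 0 with h0 | rfl | h0
  · obtain ⟨rfl, rfl, rfl, rfl⟩ := edge_comb_aux (α := -a₂) h.isEdge h' hs ht hst hs'
      ht' hst' he (by linarith) (by rw [hd']; module)
    rfl
  · refine (h'.ne (sub_eq_zero.1 ?_)).elim
    rw [hd']; module
  · obtain ⟨rfl, rfl, rfl, rfl⟩ := edge_comb_aux (α := a₂) h.isEdge h'.symm hs ht hst
      ht' hs' (by linarith) (by rw [he]; abel) h0 (by rw [← neg_sub, hd']; module)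
    ring

/-- The midpoint lies in some closed lifted face. It can be neither a corner nor an interior point
of it, so it lies on a side, and sides meeting an edge coincide with it. -/
theorem IsEdge.exists_isFace (hfin : V.Finite) {x y : EPlane} (h : T.IsEdge x y) :
    ∃ z, T.IsFace x y z := by
  have hm := h.proj_mem (s := 1 / 2) (t := 1 / 2) (by norm_num) (by norm_num) (by norm_num)
  obtain ⟨u, v, w, a₁, a₂, a₃, hF, h₁, h₂, h₃, h1, he⟩ :=
    T.cover hfin ((1 / 2 : ℝ) • x + (1 / 2 : ℝ) • y)
  rcases normalForm (F := T.IsFace) (fun h => h.memx) (fun h => h.rot) hF h₁ h₂ h₃ h1 with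
    ⟨v, hv, e⟩ | ⟨u, v, w, s, t, hs, ht, hst, hF, e⟩ | ⟨h₁, h₂, h₃⟩
  · rw [he, point_eq_of_comb e] at hm
    exact (notMem_of_mem_edge h.edge hm hv).elim
  · rw [segment_point_eq_of_comb e] at he
    have := edge_comb hfin hF h hs ht hst (by norm_num) (by norm_num) (by norm_num) he.symm
    obtain ⟨rfl | rfl, rfl | rfl⟩ := segment_eq_of_comb hs ht this
    · exact ((ne_of_det3 hF.det_ne).1 rfl).elim
    · exact ⟨w, hF⟩
    · exact ⟨w, hF.swap⟩
    · exact ((ne_of_det3 hF.det_ne).1 rfl).elim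
  · rw [he] at hm
    exact (notMem_face_of_mem_edge hfin h.edge hF.face hm (hF.proj_mem h₁ h₂ h₃ h1)).elim

theorem isComplex_isFace (hfin : V.Finite) (T : GeometricTriangulation b V) :
    IsComplex b V T.IsFace where
  det_ne h := h.det_ne
  mem h := h.memx
  rot h := h.rot
  swap h := h.swap
  trans hv h := h.trans hv
  bound := T.exists_bound hfin
  cover := T.cover hfin
  vertex := by
    intro p hp
    obtain ⟨x, y, z, a₁, a₂, a₃, hF, h₁, h₂, h₃, h1, he⟩ := T.cover hfin p
    rcases normalForm (F := T.IsFace) (fun h => h.memx) (fun h => h.rot) hF h₁ h₂ h₃ h1 with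
      ⟨v, hv, e⟩ | ⟨u, v, w, s, t, hs, ht, hst, hG, e⟩ | ⟨h₁, h₂, h₃⟩
    · rw [point_eq_of_comb e] at he
      subst he
      rcases mem_triple_of_comb (x := p) (y := p) (z := p) one_pos le_rfl le_rfl
        (fun f => by rw [e f]; ring) with rfl | rfl | rfl
      exacts [⟨_, _, hF⟩, ⟨_, _, hF.rot⟩, ⟨_, _, hF.rot.rot⟩]
    · rw [segment_point_eq_of_comb e] at he
      exact (hG.isEdge.proj_notMem hs ht hst (he ▸ hp)).elim
    · exact (notMem_face_of_mem hfin hF.face hp (he ▸ hF.proj_mem h₁ h₂ h₃ h1)).elim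
  uniq := by
    intro x y z x' y' z' a₁ a₂ a₃ a₁' a₂' a₃' hF hF' h₁ h₂ h₃ h1 h₁' h₂' h₃' h1' he f
    rcases normalForm (F := T.IsFace) (fun h => h.memx) (fun h => h.rot) hF h₁ h₂ h₃ h1 with
      ⟨v, hv, e⟩ | ⟨u, v, w, s, t, hs, ht, hst, hG, e⟩ | ⟨h₁, h₂, h₃⟩ <;>
    rcases normalForm (F := T.IsFace) (fun h => h.memx) (fun h => h.rot) hF' h₁' h₂' h₃' h1' with
      ⟨v', hv', e'⟩ | ⟨u', v', w', s', t', hs', ht', hst', hG', e'⟩ | ⟨h₁', h₂', h₃'⟩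
    · rw [point_eq_of_comb e, point_eq_of_comb e'] at he
      rw [e, e', he]
    · rw [point_eq_of_comb e, segment_point_eq_of_comb e'] at he
      exact (hG'.isEdge.proj_notMem hs' ht' hst' (he ▸ hv)).elim
    · rw [point_eq_of_comb e] at he
      exact (notMem_face_of_mem hfin hF'.face hv (he ▸ hF'.proj_mem h₁' h₂' h₃' h1')).elim
    · rw [point_eq_of_comb e', segment_point_eq_of_comb e] at he
      exact (hG.isEdge.proj_notMem hs ht hst (he ▸ hv')).elim
    · rw [segment_point_eq_of_comb e, segment_point_eq_of_comb e'] at he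
      rw [e, e', edge_comb hfin hG hG'.isEdge hs ht hst hs' ht' hst' he]
    · rw [segment_point_eq_of_comb e] at he
      exact (notMem_face_of_mem_edge hfin hG.isEdge.edge hF'.face (hG.isEdge.proj_mem hs ht hst)
        (he ▸ hF'.proj_mem h₁' h₂' h₃' h1')).elim
    · rw [point_eq_of_comb e'] at he
      exact (notMem_face_of_mem hfin hF.face hv' (he ▸ hF.proj_mem h₁ h₂ h₃ h1)).elim
    · rw [segment_point_eq_of_comb e'] at he
      exact (notMem_face_of_mem_edge hfin hG'.isEdge.edge hF.face
        (hG'.isEdge.proj_mem hs' ht' hst') (he ▸ hF.proj_mem h₁ h₂ h₃ h1)).elim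
    · refine comb_congr hF.det_ne (Eq.subset ?_) (h1.trans h1'.symm) he f
      exact (hF.vertices_eq hfin hF' ((mem_openTriangle hF.det_ne).2 ⟨_, _, _, h₁, h₂, h₃, h1, rfl⟩)
        ((mem_openTriangle hF'.det_ne).2 ⟨_, _, _, h₁', h₂', h₃', h1', he⟩)).symm

end GeometricTriangulation

/-! ### Local structure of a periodic triangulation. -/

namespace IsComplex

variable {F : EPlane → EPlane → EPlane → Prop}

/-- The triangles near a point contain that point. -/
theorem eventually_mem (hF : IsComplex b V F) (hfin : V.Finite) (p : EPlane) :
    ∀ᶠ p' in 𝓝 p, ∀ x y z, F x y z → p' ∈ convexHull ℝ {x, y, z} →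
      p ∈ convexHull ℝ {x, y, z} := by
  obtain ⟨C, hC⟩ := hF.bound
  have hS := finite_triples hfin hF.mem hF.rot hC p (C + 1)
  set S := {t : EPlane × EPlane × EPlane | F t.1 t.2.1 t.2.2 ∧ ‖t.1 - p‖ ≤ C + 1}
  have h1 : ∀ᶠ p' in 𝓝 p, ∀ t ∈ S, p' ∈ convexHull ℝ ({t.1, t.2.1, t.2.2} : Set EPlane) →
      p ∈ convexHull ℝ ({t.1, t.2.1, t.2.2} : Set EPlane) := by
    rw [eventually_all_finite hS]
    intro t _
    by_cases hp : p ∈ convexHull ℝ ({t.1, t.2.1, t.2.2} : Set EPlane)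
    · simp [hp]
    · filter_upwards [(isCompact_convexHull_triple _ _ _).isClosed.isOpen_compl.mem_nhds hp]
        with p' hp' h
      exact (hp' h).elim
  filter_upwards [h1, Metric.ball_mem_nhds p one_pos] with p' h1 hb x y z hxyz hp'
  refine h1 (x, y, z) ⟨hxyz, ?_⟩ hp'
  obtain ⟨a₁, a₂, a₃, h₁, h₂, h₃, hs, rfl⟩ := mem_convexHull_triple.1 hp'
  have h2 := norm_sub_le_of_comb hF.rot hC hxyz h₁ h₂ h₃ hs
  have h3 : ‖a₁ • x + a₂ • y + a₃ • z - p‖ < 1 := by simpa [dist_eq_norm] using hb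
  rw [norm_sub_rev] at h2
  calc ‖x - p‖ = ‖(x - (a₁ • x + a₂ • y + a₃ • z)) + (a₁ • x + a₂ • y + a₃ • z - p)‖ := by
        congr 1; abel
    _ ≤ _ := (norm_add_le _ _).trans (add_le_add h2 h3.le)

theorem perm (hF : IsComplex b V F) {x y z x' y' z' : EPlane} (h : F x' y' z')
    (hd : det3 x y z ≠ 0) (hv : ({x, y, z} : Set EPlane) = {x', y', z'}) : F x y z := by
  obtain ⟨n1, n2, n3⟩ := ne_of_det3 hd
  have hx : x ∈ ({x', y', z'} : Set EPlane) := hv ▸ (by simp)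
  have hy : y ∈ ({x', y', z'} : Set EPlane) := hv ▸ (by simp)
  have hz : z ∈ ({x', y', z'} : Set EPlane) := hv ▸ (by simp)
  rcases hx with rfl | rfl | rfl <;> rcases hy with rfl | rfl | rfl <;>
    rcases hz with rfl | rfl | rfl <;>
    first
    | exact (n1 rfl).elim
    | exact (n2 rfl).elim
    | exact (n3 rfl).elim
    | exact h
    | exact hF.rot h
    | exact hF.rot (hF.rot h)
    | exact hF.swap h
    | exact hF.swap (hF.rot h)
    | exact hF.swap (hF.rot (hF.rot h))

/-- A triangle which contains a point of the relative interior of a side of a triangle has that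
side. -/
theorem exists_third (hF : IsComplex b V F) {x y z u v w : EPlane} {s t : ℝ} (h : F x y z)
    (h' : F u v w) (hs : 0 < s) (ht : 0 < t) (hst : s + t = 1)
    (hm : s • x + t • y ∈ convexHull ℝ {u, v, w}) :
    ∃ z', F x y z' ∧ ({x, y, z'} : Set EPlane) = {u, v, w} := by
  obtain ⟨a₁, a₂, a₃, h₁, h₂, h₃, h1, he⟩ := mem_convexHull_triple.1 hm
  have hu := hF.uniq (a₁ := s) (a₂ := t) (a₃ := 0) h h' hs.le ht.le le_rfl (by linarith) h₁ h₂ h₃ h1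
    (by rw [← he]; simp)
  have hx := mem_triple_of_comb hs ht.le le_rfl hu
  have hy := mem_triple_of_comb (x := y) (y := x) ht hs.le le_rfl
    (fun f => by rw [← hu f, add_comm (t * _)])
  have hxy := (ne_of_det3 (hF.det_ne h)).1
  rcases hx with rfl | rfl | rfl <;> rcases hy with rfl | rfl | rfl <;>
    first
    | exact (hxy rfl).elim
    | exact ⟨_, h', rfl⟩
    | exact ⟨_, hF.rot h', triple_rot _ _ _⟩
    | exact ⟨_, hF.rot (hF.rot h'), by rw [triple_rot, triple_rot]⟩
    | exact ⟨_, hF.swap h', triple_swap _ _ _⟩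
    | exact ⟨_, hF.swap (hF.rot h'), by rw [triple_swap, triple_rot]⟩
    | exact ⟨_, hF.swap (hF.rot (hF.rot h')), by rw [triple_swap, triple_rot, triple_rot]⟩

/-- Two triangles on the same side of a common side are equal. -/
theorem third_eq (hF : IsComplex b V F) {x y z w : EPlane} {α β γ : ℝ} (h : F x y z)
    (h' : F x y w) (h1 : α + β + γ = 1) (hw : w = α • x + β • y + γ • z) (hγ : 0 < γ) :
    w = z := by
  -- Shift the midpoint of `x y` by a small multiple of `z`, rescaling by `N`. Rewriting `γ • z` as
  -- `w - α • x - β • y` expresses the same point with nonnegative weights in `x y w`, so `uniq`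
  -- applies and makes `z` a corner there.
  obtain ⟨k, hk, hk1, hk2⟩ : ∃ k : ℝ, 0 < k ∧ 0 < 1 / 2 + k * (-α) ∧ 0 < 1 / 2 + k * (-β) := by
    have hpos : ∀ c : ℝ, ∀ᶠ ε in 𝓝[>] (0 : ℝ), 0 < 1 / 2 + ε * c := by
      intro c
      have : Continuous fun ε : ℝ => 1 / 2 + ε * c := by fun_prop
      exact (this.tendsto' 0 (1 / 2) (by simp)).eventually_const_lt (by norm_num)
        |>.filter_mono nhdsWithin_le_nhds
    obtain ⟨k, ⟨h1, h2⟩, h3⟩ := (((hpos (-α)).and (hpos (-β))).and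
      (self_mem_nhdsWithin (s := Ioi (0 : ℝ)))).exists
    exact ⟨k, h3, h1, h2⟩
  set N : ℝ := 1 + k * γ
  have hkγ : 0 < k * γ := by positivity
  have hN : 0 < N := by positivity
  have hu := hF.uniq (a₁ := (1 / 2) / N) (a₂ := (1 / 2) / N)
    (a₃ := (k * γ) / N) (a₁' := (1 / 2 + k * (-α)) / N) (a₂' := (1 / 2 + k * (-β)) / N)
    (a₃' := k / N) h h' (by positivity) (by positivity) (by positivity)
    (by field_simp; simp only [N]; ring) (by positivity) (by positivity) (by positivity)
    (by
      field_simp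
      simp only [N]
      linear_combination (-2 * k) * h1) (by
      rw [hw, smul_add, smul_add, smul_smul, smul_smul, smul_smul]
      match_scalars <;> field_simp <;> ring)
  have hz := mem_triple_of_comb (x := z) (y := x) (z := y) (c := (1 / 2) / N)
    (a := k * γ / N) (b := (1 / 2) / N) (by positivity)
    (by positivity) (by positivity) (fun f => by rw [← hu f]; ring)
  obtain ⟨-, n2, n3⟩ := ne_of_det3 (hF.det_ne h)
  rcases hz with hz | hz | hz
  · exact (n3 hz).elim
  · exact (n2 hz.symm).elim
  · exact hz.symm

end IsComplex

/-! ### Piecewise linear heights; locally Delaunay implies Delaunay. -/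

/-- The affine function which agrees with `q` at the three points `x`, `y`, `z`. -/
noncomputable def interp (q : EPlane → ℝ) (x y z p : EPlane) : ℝ :=
  (det3 p y z * q x + det3 p z x * q y + det3 p x y * q z) / det3 x y z

theorem interp_affine (q : EPlane → ℝ) (x y z u v w : EPlane) {a₁ a₂ a₃ : ℝ}
    (h1 : a₁ + a₂ + a₃ = 1) : interp q x y z (a₁ • u + a₂ • v + a₃ • w) =
      a₁ * interp q x y z u + a₂ * interp q x y z v + a₃ * interp q x y z w := by
  obtain rfl : a₁ = 1 - a₂ - a₃ := by linarith
  simp only [interp, det3, comb_coord]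
  ring

theorem interp_left {q : EPlane → ℝ} {x y z : EPlane} (h : det3 x y z ≠ 0) :
    interp q x y z x = q x := by
  have h1 : det3 x z x = 0 := by unfold det3; ring
  have h2 : det3 x x y = 0 := by unfold det3; ring
  rw [interp, h1, h2]; field_simp; ring

theorem interp_rot (q : EPlane → ℝ) (x y z p : EPlane) : interp q y z x p = interp q x y z p := by
  unfold interp; rw [det3_rot x y z]; ring

theorem interp_swap (q : EPlane → ℝ) (x y z p : EPlane) : interp q y x z p = interp q x y z p := by
  unfold interp
  rw [det3_swap x y z, div_neg, ← neg_div]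
  congr 1
  unfold det3; ring

theorem interp_comb {q : EPlane → ℝ} {x y z : EPlane} (h : det3 x y z ≠ 0) {a₁ a₂ a₃ : ℝ}
    (h1 : a₁ + a₂ + a₃ = 1) :
    interp q x y z (a₁ • x + a₂ • y + a₃ • z) = a₁ * q x + a₂ * q y + a₃ * q z := by
  rw [interp_affine q x y z x y z h1, interp_left h]
  rw [← interp_rot q x y z y, interp_left (by rwa [det3_rot]), ← interp_rot q x y z z,
    ← interp_rot q y z x z, interp_left (by rwa [det3_rot, det3_rot])]

theorem interp_line (q : EPlane → ℝ) (x y z p d : EPlane) :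
    ∃ k : ℝ, ∀ t : ℝ, interp q x y z (p + t • d) = interp q x y z p + k * t := by
  refine ⟨interp q x y z (p + d) - interp q x y z p, fun t => ?_⟩
  simp only [interp, det3, PiLp.add_apply, PiLp.smul_apply, smul_eq_mul]
  ring

theorem continuous_interp (q : EPlane → ℝ) (x y z : EPlane) : Continuous (interp q x y z) := by
  unfold interp det3; fun_prop

/-- The function which interpolates `q` linearly on every triangle of `F`. -/
noncomputable def height (F : EPlane → EPlane → EPlane → Prop) (q : EPlane → ℝ) (p : EPlane) : ℝ :=
  sInf {r | ∃ (x y z : EPlane) (a₁ a₂ a₃ : ℝ), F x y z ∧ 0 ≤ a₁ ∧ 0 ≤ a₂ ∧ 0 ≤ a₃ ∧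
    a₁ + a₂ + a₃ = 1 ∧ p = a₁ • x + a₂ • y + a₃ • z ∧ r = a₁ * q x + a₂ * q y + a₃ * q z}

/-- The triangulation `F` is locally Delaunay with respect to `q`. -/
def LocallyDelaunay (F : EPlane → EPlane → EPlane → Prop) (q : EPlane → ℝ) : Prop :=
  ∀ (x y z w : EPlane) (α β γ : ℝ), F x y z → F x y w → α + β + γ = 1 →
    w = α • x + β • y + γ • z → γ < 0 → α * q x + β * q y + γ * q z ≤ q w

namespace IsComplex

variable {F : EPlane → EPlane → EPlane → Prop} {q : EPlane → ℝ}

/-- By `uniq` every triangle containing the point gives the same value, so the infimum is over a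
singleton. -/
theorem height_comb (hF : IsComplex b V F) {x y z : EPlane} {a₁ a₂ a₃ : ℝ} (h : F x y z)
    (h₁ : 0 ≤ a₁) (h₂ : 0 ≤ a₂) (h₃ : 0 ≤ a₃) (h1 : a₁ + a₂ + a₃ = 1) :
    height F q (a₁ • x + a₂ • y + a₃ • z) = a₁ * q x + a₂ * q y + a₃ * q z := by
  unfold height
  refine Eq.trans (congrArg sInf ?_) (csInf_singleton (a₁ * q x + a₂ * q y + a₃ * q z))
  ext r
  constructor
  · rintro ⟨x', y', z', a₁', a₂', a₃', h', h₁', h₂', h₃', h1', he, rfl⟩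
    exact (hF.uniq h h' h₁ h₂ h₃ h1 h₁' h₂' h₃' h1' he q).symm
  · rintro rfl
    exact ⟨_, _, _, _, _, _, h, h₁, h₂, h₃, h1, rfl, rfl⟩

theorem height_eq_interp (hF : IsComplex b V F) {x y z p : EPlane} (h : F x y z)
    (hp : p ∈ convexHull ℝ {x, y, z}) : height F q p = interp q x y z p := by
  obtain ⟨a₁, a₂, a₃, h₁, h₂, h₃, h1, rfl⟩ := mem_convexHull_triple.1 hp
  rw [hF.height_comb h h₁ h₂ h₃ h1, interp_comb (hF.det_ne h) h1]

theorem height_vertex (hF : IsComplex b V F) {v : EPlane} (hv : proj b v ∈ V) :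
    height F q v = q v := by
  obtain ⟨x, y, h⟩ := hF.vertex hv
  simpa using hF.height_comb (q := q) (a₁ := 1) (a₂ := 0) (a₃ := 0) h (by simp) le_rfl le_rfl
    (by simp)

theorem continuous_height (hF : IsComplex b V F) (hfin : V.Finite) : Continuous (height F q) := by
  let f : {t : EPlane × EPlane × EPlane // F t.1 t.2.1 t.2.2} → Set EPlane :=
    fun t => convexHull ℝ {t.1.1, t.1.2.1, t.1.2.2}
  refine LocallyFinite.continuous (f := f) ?_ ?_
    (fun t => (isCompact_convexHull_triple _ _ _).isClosed) ?_
  · intro p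
    obtain ⟨C, hC⟩ := hF.bound
    refine ⟨_, Metric.ball_mem_nhds p one_pos, ?_⟩
    have hS := finite_triples hfin hF.mem hF.rot hC p (C + 1)
    refine (hS.preimage Subtype.val_injective.injOn).subset ?_
    rintro ⟨⟨x, y, z⟩, h⟩ ⟨p', hp', hb⟩
    refine ⟨h, ?_⟩
    obtain ⟨a₁, a₂, a₃, h₁, h₂, h₃, hs, rfl⟩ := mem_convexHull_triple.1 hp'
    have h2 := norm_sub_le_of_comb hF.rot hC h h₁ h₂ h₃ hs
    have h3 : ‖a₁ • x + a₂ • y + a₃ • z - p‖ < 1 := by simpa [dist_eq_norm] using hb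
    rw [norm_sub_rev] at h2
    calc ‖x - p‖ = ‖(x - (a₁ • x + a₂ • y + a₃ • z)) + (a₁ • x + a₂ • y + a₃ • z - p)‖ := by
          congr 1; abel
      _ ≤ _ := (norm_add_le _ _).trans (add_le_add h2 h3.le)
  · refine eq_univ_of_forall fun p => ?_
    obtain ⟨x, y, z, a₁, a₂, a₃, h, hp⟩ := hF.cover p
    exact mem_iUnion.2 ⟨⟨(x, y, z), h⟩, mem_convexHull_triple.2 ⟨_, _, _, hp⟩⟩
  · rintro ⟨⟨x, y, z⟩, h⟩
    exact (continuous_interp q x y z).continuousOn.congr fun p hp => hF.height_eq_interp h hp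

/-- Inside a triangle the height is affine. At an interior point of a side, only triangles with that
side matter nearby, and the local Delaunay condition places the one across it above the affine
extension. -/
theorem exists_local_support (hF : IsComplex b V F) (hfin : V.Finite) (hL : LocallyDelaunay F q)
    {p : EPlane} (hp : proj b p ∉ V) : ∃ x y z, height F q p = interp q x y z p ∧
      ∀ᶠ p' in 𝓝 p, interp q x y z p' ≤ height F q p' := by
  obtain ⟨x, y, z, a₁, a₂, a₃, h, h₁, h₂, h₃, h1, he⟩ := hF.cover p
  rcases normalForm hF.mem hF.rot h h₁ h₂ h₃ h1 with
    ⟨v, hv, e⟩ | ⟨u, v, w, s, t, hs, ht, hst, hG, e⟩ | ⟨h₁, h₂, h₃⟩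
  · rw [he, point_eq_of_comb e] at hp
    exact (hp hv).elim
  · rw [segment_point_eq_of_comb e] at he
    refine ⟨u, v, w, hF.height_eq_interp hG (mem_convexHull_triple.2 ⟨s, t, 0, hs.le, ht.le, le_rfl,
      by linarith, by rw [he]; simp⟩), ?_⟩
    filter_upwards [hF.eventually_mem hfin p] with p' hp'
    obtain ⟨x', y', z', a₁', a₂', a₃', h', h''⟩ := hF.cover p'
    have hm := mem_convexHull_triple.2 ⟨_, _, _, h''⟩
    obtain ⟨w', hw', hv⟩ := hF.exists_third hG h' hs ht hst (he ▸ hp' _ _ _ h' hm)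
    rw [← hv] at hm
    obtain ⟨c₁, c₂, c₃, g₁, g₂, g₃, g, rfl⟩ := mem_convexHull_triple.1 hm
    rw [hF.height_comb hw' g₁ g₂ g₃ g, interp_affine _ _ _ _ _ _ _ g]
    have hd := hF.det_ne hG
    have e1 : interp q u v w u = q u := interp_left hd
    have e2 : interp q u v w v = q v := by
      rw [← interp_rot, interp_left (by rwa [det3_rot])]
    have e3 : interp q u v w w' ≤ q w' := by
      obtain ⟨α, β, γ, hαβ, hw⟩ := exists_comb hd w'
      rcases lt_trichotomy γ 0 with h0 | rfl | h0
      · have := hL _ _ _ _ _ _ _ hG hw' hαβ hw h0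
        rwa [hw, interp_comb hd hαβ, ← hw]
      · refine (hF.det_ne hw' ?_).elim
        rw [hw, det3_comb hαβ, zero_mul]
      · obtain rfl := hF.third_eq hG hw' hαβ hw h0
        rw [← interp_rot, ← interp_rot, interp_left (by rwa [det3_rot, det3_rot])]
    rw [e1, e2]
    gcongr
  · have hp : p ∈ openTriangle x y z :=
      (mem_openTriangle (hF.det_ne h)).2 ⟨_, _, _, h₁, h₂, h₃, h1, he⟩
    refine ⟨x, y, z, hF.height_eq_interp h (interior_subset hp), ?_⟩
    filter_upwards [(isOpen_openTriangle x y z).mem_nhds hp] with p' hp'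
    exact (hF.height_eq_interp h (interior_subset hp')).ge

end IsComplex

/-- A function of a real variable which has a local support line at every interior point lies above
its tangent at the left end. -/
theorem nonneg_of_local_support {h : ℝ → ℝ} (hc : Continuous h) (h0 : ∀ᶠ s in 𝓝 (0 : ℝ), h s = 0)
    (hs : ∀ s ∈ Ioo (0 : ℝ) 1, ∃ k : ℝ, ∀ᶠ s' in 𝓝 s, h s + k * (s' - s) ≤ h s') : 0 ≤ h 1 := by
  by_contra! hneg
  -- This is `h s - h 1 * s ^ 2`: it vanishes at both ends, and since `h 1 < 0` it is positive just
  -- after 0. At an interior maximum the support line of `h` plus a strictly convex term gives a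
  -- positive second difference, a contradiction.
  set g : ℝ → ℝ := fun s => h s - s * h 1 + h 1 * (s * (1 - s))
  have hg : Continuous g := by fun_prop
  obtain ⟨s₀, hs₀, hmax⟩ := isCompact_Icc.exists_isMaxOn (nonempty_Icc.2 zero_le_one)
    (hg.continuousOn (s := Icc (0 : ℝ) 1))
  obtain ⟨s₁, ⟨e1, e2⟩, e3⟩ := ((h0.filter_mono nhdsWithin_le_nhds).and
    ((gt_mem_nhds (zero_lt_one (α := ℝ))).filter_mono nhdsWithin_le_nhds)).and
    (self_mem_nhdsWithin (s := Ioi (0 : ℝ))) |>.exists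
  have e3 : 0 < s₁ := e3
  have hg1 : 0 < g s₁ := by
    simp only [g, e1]
    nlinarith [mul_pos e3 e3]
  have hg0 : 0 < g s₀ := hg1.trans_le (hmax ⟨e3.le, e2.le⟩)
  have hs₀' : s₀ ∈ Ioo (0 : ℝ) 1 := by
    refine ⟨hs₀.1.lt_of_ne ?_, hs₀.2.lt_of_ne ?_⟩
    · rintro rfl
      simp [g, h0.self_of_nhds] at hg0
    · rintro rfl
      simp [g] at hg0
  obtain ⟨k, hk⟩ := hs s₀ hs₀'
  have hlim : ∀ c : ℝ, Tendsto (fun δ : ℝ => s₀ + c * δ) (𝓝[>] 0) (𝓝 s₀) := by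
    intro c
    have : Continuous fun δ : ℝ => s₀ + c * δ := by fun_prop
    exact (this.tendsto' 0 s₀ (by simp)).mono_left nhdsWithin_le_nhds
  have hI : ∀ᶠ s in 𝓝 s₀, s ∈ Icc (0 : ℝ) 1 := Icc_mem_nhds hs₀'.1 hs₀'.2
  obtain ⟨δ, ⟨⟨d1, d2⟩, d3, d4⟩, d5⟩ := (((hlim 1).eventually (hk.and hI)).and
    ((hlim (-1)).eventually (hk.and hI))).and (self_mem_nhdsWithin (s := Ioi (0 : ℝ))) |>.exists
  have d5 : 0 < δ := d5
  have m1 : g (s₀ + 1 * δ) ≤ g s₀ := hmax d2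
  have m2 : g (s₀ + -1 * δ) ≤ g s₀ := hmax d4
  simp only [g] at m1 m2
  nlinarith [mul_pos d5 d5]

/-- A locally Delaunay triangulation is Delaunay. -/
theorem IsComplex.interp_le {F : EPlane → EPlane → EPlane → Prop} {q : EPlane → ℝ}
    (hF : IsComplex b V F) (hfin : V.Finite) (hL : LocallyDelaunay F q)
    {x y z v : EPlane} (h : F x y z) (hv : proj b v ∈ V) : interp q x y z v ≤ q v := by
  -- With this choice the open segment from `a` to `v` contains no vertex: a vertex there would put
  -- `a` on a line through it and `v`. This matters because local support is known only away from
  -- vertices.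
  obtain ⟨a, ha, ha'⟩ := (dense_offLines (countable_preimage hfin)).exists_mem_open
    (isOpen_openTriangle x y z) (openTriangle_nonempty (hF.det_ne h))
  have hcont : Continuous fun s : ℝ => a + s • (v - a) := by fun_prop
  have key := nonneg_of_local_support
    (h := fun s => height F q (a + s • (v - a)) - interp q x y z (a + s • (v - a))) ?_ ?_ ?_
  · simpa [hF.height_vertex hv] using key
  · exact ((hF.continuous_height hfin).comp hcont).sub ((continuous_interp q x y z).comp hcont)
  · have : ∀ᶠ s in 𝓝 (0 : ℝ), a + s • (v - a) ∈ openTriangle x y z :=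
      (hcont.tendsto' 0 a (by simp)).eventually ((isOpen_openTriangle x y z).mem_nhds ha')
    filter_upwards [this] with s hs
    rw [hF.height_eq_interp h (interior_subset hs), sub_self]
  · intro s hs
    have hsV : proj b (a + s • (v - a)) ∉ V := by
      intro hsV
      have h1s : 1 - s ≠ 0 := by linarith [hs.2]
      refine ha v hv _ hsV ?_ (1 - s)⁻¹ ?_
      · intro he
        have : (1 - s) • (v - a) = 0 := by
          rw [← sub_eq_zero] at he
          rw [← he]; module
        rw [smul_eq_zero, sub_eq_zero (a := v)] at this
        rcases this with h | rfl
        · exact h1s h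
        · exact notMem_of_mem_offLines ha hv
      · have : a + s • (v - a) - v = (1 - s) • (a - v) := by module
        rw [this, smul_smul, inv_mul_cancel₀ h1s]; module
    obtain ⟨u, w, t, e, hev⟩ := hF.exists_local_support hfin hL hsV
    obtain ⟨k₁, hk₁⟩ := interp_line q u w t a (v - a)
    obtain ⟨k₂, hk₂⟩ := interp_line q x y z a (v - a)
    refine ⟨k₁ - k₂, ?_⟩
    filter_upwards [hcont.continuousAt.eventually hev] with s' hs'
    simp only [e]
    rw [hk₁] at hs' ⊢
    rw [hk₂, hk₂]
    linarith

/-! ### A family of quadratic forms and its generic members. -/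

/-- A one-parameter family of positive definite quadratic forms. -/
def quad (s : ℝ) (p : EPlane) : ℝ := (p 0 + s * p 1) ^ 2 + p 1 ^ 2

theorem quad_nonneg (s : ℝ) (p : EPlane) : 0 ≤ quad s p := by unfold quad; positivity

/-- The excess of the interpolated form over the form depends only on differences of corners. This
yields convexity, lattice invariance, and a link between height and edge lengths. -/
theorem quad_comb (s : ℝ) (x y z : EPlane) {a₁ a₂ a₃ : ℝ} (h1 : a₁ + a₂ + a₃ = 1) :
    a₁ * quad s x + a₂ * quad s y + a₃ * quad s z - quad s (a₁ • x + a₂ • y + a₃ • z) =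
      a₁ * a₂ * quad s (x - y) + a₂ * a₃ * quad s (y - z) + a₃ * a₁ * quad s (z - x) := by
  obtain rfl : a₁ = 1 - a₂ - a₃ := by linarith
  simp only [quad, comb_coord, PiLp.sub_apply]
  ring

theorem quad_comb_le (s : ℝ) (x y z : EPlane) {a₁ a₂ a₃ : ℝ} (h₁ : 0 ≤ a₁) (h₂ : 0 ≤ a₂)
    (h₃ : 0 ≤ a₃) (h1 : a₁ + a₂ + a₃ = 1) :
    quad s (a₁ • x + a₂ • y + a₃ • z) ≤ a₁ * quad s x + a₂ * quad s y + a₃ * quad s z := by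
  have := quad_comb s x y z h1
  have h1 := quad_nonneg s (x - y)
  have h2 := quad_nonneg s (y - z)
  have h3 := quad_nonneg s (z - x)
  have : 0 ≤ a₁ * a₂ * quad s (x - y) + a₂ * a₃ * quad s (y - z) + a₃ * a₁ * quad s (z - x) := by
    positivity
  linarith

/-- No four points of the vertex set lie on an ellipse `q (x - c) = r`. -/
def Generic (V : Set (FlatTorus b)) (q : EPlane → ℝ) : Prop :=
  ∀ x y z v : EPlane, proj b x ∈ V → proj b y ∈ V → proj b z ∈ V → proj b v ∈ V →
    det3 x y z ≠ 0 → interp q x y z v = q v → v ∈ ({x, y, z} : Set EPlane)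

/-- The condition is a polynomial equation in `s` of degree at most 2. If it held identically, then
all quadratic forms would interpolate exactly at `v`, which forces `v` to be a corner. -/
theorem finite_quad_eq {x y z v : EPlane} (h : det3 x y z ≠ 0)
    (hv : v ∉ ({x, y, z} : Set EPlane)) :
    {s | interp (quad s) x y z v = quad s v}.Finite := by
  obtain ⟨α, β, γ, h1, rfl⟩ := exists_comb h v
  obtain rfl : α = 1 - β - γ := by linarith
  set A := (1 - β - γ) * x 0 ^ 2 + β * y 0 ^ 2 + γ * z 0 ^ 2
    - ((1 - β - γ) * x 0 + β * y 0 + γ * z 0) ^ 2 with hA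
  set B := (1 - β - γ) * (x 0 * x 1) + β * (y 0 * y 1) + γ * (z 0 * z 1)
    - ((1 - β - γ) * x 0 + β * y 0 + γ * z 0) * ((1 - β - γ) * x 1 + β * y 1 + γ * z 1) with hB
  set C := (1 - β - γ) * x 1 ^ 2 + β * y 1 ^ 2 + γ * z 1 ^ 2
    - ((1 - β - γ) * x 1 + β * y 1 + γ * z 1) ^ 2 with hC
  let P : Polynomial ℝ :=
    Polynomial.C (A + C) + Polynomial.C (2 * B) * Polynomial.X + Polynomial.C C * Polynomial.X ^ 2
  have hP : P ≠ 0 := by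
    intro hP
    have c0 : A + C = 0 := by simpa [P] using congrArg (fun p => Polynomial.coeff p 0) hP
    have c1 : 2 * B = 0 := by
      simpa [P, Polynomial.coeff_X, Polynomial.coeff_C] using
        congrArg (fun p => Polynomial.coeff p 1) hP
    have c2 : C = 0 := by
      simpa [P, Polynomial.coeff_X, Polynomial.coeff_C] using
        congrArg (fun p => Polynomial.coeff p 2) hP
    have hA0 : A = 0 := by linarith
    have hB0 : B = 0 := by linarith
    rw [hA] at hA0
    rw [hB] at hB0
    rw [hC] at c2
    -- Apply the vanishing of `A`, `B`, `C` to the square of the linear functional that reads off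
    -- the coordinate `β` times the area; `e2` does this for `γ`, and `e3` uses the product of the
    -- two functionals.
    have e1 : β * (1 - β) * det3 x y z ^ 2 = 0 := by
      unfold det3
      linear_combination (z 1 - x 1) ^ 2 * hA0 - 2 * (z 1 - x 1) * (z 0 - x 0) * hB0
        + (z 0 - x 0) ^ 2 * c2
    have e2 : γ * (1 - γ) * det3 x y z ^ 2 = 0 := by
      unfold det3
      linear_combination (y 1 - x 1) ^ 2 * hA0 - 2 * (y 1 - x 1) * (y 0 - x 0) * hB0
        + (y 0 - x 0) ^ 2 * c2
    have e3 : β * γ * det3 x y z ^ 2 = 0 := by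
      unfold det3
      linear_combination (y 1 - x 1) * (z 1 - x 1) * hA0
        - ((y 1 - x 1) * (z 0 - x 0) + (y 0 - x 0) * (z 1 - x 1)) * hB0
        + (y 0 - x 0) * (z 0 - x 0) * c2
    have hd : det3 x y z ^ 2 ≠ 0 := pow_ne_zero _ h
    have e1 := (mul_eq_zero.1 e1).resolve_right hd
    have e2 := (mul_eq_zero.1 e2).resolve_right hd
    have e3 := (mul_eq_zero.1 e3).resolve_right hd
    apply hv
    rcases mul_eq_zero.1 e1 with b0 | b0 <;> rcases mul_eq_zero.1 e2 with g0 | g0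
    · left; rw [b0, g0]; simp
    · right; right
      obtain rfl : γ = 1 := by linarith
      rw [b0]; simp
    · right; left
      obtain rfl : β = 1 := by linarith
      rw [g0]; simp
    · obtain rfl : γ = 1 := by linarith
      obtain rfl : β = 1 := by linarith
      norm_num at e3
  refine (Polynomial.finite_setOfPred_isRoot hP).subset fun s hs => ?_
  have hs : interp (quad s) x y z _ = _ := hs
  rw [interp_comb h (by ring)] at hs
  simp only [mem_ofPred_eq, Polynomial.IsRoot.def, P, Polynomial.eval_add, Polynomial.eval_mul,
    Polynomial.eval_C, Polynomial.eval_X, Polynomial.eval_pow]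
  simp only [quad, comb_coord] at hs
  rw [hA, hB, hC]
  linear_combination hs

/-- There are countably many quadruples of lifted vertices, each excluding finitely many parameters.
-/
theorem exists_generic (hfin : V.Finite) : ∃ s, Generic V (quad s) := by
  have hP := countable_preimage hfin
  have hB : (⋃ x ∈ proj b ⁻¹' V, ⋃ y ∈ proj b ⁻¹' V, ⋃ z ∈ proj b ⁻¹' V, ⋃ v ∈ proj b ⁻¹' V,
      {s | det3 x y z ≠ 0 ∧ v ∉ ({x, y, z} : Set EPlane) ∧
        interp (quad s) x y z v = quad s v}).Countable := by
    refine hP.biUnion fun x _ => hP.biUnion fun y _ => hP.biUnion fun z _ => hP.biUnion fun v _ => ?_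
    by_cases h : det3 x y z ≠ 0 ∧ v ∉ ({x, y, z} : Set EPlane)
    · exact (finite_quad_eq h.1 h.2).countable.mono fun s hs => hs.2.2
    · convert countable_empty
      ext s
      simp only [mem_ofPred_eq, mem_empty_iff_false, iff_false]
      exact fun hs => h ⟨hs.1, hs.2.1⟩
  obtain ⟨s, hs⟩ := (hB.dense_compl ℝ).nonempty
  refine ⟨s, fun x y z v hx hy hz hv hd he => ?_⟩
  by_contra hn
  apply hs
  simp only [mem_iUnion]
  exact ⟨x, hx, y, hy, z, hz, v, hv, hd, hn, he⟩

/-- The linear map which turns the quadratic form `quad s` into the square of the norm. -/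
noncomputable def shear (s : ℝ) (p : EPlane) : EPlane := !₂[p 0 + s * p 1, p 1]

theorem norm_shear_sq (s : ℝ) (p : EPlane) : ‖shear s p‖ ^ 2 = quad s p := by
  simp [EuclideanSpace.norm_sq_eq, shear, quad, Fin.sum_univ_two]

theorem shear_add (s : ℝ) (p q : EPlane) : shear s (p + q) = shear s p + shear s q := by
  apply ext_coord <;> simp [shear]; ring

theorem shear_smul (s c : ℝ) (p : EPlane) : shear s (c • p) = c • shear s p := by
  apply ext_coord <;> simp [shear]; ring

theorem norm_shear_le (s : ℝ) (p : EPlane) : ‖shear s p‖ ≤ (1 + |s|) * ‖p‖ := by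
  have : shear s p = p + (s * p 1) • EuclideanSpace.single 0 1 := by
    apply ext_coord <;> simp [shear]
  rw [this]
  refine (norm_add_le _ _).trans ?_
  rw [norm_smul, PiLp.norm_single, norm_mul]
  have := PiLp.norm_apply_le p 1
  simp only [Real.norm_eq_abs, norm_one, mul_one] at this ⊢
  nlinarith [abs_nonneg s]

theorem norm_le_shear (s : ℝ) (p : EPlane) : ‖p‖ ≤ (1 + |s|) * ‖shear s p‖ := by
  have : p = shear (-s) (shear s p) := by
    apply ext_coord <;> simp [shear]
  conv_lhs => rw [this]
  simpa using norm_shear_le (-s) (shear s p)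

/-- Completing the square: the form minus an affine function is the form about a center minus a
constant. The zero set is the circumscribed ellipse. -/
theorem exists_center (s : ℝ) (q : EPlane → ℝ) (x y z : EPlane) : ∃ (c : EPlane) (ρ : ℝ),
    ∀ v, quad s v - interp q x y z v = quad s (v - c) - ρ := by
  obtain ⟨i₀, i₁, i₂, hi⟩ : ∃ i₀ i₁ i₂ : ℝ, ∀ v, interp q x y z v = i₀ + i₁ * v 0 + i₂ * v 1 := by
    refine ⟨interp q x y z !₂[0, 0], interp q x y z !₂[1, 0] - interp q x y z !₂[0, 0],
      interp q x y z !₂[0, 1] - interp q x y z !₂[0, 0], fun v => ?_⟩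
    simp [interp, det3]
    ring
  set c₁ := i₂ / 2 - s * i₁ / 2 with hc₁
  set c₀ := i₁ / 2 - s * c₁ with hc₀
  refine ⟨!₂[c₀, c₁], quad s !₂[c₀, c₁] + i₀, fun v => ?_⟩
  rw [hi]
  simp [quad]
  rw [hc₀, hc₁]
  ring

/-! ### Delaunay triangles: uniqueness and size. -/

/-- A Delaunay triangle of the vertex set with respect to `q`: no vertex lies inside its
circumscribed ellipse. -/
structure IsDelaunay (V : Set (FlatTorus b)) (q : EPlane → ℝ) (x y z : EPlane) : Prop where
  det_ne : det3 x y z ≠ 0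
  memx : proj b x ∈ V
  memy : proj b y ∈ V
  memz : proj b z ∈ V
  le : ∀ v, proj b v ∈ V → interp q x y z v ≤ q v

namespace IsDelaunay

variable {q : EPlane → ℝ} {x y z : EPlane}

theorem rot (h : IsDelaunay V q x y z) : IsDelaunay V q y z x :=
  ⟨by rw [det3_rot]; exact h.1, h.3, h.4, h.2, fun v hv => by rw [interp_rot]; exact h.5 v hv⟩

theorem swap (h : IsDelaunay V q x y z) : IsDelaunay V q y x z :=
  ⟨by rw [det3_swap, neg_ne_zero]; exact h.1, h.3, h.2, h.4,
    fun v hv => by rw [interp_swap]; exact h.5 v hv⟩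

theorem trans {s : ℝ} {u : EPlane} (hu : u ∈ lattice b) (h : IsDelaunay V (quad s) x y z) :
    IsDelaunay V (quad s) (x + u) (y + u) (z + u) := by
  refine ⟨by rw [det3_add]; exact h.1, by rw [proj_add hu]; exact h.2,
    by rw [proj_add hu]; exact h.3, by rw [proj_add hu]; exact h.4, fun v hv => ?_⟩
  have h2 := h.le (v + -u) (by rwa [proj_add (neg_mem hu)])
  obtain ⟨α, β, γ, h1, e⟩ := exists_comb h.det_ne (v + -u)
  have e' : v = α • (x + u) + β • (y + u) + γ • (z + u) := by
    rw [← sub_eq_add_neg, sub_eq_iff_eq_add] at e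
    rw [e]
    obtain rfl : α = 1 - β - γ := by linarith
    module
  rw [e, interp_comb h.det_ne h1] at h2
  rw [e', interp_comb (by rw [det3_add]; exact h.det_ne) h1]
  have q1 := quad_comb s x y z h1
  have q2 := quad_comb s (x + u) (y + u) (z + u) h1
  simp only [add_sub_add_right_eq_sub] at q2
  linarith

/-- The plane over a Delaunay triangle supports the lifted vertices from below, so it lies below
every convex combination of them. -/
theorem comb_le (h : IsDelaunay V q x y z) {x' y' z' : EPlane} {a₁ a₂ a₃ a₁' a₂' a₃' : ℝ}
    (h1 : a₁ + a₂ + a₃ = 1) (h₁' : 0 ≤ a₁') (h₂' : 0 ≤ a₂') (h₃' : 0 ≤ a₃')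
    (h1' : a₁' + a₂' + a₃' = 1) (hx : proj b x' ∈ V) (hy : proj b y' ∈ V) (hz : proj b z' ∈ V)
    (he : a₁ • x + a₂ • y + a₃ • z = a₁' • x' + a₂' • y' + a₃' • z') :
    a₁ * q x + a₂ * q y + a₃ * q z ≤ a₁' * q x' + a₂' * q y' + a₃' * q z' := by
  rw [← interp_comb h.det_ne h1, he, interp_affine _ _ _ _ _ _ _ h1']
  have := h.le _ hx
  have := h.le _ hy
  have := h.le _ hz
  gcongr

/-- Equality in `comb_le` puts every vertex of positive weight on the supporting plane, and
genericity leaves only the corners. -/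
theorem mem_of_comb_eq (hq : Generic V q) (h : IsDelaunay V q x y z) {x' y' z' : EPlane}
    {a₁ a₂ a₃ a₁' a₂' a₃' : ℝ}
    (h1 : a₁ + a₂ + a₃ = 1) (h₁' : 0 < a₁') (h₂' : 0 ≤ a₂') (h₃' : 0 ≤ a₃')
    (h1' : a₁' + a₂' + a₃' = 1) (hx : proj b x' ∈ V) (hy : proj b y' ∈ V) (hz : proj b z' ∈ V)
    (he : a₁ • x + a₂ • y + a₃ • z = a₁' • x' + a₂' • y' + a₃' • z')
    (heq : a₁' * q x' + a₂' * q y' + a₃' * q z' ≤ a₁ * q x + a₂ * q y + a₃ * q z) :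
    x' ∈ ({x, y, z} : Set EPlane) := by
  rw [← interp_comb h.det_ne h1, he, interp_affine _ _ _ _ _ _ _ h1'] at heq
  refine hq x y z x' h.memx h.memy h.memz hx h.det_ne (le_antisymm (h.le _ hx) ?_)
  have g1 := mul_le_mul_of_nonneg_left (h.le _ hy) h₂'
  have g2 := mul_le_mul_of_nonneg_left (h.le _ hz) h₃'
  exact le_of_mul_le_mul_left (by linarith) h₁'

/-- Comparing both ways with `comb_le`, the two triangles give the same height at the common point.
So every corner of the second that carries weight is a corner of the first, and barycentric
coordinates are unique. -/
theorem uniq (hq : Generic V q) (h : IsDelaunay V q x y z) {x' y' z' : EPlane}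
    (h' : IsDelaunay V q x' y' z') {a₁ a₂ a₃ a₁' a₂' a₃' : ℝ}
    (h₁ : 0 ≤ a₁) (h₂ : 0 ≤ a₂) (h₃ : 0 ≤ a₃)
    (h1 : a₁ + a₂ + a₃ = 1) (h₁' : 0 ≤ a₁') (h₂' : 0 ≤ a₂') (h₃' : 0 ≤ a₃')
    (h1' : a₁' + a₂' + a₃' = 1)
    (he : a₁ • x + a₂ • y + a₃ • z = a₁' • x' + a₂' • y' + a₃' • z') (f : EPlane → ℝ) :
    a₁ * f x + a₂ * f y + a₃ * f z = a₁' * f x' + a₂' * f y' + a₃' * f z' := by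
  have hle := h'.comb_le h1' h₁ h₂ h₃ h1 h.memx h.memy h.memz he.symm
  have key : ∀ {u : EPlane} {c : ℝ}, (0 < c → u ∈ ({x, y, z} : Set EPlane)) → 0 ≤ c →
      ∃ u' ∈ ({x, y, z} : Set EPlane), c • u = c • u' ∧ c * f u = c * f u' := by
    intro u c hu hc
    rcases hc.eq_or_lt with rfl | hc
    · exact ⟨x, by simp, by simp, by simp⟩
    · exact ⟨u, hu hc, rfl, rfl⟩
  obtain ⟨u, hu, eu, eu'⟩ := key (fun hp => h.mem_of_comb_eq hq h1 hp h₂' h₃' h1' h'.memx h'.memy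
    h'.memz he hle) h₁'
  obtain ⟨v, hv, ev, ev'⟩ := key (u := y') (fun hp => h.mem_of_comb_eq hq h1 hp h₃' h₁' (by linarith)
    h'.memy h'.memz h'.memx (by rw [he]; abel) (by linarith)) h₂'
  obtain ⟨w, hw, ew, ew'⟩ := key (u := z') (fun hp => h.mem_of_comb_eq hq h1 hp h₁' h₂' (by linarith)
    h'.memz h'.memx h'.memy (by rw [he]; abel) (by linarith)) h₃'
  rw [eu', ev', ew']
  rw [eu, ev, ew] at he
  refine comb_congr h.det_ne ?_ (h1.trans h1'.symm) he f
  rintro _ (rfl | rfl | rfl) <;> assumption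

/-- Some vertex lies within `R` of the center of the circumscribed ellipse but not inside the
ellipse, which bounds its size. -/
theorem exists_bound (hne : V.Nonempty) (s : ℝ) :
    ∃ C, ∀ {x y z}, IsDelaunay V (quad s) x y z → ‖x - y‖ ≤ C := by
  obtain ⟨R, hR0, hR⟩ := exists_preimage_near hne
  refine ⟨(1 + |s|) * ((1 + |s|) * R + (1 + |s|) * R), fun {x y z} h => ?_⟩
  obtain ⟨c, ρ, hc⟩ := exists_center s (quad s) x y z
  obtain ⟨v, hv, hvc⟩ := hR c
  have hρ : ρ ≤ ((1 + |s|) * R) ^ 2 := by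
    have h1 := h.le v hv
    have h2 : ρ ≤ quad s (v - c) := by linarith [hc v]
    rw [← norm_shear_sq] at h2
    refine h2.trans (pow_le_pow_left₀ (norm_nonneg _) ?_ 2)
    exact (norm_shear_le s _).trans (by gcongr)
  have key : ∀ u, interp (quad s) x y z u = quad s u → ‖shear s (u - c)‖ ≤ (1 + |s|) * R := by
    intro u hu
    have h1 := hc u
    rw [hu, sub_self] at h1
    rw [← norm_shear_sq] at h1
    exact le_of_sq_le_sq (by linarith) (by positivity)
  have kx := key x (interp_left h.det_ne)
  have ky := key y (by rw [← interp_rot, interp_left (by rw [det3_rot]; exact h.det_ne)])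
  refine (norm_le_shear s _).trans ?_
  gcongr
  have : shear s (x - y) = shear s (x - c) - shear s (y - c) := by
    rw [eq_sub_iff_add_eq, ← shear_add]; congr 1; abel
  rw [this]
  exact (norm_sub_le _ _).trans (add_le_add kx ky)

end IsDelaunay

/-! ### Existence of Delaunay triangles. -/

/-- Every point lies in a triangle with corners in the vertex set. -/
theorem exists_triangle (hne : V.Nonempty) (p : EPlane) : ∃ (x y z : EPlane) (a₁ a₂ a₃ : ℝ),
    proj b x ∈ V ∧ proj b y ∈ V ∧ proj b z ∈ V ∧ 0 ≤ a₁ ∧ 0 ≤ a₂ ∧ 0 ≤ a₃ ∧ a₁ + a₂ + a₃ = 1 ∧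
      p = a₁ • x + a₂ • y + a₃ • z := by
  obtain ⟨v, hv⟩ := hne
  obtain ⟨u, rfl⟩ := proj_surjective v
  have hb : ∀ i, b i ∈ lattice b := fun i => Submodule.subset_span ⟨i, rfl⟩
  set c := ZSpan.floor b (p - u)
  set w := u + (c : EPlane) with hw
  have hwV : proj b w ∈ V := by rwa [proj_add c.2]
  set f := fun i => Int.fract (b.repr (p - u) i) with hf
  have hp : p = w + f 0 • b 0 + f 1 • b 1 := by
    have h := b.sum_repr (ZSpan.fract b (p - u))
    rw [Fin.sum_univ_two, ZSpan.repr_fract_apply, ZSpan.repr_fract_apply, ZSpan.fract_apply] at h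
    simp only [hf]
    rw [add_assoc, h, hw]
    simp [c]
  have h0 : ∀ i, 0 ≤ f i := fun i => Int.fract_nonneg _
  have h1 : ∀ i, f i < 1 := fun i => Int.fract_lt_one _
  by_cases h : f 0 + f 1 ≤ 1
  · refine ⟨w, w + b 0, w + b 1, 1 - f 0 - f 1, f 0, f 1, hwV, by rwa [proj_add (hb 0)],
      by rwa [proj_add (hb 1)], by linarith, h0 0, h0 1, by ring, ?_⟩
    conv_lhs => rw [hp]
    module
  · refine ⟨w + b 0, w + b 1, w + b 0 + b 1, 1 - f 1, 1 - f 0, f 0 + f 1 - 1,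
      by rwa [proj_add (hb 0)], by rwa [proj_add (hb 1)],
      by rwa [proj_add (hb 1), proj_add (hb 0)], by linarith [h1 1], by linarith [h1 0],
      by linarith, by ring, ?_⟩
    conv_lhs => rw [hp]
    module

/-- The ratio test of the simplex method: `σ` is the inverse of the largest quotient `μᵢ / aᵢ`,
which is positive because the `μᵢ` sum to 1. -/
theorem exists_ratio {a₁ a₂ a₃ μ₁ μ₂ μ₃ : ℝ} (h₁ : 0 < a₁) (h₂ : 0 < a₂) (h₃ : 0 < a₃)
    (hμ : μ₁ + μ₂ + μ₃ = 1) : ∃ σ : ℝ, 0 < σ ∧ 0 ≤ a₁ - σ * μ₁ ∧ 0 ≤ a₂ - σ * μ₂ ∧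
      0 ≤ a₃ - σ * μ₃ ∧ (a₁ - σ * μ₁ = 0 ∨ a₂ - σ * μ₂ = 0 ∨ a₃ - σ * μ₃ = 0) := by
  set m := max (μ₁ / a₁) (max (μ₂ / a₂) (μ₃ / a₃)) with hm
  have m1 : μ₁ ≤ m * a₁ := (div_le_iff₀ h₁).1 (le_max_left _ _)
  have m2 : μ₂ ≤ m * a₂ := (div_le_iff₀ h₂).1 ((le_max_left _ _).trans (le_max_right _ _))
  have m3 : μ₃ ≤ m * a₃ := (div_le_iff₀ h₃).1 ((le_max_right _ _).trans (le_max_right _ _))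
  have hm0 : 0 < m := by
    by_contra! h
    nlinarith
  have hle : ∀ {a μ : ℝ}, μ ≤ m * a → 0 ≤ a - m⁻¹ * μ := by
    intro a μ h
    rw [sub_nonneg, inv_mul_le_iff₀ hm0]; exact h
  refine ⟨m⁻¹, inv_pos.2 hm0, hle m1, hle m2, hle m3, ?_⟩
  have heq : ∀ {a μ : ℝ}, 0 < a → m = μ / a → a - m⁻¹ * μ = 0 := by
    intro a μ ha h
    have : μ = m * a := by rw [h]; field_simp
    rw [this]; field_simp; ring
  rcases max_choice (μ₁ / a₁) (max (μ₂ / a₂) (μ₃ / a₃)) with h | h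
  · exact .inl (heq h₁ (hm.trans h))
  · rcases max_choice (μ₂ / a₂) (μ₃ / a₃) with h' | h'
    · exact .inr (.inl (heq h₂ (hm.trans (h.trans h'))))
    · exact .inr (.inr (heq h₃ (hm.trans (h.trans h'))))

/-- Replacing a corner of a triangle around `p` by a point below its plane lowers the height
at `p`. -/
theorem exists_lower {P : Set EPlane} {q : EPlane → ℝ} {x y z v : EPlane} (hd : det3 x y z ≠ 0)
    {a₁ a₂ a₃ : ℝ} (h₁ : 0 < a₁) (h₂ : 0 < a₂) (h₃ : 0 < a₃) (h1 : a₁ + a₂ + a₃ = 1)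
    (hx : x ∈ P) (hy : y ∈ P) (hz : z ∈ P) (hv : v ∈ P) (hlt : q v < interp q x y z v) :
    ∃ (x' y' z' : EPlane) (a₁' a₂' a₃' : ℝ), x' ∈ P ∧ y' ∈ P ∧ z' ∈ P ∧ 0 ≤ a₁' ∧ 0 ≤ a₂' ∧
      0 ≤ a₃' ∧ a₁' + a₂' + a₃' = 1 ∧
      a₁ • x + a₂ • y + a₃ • z = a₁' • x' + a₂' • y' + a₃' • z' ∧
      a₁' * q x' + a₂' * q y' + a₃' * q z' < a₁ * q x + a₂ * q y + a₃ * q z := by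
  obtain ⟨μ₁, μ₂, μ₃, hμ, rfl⟩ := exists_comb hd v
  rw [interp_comb hd hμ] at hlt
  obtain ⟨σ, hσ, g₁, g₂, g₃, h0⟩ := exists_ratio h₁ h₂ h₃ hμ
  have hlt' := mul_lt_mul_of_pos_left hlt hσ
  set v := μ₁ • x + μ₂ • y + μ₃ • z with hv'
  rcases h0 with h0 | h0 | h0
  · refine ⟨v, y, z, σ, _, _, hv, hy, hz, hσ.le, g₂, g₃, by linear_combination h1 - σ * hμ - h0,
      ?_, by linear_combination hlt' - q x * h0⟩
    obtain rfl : a₁ = σ * μ₁ := by linarith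
    rw [hv']; module
  · refine ⟨x, v, z, _, σ, _, hx, hv, hz, g₁, hσ.le, g₃, by linear_combination h1 - σ * hμ - h0,
      ?_, by linear_combination hlt' - q y * h0⟩
    obtain rfl : a₂ = σ * μ₂ := by linarith
    rw [hv']; module
  · refine ⟨x, y, v, _, _, σ, hx, hy, hv, g₁, g₂, hσ.le, by linear_combination h1 - σ * hμ - h0,
      ?_, by linear_combination hlt' - q z * h0⟩
    obtain rfl : a₃ = σ * μ₃ := by linarith
    rw [hv']; module

/-- A closed ball which contains `p` and no vertex near `p` in its interior is small, so that all
vertices in its interior are near `p`. -/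
theorem nonneg_of_nonneg_near {s R : ℝ} (hR0 : 0 < R)
    (hR : ∀ p : EPlane, ∃ x, proj b x ∈ V ∧ ‖x - p‖ ≤ R) {p c : EPlane} {ρ : ℝ}
    (hp : quad s (p - c) ≤ ρ)
    (hnear : ∀ v, proj b v ∈ V → ‖v - p‖ ≤ (1 + |s|) * (6 * ((1 + |s|) * R)) →
      ρ ≤ quad s (v - c)) (v : EPlane) (hv : proj b v ∈ V) : ρ ≤ quad s (v - c) := by
  set M := 1 + |s|
  have hM : 0 < M := by positivity
  set κ := M * R
  have hκ : 0 < κ := by positivity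
  have hρ0 : 0 ≤ ρ := (quad_nonneg _ _).trans hp
  have hsub : ∀ x y z : EPlane, shear s (x - z) = shear s (x - y) + shear s (y - z) := by
    intro x y z; rw [← shear_add]; congr 1; abel
  have hpr : ‖shear s (p - c)‖ ≤ √ρ := by
    rw [← norm_shear_sq] at hp
    exact Real.le_sqrt_of_sq_le hp
  have hlt : ∀ u, ‖shear s (u - c)‖ < √ρ → quad s (u - c) < ρ := by
    intro u hu
    rw [← norm_shear_sq, ← Real.sq_sqrt hρ0]
    exact pow_lt_pow_left₀ hu (norm_nonneg _) two_ne_zero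
  have hsmall : √ρ ≤ 3 * κ := by
    by_contra! hbig
    -- Move from `p` towards the center by `2 * κ`, or to the center if it is closer. A vertex
    -- within `κ` of `m` is then strictly inside the ball and near `p`, contradicting `hnear`.
    obtain ⟨m, hm1, hm2⟩ : ∃ m, ‖shear s (m - p)‖ ≤ 2 * κ ∧ ‖shear s (m - c)‖ < √ρ - κ := by
      by_cases hr : ‖shear s (p - c)‖ ≤ 2 * κ
      · refine ⟨c, ?_, ?_⟩
        · rw [← neg_sub, ← neg_one_smul ℝ, shear_smul, neg_one_smul, norm_neg]; exact hr
        · rw [sub_self, show shear s 0 = 0 by apply ext_coord <;> simp [shear], norm_zero]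
          linarith
      · push Not at hr
        set r := ‖shear s (p - c)‖
        have hr0 : 0 < r := by linarith
        refine ⟨p + (2 * κ / r) • (c - p), ?_, ?_⟩
        · rw [add_sub_cancel_left, ← neg_sub, smul_neg, ← neg_smul, shear_smul, norm_smul, norm_neg,
            Real.norm_of_nonneg (by positivity)]
          exact (div_mul_cancel₀ _ hr0.ne').le
        · have : p + (2 * κ / r) • (c - p) - c = (1 - 2 * κ / r) • (p - c) := by module
          have h1 : 0 ≤ 1 - 2 * κ / r := by
            rw [sub_nonneg, div_le_one hr0]; exact hr.le
          rw [this, shear_smul, norm_smul, Real.norm_of_nonneg h1]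
          have : (1 - 2 * κ / r) * r = r - 2 * κ := by field_simp
          change (1 - 2 * κ / r) * r < _
          linarith
    obtain ⟨u, hu, hum⟩ := hR m
    have hum' : ‖shear s (u - m)‖ ≤ κ := (norm_shear_le s _).trans (mul_le_mul_of_nonneg_left hum hM.le)
    have h1 : ‖shear s (u - c)‖ < √ρ := by
      rw [hsub u m c]
      linarith [norm_add_le (shear s (u - m)) (shear s (m - c))]
    have h2 : ‖shear s (u - p)‖ ≤ 6 * κ := by
      rw [hsub u m p]
      linarith [norm_add_le (shear s (u - m)) (shear s (m - p))]
    exact (hnear u hu ((norm_le_shear s _).trans (by gcongr))).not_gt (hlt u h1)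
  by_contra! hneg
  have h1 : ‖shear s (v - c)‖ ≤ √ρ := by
    rw [← norm_shear_sq] at hneg
    exact Real.le_sqrt_of_sq_le hneg.le
  have h2 : ‖shear s (c - p)‖ ≤ √ρ := by
    rwa [← neg_sub, ← neg_one_smul ℝ, shear_smul, neg_one_smul, norm_neg]
  have h3 : ‖shear s (v - p)‖ ≤ 6 * κ := by
    rw [hsub v c p]
    linarith [norm_add_le (shear s (v - c)) (shear s (c - p))]
  exact (hnear v hv ((norm_le_shear s _).trans (by gcongr))).not_gt hneg

/-- Among triangles containing `p` with corners in a finite window of vertices, take one of least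
interpolated height at `p`. By `exists_lower` no vertex of the window lies below its plane, and
`nonneg_of_nonneg_near` extends this to all vertices. -/
theorem exists_isDelaunay (hfin : V.Finite) (hne : V.Nonempty) (s : ℝ) {p : EPlane}
    (hp : p ∈ offLines (proj b ⁻¹' V)) :
    ∃ (x y z : EPlane) (a₁ a₂ a₃ : ℝ), IsDelaunay V (quad s) x y z ∧ 0 ≤ a₁ ∧ 0 ≤ a₂ ∧ 0 ≤ a₃ ∧
      a₁ + a₂ + a₃ = 1 ∧ p = a₁ • x + a₂ • y + a₃ • z := by
  obtain ⟨R, hR0, hR⟩ := exists_preimage_near hne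
  obtain ⟨x₀, y₀, z₀, c₁, c₂, c₃, hx₀, hy₀, hz₀, k₁, k₂, k₃, k1, e₀⟩ := exists_triangle hne p
  -- Large enough both for the locality bound of `nonneg_of_nonneg_near` and to contain one triangle
  -- around `p`.
  set R' := max ((1 + |s|) * (6 * ((1 + |s|) * R))) (max ‖x₀ - p‖ (max ‖y₀ - p‖ ‖z₀ - p‖))
  set A := {x | proj b x ∈ V ∧ ‖x - p‖ ≤ R'}
  have hA : A.Finite := finite_preimage_norm hfin p R'
  set S := {t : EPlane × EPlane × EPlane | (t.1 ∈ A ∧ t.2.1 ∈ A ∧ t.2.2 ∈ A) ∧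
    ∃ a₁ a₂ a₃ : ℝ, 0 ≤ a₁ ∧ 0 ≤ a₂ ∧ 0 ≤ a₃ ∧ a₁ + a₂ + a₃ = 1 ∧
      p = a₁ • t.1 + a₂ • t.2.1 + a₃ • t.2.2}
  have hS : S.Finite := (hA.prod (hA.prod hA)).subset fun t ht => ht.1
  have hSne : S.Nonempty := ⟨(x₀, y₀, z₀), ⟨⟨hx₀, by simp [R']⟩, ⟨hy₀, by simp [R']⟩,
    ⟨hz₀, by simp [R']⟩⟩, c₁, c₂, c₃, k₁, k₂, k₃, k1, e₀⟩
  obtain ⟨⟨x, y, z⟩, ⟨⟨hx, hy, hz⟩, a₁, a₂, a₃, h₁, h₂, h₃, h1, he⟩, hmin⟩ :=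
    exists_min_image S (fun t => interp (quad s) t.1 t.2.1 t.2.2 p) hS hSne
  simp only at hx hy hz he hmin
  obtain ⟨hd, g₁, g₂, g₃⟩ := comb_pos_of_mem_offLines hp hx.1 hy.1 hz.1 h₁ h₂ h₃ h1 he
  have hnear : ∀ v ∈ A, interp (quad s) x y z v ≤ quad s v := by
    intro v hv
    by_contra! hlt
    obtain ⟨x', y', z', a₁', a₂', a₃', hx', hy', hz', h₁', h₂', h₃', h1', he', hlt⟩ :=
      exists_lower hd g₁ g₂ g₃ h1 hx hy hz hv hlt
    have e' := he.trans he'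
    have hd' := (comb_pos_of_mem_offLines hp hx'.1 hy'.1 hz'.1 h₁' h₂' h₃' h1' e').1
    have := hmin (x', y', z') ⟨⟨hx', hy', hz'⟩, _, _, _, h₁', h₂', h₃', h1', e'⟩
    simp only at this
    rw [he, interp_comb hd h1, he', interp_comb hd' h1'] at this
    linarith
  obtain ⟨c, ρ, hc⟩ := exists_center s (quad s) x y z
  refine ⟨x, y, z, a₁, a₂, a₃, ⟨hd, hx.1, hy.1, hz.1, fun v hv => ?_⟩, h₁, h₂, h₃, h1, he⟩
  have hpc : quad s (p - c) ≤ ρ := by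
    have h2 := quad_comb_le s x y z h₁ h₂ h₃ h1
    rw [← interp_comb (q := quad s) hd h1, ← he] at h2
    linarith [hc p]
  have := nonneg_of_nonneg_near hR0 hR hpc (fun v hv hvp => by
    linarith [hc v, hnear v ⟨hv, hvp.trans (le_max_left _ _)⟩]) v hv
  linarith [hc v]

theorem isComplex_isDelaunay (hfin : V.Finite) (hne : V.Nonempty) {s : ℝ}
    (hq : Generic V (quad s)) : IsComplex b V (IsDelaunay V (quad s)) := by
  have hcov := cover_of_dense hfin (F := IsDelaunay V (quad s)) (fun h => h.memx)
    (fun h => h.rot) (IsDelaunay.exists_bound hne s) (dense_offLines (countable_preimage hfin))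
    fun p hp => exists_isDelaunay hfin hne s hp
  refine ⟨fun h => h.det_ne, fun h => h.memx, fun h => h.rot, fun h => h.swap,
    fun hv h => h.trans hv, IsDelaunay.exists_bound hne s, hcov, fun {v} hv => ?_,
    fun h h' => h.uniq hq h'⟩
  -- Convexity puts the form at `v` below the interpolation, the Delaunay property above it. Hence
  -- `v` is on the ellipse, and genericity makes it a corner.
  obtain ⟨x, y, z, a₁, a₂, a₃, h, h₁, h₂, h₃, h1, he⟩ := hcov v
  have h2 := quad_comb_le s x y z h₁ h₂ h₃ h1
  rw [← interp_comb (q := quad s) h.det_ne h1, ← he] at h2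
  rcases hq x y z v h.memx h.memy h.memz hv h.det_ne (le_antisymm (h.le v hv) h2) with
    rfl | rfl | rfl
  exacts [⟨_, _, h⟩, ⟨_, _, h.rot⟩, ⟨_, _, h.rot.rot⟩]

/-! ### Projecting a periodic triangulation to the torus. -/

/-- A nonempty finite set is not mapped into itself by a nontrivial translation. -/
theorem eq_zero_of_add_mem {S : Set EPlane} (hS : S.Finite) (hne : S.Nonempty) {v : EPlane}
    (h : ∀ u ∈ S, u + v ∈ S) : v = 0 := by
  obtain ⟨m, hm, hmax⟩ := exists_max_image S (fun u => inner ℝ u v) hS hne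
  have := hmax _ (h m hm)
  simp only [inner_add_left] at this
  have h0 : inner ℝ v v = 0 := le_antisymm (by linarith) real_inner_self_nonneg
  exact inner_self_eq_zero.1 h0

theorem exists_translate (b : Module.Basis (Fin 2) ℝ EPlane) :
    ∃ R : ℝ, ∀ x, ∃ v ∈ lattice b, ‖x + v - 0‖ ≤ R := by
  refine ⟨∑ i, ‖b i‖, fun x => ⟨-(ZSpan.floor b x : EPlane), neg_mem (ZSpan.floor b x).2, ?_⟩⟩
  have h := ZSpan.norm_fract_le b x
  rw [ZSpan.fract_apply] at h
  rwa [sub_zero, ← sub_eq_add_neg]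

theorem triple_eq_of_comb {x y z x' y' z' : EPlane} {a b c a' b' c' : ℝ} (ha : 0 < a)
    (hb : 0 < b) (hc : 0 < c) (ha' : 0 < a') (hb' : 0 < b') (hc' : 0 < c')
    (h : ∀ f : EPlane → ℝ, a * f x + b * f y + c * f z = a' * f x' + b' * f y' + c' * f z') :
    ({x, y, z} : Set EPlane) = {x', y', z'} := by
  apply subset_antisymm
  · rintro u (rfl | rfl | rfl)
    · exact mem_triple_of_comb ha hb.le hc.le h
    · exact mem_triple_of_comb (y := z) (z := x) hb hc.le ha.le fun f => by rw [← h f]; ring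
    · exact mem_triple_of_comb (y := x) (z := y) hc ha.le hb.le fun f => by rw [← h f]; ring
  · rintro u (rfl | rfl | rfl)
    · exact mem_triple_of_comb ha' hb'.le hc'.le fun f => (h f).symm
    · exact mem_triple_of_comb (y := z') (z := x') hb' hc'.le ha'.le fun f => by rw [h f]; ring
    · exact mem_triple_of_comb (y := x') (z := y') hc' ha'.le hb'.le fun f => by rw [h f]; ring

theorem false_of_triple_comb_eq_pair {x y z u v : EPlane} {a b c s t : ℝ} (hd : det3 x y z ≠ 0)
    (ha : 0 < a) (hb : 0 < b) (hc : 0 < c)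
    (h : ∀ f : EPlane → ℝ, a * f x + b * f y + c * f z = s * f u + t * f v) : False := by
  have hx := mem_triple_of_comb (x' := u) (y' := v) (z' := v) (a' := s) (b' := t) (c' := 0)
    ha hb.le hc.le fun f => by rw [h f]; ring
  have hy := mem_triple_of_comb (x := y) (y := z) (z := x) (x' := u) (y' := v) (z' := v) (a' := s)
    (b' := t) (c' := 0) hb hc.le ha.le fun f => by linarith [h f]
  have hz := mem_triple_of_comb (x := z) (y := x) (z := y) (x' := u) (y' := v) (z' := v) (a' := s)
    (b' := t) (c' := 0) hc ha.le hb.le fun f => by linarith [h f]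
  obtain ⟨n1, n2, n3⟩ := ne_of_det3 hd
  simp only [mem_insert_iff, mem_singleton_iff, or_self] at hx hy hz
  rcases hx with rfl | rfl <;> rcases hy with rfl | rfl <;> rcases hz with rfl | rfl <;>
    contradiction

/-- Every lattice orbit of triangles has a representative near the origin, where there are only
finitely many. -/
theorem finite_image (hfin : V.Finite) {F : EPlane → EPlane → EPlane → Prop}
    (hmem : ∀ {x y z}, F x y z → proj b x ∈ V) (hrot : ∀ {x y z}, F x y z → F y z x)
    (htrans : ∀ {x y z v}, v ∈ lattice b → F x y z → F (x + v) (y + v) (z + v))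
    (hC : ∃ C, ∀ {x y z}, F x y z → ‖x - y‖ ≤ C) {α : Type*} (g : EPlane → EPlane → EPlane → α)
    (hg : ∀ {x y z v}, F x y z → v ∈ lattice b → g (x + v) (y + v) (z + v) = g x y z) :
    {c | ∃ x y z, F x y z ∧ c = g x y z}.Finite := by
  obtain ⟨C, hC⟩ := hC
  obtain ⟨R, hR⟩ := exists_translate b
  refine ((finite_triples hfin hmem hrot hC 0 R).image fun t => g t.1 t.2.1 t.2.2).subset ?_
  rintro c ⟨x, y, z, h, rfl⟩
  obtain ⟨v, hv, hx⟩ := hR x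
  exact ⟨(x + v, y + v, z + v), ⟨htrans hv h, hx⟩, hg h hv⟩

namespace IsComplex

variable {F : EPlane → EPlane → EPlane → Prop}

/-- A set which is a vertex, an edge or a face of the projection of `F`. -/
def IsCell (b : Module.Basis (Fin 2) ℝ EPlane) (V : Set (FlatTorus b))
    (F : EPlane → EPlane → EPlane → Prop) (c : Set (FlatTorus b)) (p : EPlane) : Prop :=
  (proj b p ∈ V ∧ c = {proj b p}) ∨
  (∃ (x y z : EPlane) (s t : ℝ), F x y z ∧ 0 < s ∧ 0 < t ∧ s + t = 1 ∧ p = s • x + t • y ∧ c = geodesic b x y) ∨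
  (∃ (x y z : EPlane) (a₁ a₂ a₃ : ℝ), F x y z ∧ 0 < a₁ ∧ 0 < a₂ ∧ 0 < a₃ ∧ a₁ + a₂ + a₃ = 1 ∧
    p = a₁ • x + a₂ • y + a₃ • z ∧ c = triangle b x y z)

theorem isCell_unique (hF : IsComplex b V F) {c c' : Set (FlatTorus b)} {p : EPlane}
    (h : IsCell b V F c p) (h' : IsCell b V F c' p) : c = c' := by
  rcases h with ⟨hv, rfl⟩ | ⟨x, y, z, s, t, hG, hs, ht, hst, he, rfl⟩ |
    ⟨x, y, z, a₁, a₂, a₃, hG, h₁, h₂, h₃, h1, he, rfl⟩ <;>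
  rcases h' with ⟨hv', rfl⟩ | ⟨x', y', z', s', t', hG', hs', ht', hst', he', rfl⟩ |
    ⟨x', y', z', a₁', a₂', a₃', hG', h₁', h₂', h₃', h1', he', rfl⟩
  · rfl
  · obtain ⟨u, w, hp⟩ := hF.vertex hv
    have e := hF.uniq (a₁ := 1) (a₂ := 0) (a₃ := 0) (a₃' := 0) hp hG' (by simp) le_rfl le_rfl
      (by simp) hs'.le ht'.le le_rfl (by linarith) (by simpa using he')
    obtain ⟨h1, h2⟩ := segment_eq_of_comb (x := x') (y := y') (x' := p) (y' := p) (s' := 1)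
      (t' := 0) hs' ht' (fun f => by simpa using (e f).symm)
    simp only [mem_insert_iff, mem_singleton_iff, or_self] at h1 h2
    exact ((ne_of_det3 (hF.det_ne hG')).1 (h1.trans h2.symm)).elim
  · obtain ⟨u, w, hp⟩ := hF.vertex hv
    have e := hF.uniq (a₁ := 1) (a₂ := 0) (a₃ := 0) hp hG' (by simp) le_rfl le_rfl
      (by simp) h₁'.le h₂'.le h₃'.le h1' (by simpa using he')
    exact (false_of_triple_comb_eq_pair (hF.det_ne hG') h₁' h₂' h₃' (u := p) (v := p) (s := 1)
      (t := 0) (fun f => by simpa using (e f).symm)).elim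
  · obtain ⟨u, w, hp⟩ := hF.vertex hv'
    have e := hF.uniq (a₁ := 1) (a₂ := 0) (a₃ := 0) (a₃' := 0) hp hG (by simp) le_rfl le_rfl
      (by simp) hs.le ht.le le_rfl (by linarith) (by simpa using he)
    obtain ⟨h1, h2⟩ := segment_eq_of_comb (x := x) (y := y) (x' := p) (y' := p) (s' := 1)
      (t' := 0) hs ht (fun f => by simpa using (e f).symm)
    simp only [mem_insert_iff, mem_singleton_iff, or_self] at h1 h2
    exact ((ne_of_det3 (hF.det_ne hG)).1 (h1.trans h2.symm)).elim
  · have e := hF.uniq (a₃ := 0) (a₃' := 0) hG hG' hs.le ht.le le_rfl (by linarith) hs'.le ht'.le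
      le_rfl (by linarith) (by simpa using he.symm.trans he')
    obtain ⟨rfl | rfl, rfl | rfl⟩ := segment_eq_of_comb (x := x) (y := y) (x' := x') (y' := y')
      hs ht (fun f => by simpa using e f)
    · exact ((ne_of_det3 (hF.det_ne hG)).1 rfl).elim
    · rfl
    · exact geodesic_symm _ _
    · exact ((ne_of_det3 (hF.det_ne hG)).1 rfl).elim
  · have e := hF.uniq (a₃' := 0) hG' hG h₁'.le h₂'.le h₃'.le h1' hs.le ht.le le_rfl (by linarith)
      (by simpa using he'.symm.trans he)
    exact (false_of_triple_comb_eq_pair (hF.det_ne hG') h₁' h₂' h₃' (u := x) (v := y) (s := s) (t := t)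
      (fun f => by simpa using e f)).elim
  · obtain ⟨u, w, hp⟩ := hF.vertex hv'
    have e := hF.uniq (a₁ := 1) (a₂ := 0) (a₃ := 0) hp hG (by simp) le_rfl le_rfl
      (by simp) h₁.le h₂.le h₃.le h1 (by simpa using he)
    exact (false_of_triple_comb_eq_pair (hF.det_ne hG) h₁ h₂ h₃ (u := p) (v := p) (s := 1) (t := 0)
      (fun f => by simpa using (e f).symm)).elim
  · have e := hF.uniq (a₃' := 0) hG hG' h₁.le h₂.le h₃.le h1 hs'.le ht'.le le_rfl (by linarith)
      (by simpa using he.symm.trans he')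
    exact (false_of_triple_comb_eq_pair (hF.det_ne hG) h₁ h₂ h₃ (u := x') (v := y') (s := s') (t := t')
      (fun f => by simpa using e f)).elim
  · have e := hF.uniq hG hG' h₁.le h₂.le h₃.le h1 h₁'.le h₂'.le h₃'.le h1' (he.symm.trans he')
    rw [triangle, triangle, openTriangle_congr (triple_eq_of_comb h₁ h₂ h₃ h₁' h₂' h₃' e)]

theorem isCell_of_mem (hF : IsComplex b V F) {c : Set (FlatTorus b)} {p : EPlane}
    (hc : c ∈ (fun v => ({v} : Set (FlatTorus b))) '' V ∪ {e | ∃ x y z, F x y z ∧ e = geodesic b x y}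
      ∪ {f | ∃ x y z, F x y z ∧ f = triangle b x y z}) (hp : proj b p ∈ c) : IsCell b V F c p := by
  rcases hc with (⟨v, hv, rfl⟩ | ⟨x, y, z, hG, rfl⟩) | ⟨x, y, z, hG, rfl⟩
  · obtain rfl := mem_singleton_iff.1 hp
    exact .inl ⟨hv, rfl⟩
  · obtain ⟨q, ⟨s, t, hs, ht, hst, rfl⟩, hq⟩ := hp
    obtain ⟨v, hv, rfl⟩ := proj_eq_iff.1 hq
    refine .inr (.inl ⟨_, _, _, s, t, hF.trans hv hG, hs, ht, hst, ?_, (geodesic_add hv _ _).symm⟩)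
    obtain rfl : s = 1 - t := by linarith
    module
  · obtain ⟨q, hq, hqp⟩ := hp
    obtain ⟨v, hv, rfl⟩ := proj_eq_iff.1 hqp
    have hd := hF.det_ne hG
    obtain ⟨a₁, a₂, a₃, h₁, h₂, h₃, h1, rfl⟩ := (mem_openTriangle hd).1 hq
    refine .inr (.inr ⟨_, _, _, _, _, _, hF.trans hv hG, h₁, h₂, h₃, h1, ?_,
      (triangle_add hd hv).symm⟩)
    obtain rfl : a₁ = 1 - a₂ - a₃ := by linarith
    module

/-- If two points of the segment differ by a lattice vector, then `uniq` shows that this translation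
maps the set of endpoints to itself, so it is trivial. -/
theorem injOn_openSegment (hF : IsComplex b V F) {x y z : EPlane} (h : F x y z) :
    InjOn (proj b) (openSegment ℝ x y) := by
  rintro _ ⟨s, t, hs, ht, hst, rfl⟩ _ ⟨s', t', hs', ht', hst', rfl⟩ he
  obtain ⟨v, hv, e⟩ := proj_eq_iff.1 he
  have e' := hF.uniq (a₃ := 0) (a₃' := 0) (hF.trans hv h) h hs.le ht.le le_rfl (by linarith)
    hs'.le ht'.le le_rfl (by linarith) (by
      rw [zero_smul, zero_smul, add_zero, add_zero, e]
      obtain rfl : s = 1 - t := by linarith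
      module)
  have hm := segment_eq_of_comb (x := x + v) (y := y + v) (x' := x) (y' := y) hs ht
    (fun f => by simpa using e' f)
  have : v = 0 := eq_zero_of_add_mem (S := {x, y}) (toFinite _) ⟨x, by simp⟩ (by
    rintro u (rfl | rfl)
    exacts [hm.1, hm.2])
  rw [e, this, add_zero]

theorem injOn_openTriangle (hF : IsComplex b V F) {x y z : EPlane} (h : F x y z) :
    InjOn (proj b) (openTriangle x y z) := by
  intro p hp p' hp' he
  obtain ⟨v, hv, rfl⟩ := proj_eq_iff.1 he
  have hd := hF.det_ne h
  have hpv := mem_openTriangle_add (v := v) hd hp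
  obtain ⟨a₁, a₂, a₃, h₁, h₂, h₃, h1, e⟩ := (mem_openTriangle (by rwa [det3_add])).1 hpv
  obtain ⟨a₁', a₂', a₃', h₁', h₂', h₃', h1', e'⟩ := (mem_openTriangle hd).1 hp'
  have hm := triple_eq_of_comb h₁ h₂ h₃ h₁' h₂' h₃' (hF.uniq (hF.trans hv h) h h₁.le h₂.le h₃.le h1
    h₁'.le h₂'.le h₃'.le h1' (e.symm.trans e'))
  have : v = 0 := eq_zero_of_add_mem (S := {x, y, z}) (toFinite _) ⟨x, by simp⟩ (by
    rintro u (rfl | rfl | rfl) <;> rw [← hm] <;> simp)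
  rw [this, add_zero]

/-- The geometric triangulation of the torus whose faces lift to the triangles of `F`. -/
def toTriangulation (hF : IsComplex b V F) (hfin : V.Finite) : GeometricTriangulation b V where
  edges := {e | ∃ x y z, F x y z ∧ e = geodesic b x y}
  faces := {f | ∃ x y z, F x y z ∧ f = triangle b x y z}
  finite_edges := finite_image hfin hF.mem hF.rot hF.trans hF.bound (fun x y _ => geodesic b x y) fun _ hv => geodesic_add hv _ _
  finite_faces := finite_image hfin hF.mem hF.rot hF.trans hF.bound (fun x y z => triangle b x y z)
    fun h hv => triangle_add (hF.det_ne h) hv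
  edge_geodesic := by
    rintro _ ⟨x, y, z, h, rfl⟩
    exact ⟨x, y, (ne_of_det3 (hF.det_ne h)).1, hF.mem h, hF.mem (hF.rot h),
      hF.injOn_openSegment h, rfl⟩
  face_triangle := by
    rintro _ ⟨x, y, z, h, rfl⟩
    exact ⟨x, y, z, affineIndependent_iff_det3.2 (hF.det_ne h), hF.mem h, hF.mem (hF.rot h),
      hF.mem (hF.rot (hF.rot h)), ⟨_, _, _, h, rfl⟩, ⟨_, _, _, hF.rot h, rfl⟩,
      ⟨_, _, _, hF.rot (hF.rot h), rfl⟩, hF.injOn_openTriangle h, rfl⟩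
  isPartition := by
    constructor
    · rintro ((⟨v, -, hv⟩ | ⟨x, y, z, h, he⟩) | ⟨x, y, z, h, hf⟩)
      · exact singleton_ne_empty v hv
      · exact (Set.Nonempty.image (proj b) ⟨_, mem_openSegment (x := x) (y := y) one_half_pos
          one_half_pos (add_halves 1)⟩).ne_empty he.symm
      · exact ((openTriangle_nonempty (hF.det_ne h)).image (proj b)).ne_empty hf.symm
    · intro a
      obtain ⟨p, rfl⟩ := proj_surjective a
      refine existsUnique_of_exists_of_unique ?_ fun c c' hc hc' =>
        hF.isCell_unique (hF.isCell_of_mem hc.1 hc.2) (hF.isCell_of_mem hc'.1 hc'.2)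
      obtain ⟨x, y, z, a₁, a₂, a₃, h, h₁, h₂, h₃, h1, he⟩ := hF.cover p
      rcases normalForm hF.mem hF.rot h h₁ h₂ h₃ h1 with
        ⟨v, hv, e⟩ | ⟨u, v, w, s, t, hs, ht, hst, hG, e⟩ | ⟨h₁, h₂, h₃⟩
      · rw [point_eq_of_comb e] at he
        subst he
        exact ⟨_, .inl (.inl ⟨_, hv, rfl⟩), rfl⟩
      · rw [segment_point_eq_of_comb e] at he
        exact ⟨_, .inl (.inr ⟨_, _, _, hG, rfl⟩), p, ⟨s, t, hs, ht, hst, he.symm⟩, rfl⟩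
      · exact ⟨_, .inr ⟨_, _, _, h, rfl⟩, p,
          (mem_openTriangle (hF.det_ne h)).2 ⟨_, _, _, h₁, h₂, h₃, h1, he⟩, rfl⟩

end IsComplex

/-! ### Convex quadrilaterals and the construction of flips. -/

theorem isPartition_replace {α : Type*} {C R N : Set (Set α)} (hC : Setoid.IsPartition C)
    (hR : R ⊆ C) (hU : ⋃₀ N = ⋃₀ R) (hN : ∅ ∉ N)
    (hd : ∀ c ∈ N, ∀ c' ∈ N, ∀ a, a ∈ c → a ∈ c' → c = c') :
    Setoid.IsPartition ((C \ R) ∪ N) := by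
  refine ⟨?_, fun a => ?_⟩
  · rintro (h | h)
    · exact hC.1 h.1
    · exact hN h
  · have hCu : ∀ c ∈ C, ∀ c' ∈ C, a ∈ c → a ∈ c' → c = c' := fun c hc c' hc' ha ha' =>
      (hC.2 a).unique ⟨hc, ha⟩ ⟨hc', ha'⟩
    have hx : ∀ c ∈ C \ R, ∀ c' ∈ N, a ∈ c → a ∈ c' → False := by
      intro c hc c' hc' ha ha'
      obtain ⟨r, hr, har⟩ : a ∈ ⋃₀ R := hU ▸ ⟨c', hc', ha'⟩
      exact hc.2 (hCu c hc.1 r (hR hr) ha har ▸ hr)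
    refine existsUnique_of_exists_of_unique ?_ ?_
    · obtain ⟨c, ⟨hc, ha⟩, -⟩ := hC.2 a
      by_cases hcR : c ∈ R
      · obtain ⟨n, hn, han⟩ : a ∈ ⋃₀ N := hU ▸ ⟨c, hcR, ha⟩
        exact ⟨n, .inr hn, han⟩
      · exact ⟨c, .inl ⟨hc, hcR⟩, ha⟩
    · rintro c c' ⟨hc | hc, ha⟩ ⟨hc' | hc', ha'⟩
      · exact hCu c hc.1 c' hc'.1 ha ha'
      · exact (hx c hc c' hc' ha ha').elim
      · exact (hx c' hc' c hc ha' ha).elim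
      · exact hd c hc c' hc' a ha ha'

/-- A nonzero shift would swap `x` and `y`, identify them, or make the three corners collinear. -/
theorem eq_zero_of_side {x y k v : EPlane} (hd : det3 x y k ≠ 0)
    (hx : x + v ∈ ({x, y, k} : Set EPlane)) (hy : y + v ∈ ({x, y, k} : Set EPlane)) : v = 0 := by
  have hxy := (ne_of_det3 hd).1
  rcases hx with hx | hx | hx
  · simpa using hx
  · have hv : v = y - x := by rw [← hx]; abel
    rcases hy with hy | hy | hy
    · exact eq_zero_of_add_mem (S := {x, y}) (toFinite _) ⟨x, by simp⟩ (by
        rintro u (rfl | rfl)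
        · simp [hx]
        · simp [hy])
    · simpa using hy
    · refine (hd ?_).elim
      rw [← mem_singleton_iff.1 hy, hv]
      simp only [det3, PiLp.add_apply, PiLp.sub_apply]; ring
  · have hx := mem_singleton_iff.1 hx
    rcases hy with hy | hy | hy
    · refine (hd ?_).elim
      have hv : v = x - y := by rw [← hy]; abel
      rw [← hx, hv]
      simp only [det3, PiLp.add_apply, PiLp.sub_apply]; ring
    · simpa using hy
    · refine (hxy ?_).elim
      have := hx.trans (mem_singleton_iff.1 hy).symm
      simpa using this

/-- Exchanging the diagonals of a convex quadrilateral in a convex combination. -/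
theorem exchange {x y z w : EPlane} {s t u v : ℝ} (hs : 0 < s) (ht : 0 < t)
    (he : s • x + t • y = u • z + v • w) {a₁ a₂ : ℝ} (a₃ : ℝ) (h₁ : 0 ≤ a₁) (h₂ : 0 ≤ a₂) :
    ∃ τ : ℝ, 0 ≤ τ ∧ (0 < a₁ → 0 < a₂ → 0 < τ) ∧ 0 ≤ a₁ - τ * s ∧ 0 ≤ a₂ - τ * t ∧
      (a₁ - τ * s = 0 ∨ a₂ - τ * t = 0) ∧ a₁ • x + a₂ • y + a₃ • z =
        (a₁ - τ * s) • x + (a₂ - τ * t) • y + (a₃ + τ * u) • z + (τ * v) • w := by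
  have hid : ∀ τ : ℝ, a₁ • x + a₂ • y + a₃ • z =
        (a₁ - τ * s) • x + (a₂ - τ * t) • y + (a₃ + τ * u) • z + (τ * v) • w := by
    intro τ
    have : τ • (s • x + t • y) = τ • (u • z + v • w) := by rw [he]
    rw [← sub_eq_zero] at this ⊢
    rw [← this]; module
  -- Transfer as much weight as possible to the other diagonal: `τ` is the smaller quotient, at
  -- which the first of the two weights vanishes.
  rcases le_total (a₁ / s) (a₂ / t) with h | h
  · refine ⟨a₁ / s, by positivity, fun h _ => by positivity, ?_, ?_, .inl ?_, hid _⟩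
    · rw [div_mul_cancel₀ _ hs.ne', sub_self]
    · rw [sub_nonneg]; exact (le_div_iff₀ ht).1 h
    · rw [div_mul_cancel₀ _ hs.ne', sub_self]
  · refine ⟨a₂ / t, by positivity, fun _ h => by positivity, ?_, ?_, .inr ?_, hid _⟩
    · rw [sub_nonneg]; exact (le_div_iff₀ hs).1 h
    · rw [div_mul_cancel₀ _ ht.ne', sub_self]
    · rw [div_mul_cancel₀ _ ht.ne', sub_self]

/-- The open quadrilateral made of the triangles `x y z` and `x y w`, which share a side. -/
def openQuad (x y z w : EPlane) : Set EPlane :=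
  openSegment ℝ x y ∪ openTriangle x y z ∪ openTriangle x y w

/-- The quadrilateral `x z y w` is strictly convex: its diagonals `x y` and `z w` cross. -/
structure Crossing (x y z w : EPlane) (s t u v : ℝ) : Prop where
  hs : 0 < s
  ht : 0 < t
  hu : 0 < u
  hv : 0 < v
  hst : s + t = 1
  huv : u + v = 1
  eq : s • x + t • y = u • z + v • w
  det : det3 x y z ≠ 0

namespace Crossing

variable {x y z w : EPlane} {s t u v : ℝ}

theorem eq_w (h : Crossing x y z w s t u v) :
    w = (s / v) • x + (t / v) • y + (-u / v) • z := by
  have hv := h.hv.ne'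
  have : v • w = s • x + t • y - u • z := by rw [h.eq]; abel
  calc w = v⁻¹ • (v • w) := by rw [smul_smul, inv_mul_cancel₀ hv, one_smul]
    _ = _ := by rw [this]; module

theorem sum_w (h : Crossing x y z w s t u v) : s / v + t / v + -u / v = 1 := by
  have := h.hv
  field_simp
  linarith [h.hst, h.huv]

theorem det_w (h : Crossing x y z w s t u v) : det3 x y w ≠ 0 := by
  rw [h.eq_w, det3_comb h.sum_w]
  exact mul_ne_zero (div_ne_zero (neg_ne_zero.2 h.hu.ne') h.hv.ne') h.det

theorem det_zw (h : Crossing x y z w s t u v) : det3 z w x ≠ 0 := by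
  have e : (s / v) • x + (-u / v) • z + (t / v) • y = w := by
    conv_rhs => rw [h.eq_w]
    abel
  have hd : det3 x z y = - det3 x y z := by unfold det3; ring
  rw [det3_rot x z w, ← e, det3_comb (by linarith [h.sum_w]), hd]
  exact mul_ne_zero (div_ne_zero h.ht.ne' h.hv.ne') (neg_ne_zero.2 h.det)

theorem swap_zw (h : Crossing x y z w s t u v) : Crossing x y w z s t v u :=
  ⟨h.1, h.2, h.4, h.3, h.5, by linarith [h.6], by rw [h.7]; abel, h.det_w⟩

theorem flip (h : Crossing x y z w s t u v) : Crossing z w x y u v s t :=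
  ⟨h.3, h.4, h.1, h.2, h.6, h.5, h.7.symm, h.det_zw⟩

/-- After exchanging diagonals at most one of the weights of `x` and `y` survives; which one decides
the piece of the other decomposition. -/
theorem mem_flip (h : Crossing x y z w s t u v) {a₁ a₂ a₃ : ℝ} (h₁ : 0 < a₁) (h₂ : 0 < a₂)
    (h₃ : 0 ≤ a₃) (h1 : a₁ + a₂ + a₃ = 1) :
    a₁ • x + a₂ • y + a₃ • z ∈ openQuad z w x y := by
  obtain ⟨τ, -, hτ, g₁, g₂, g0, e⟩ := exchange h.hs h.ht h.eq a₃ h₁.le h₂.le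
  have hτ := hτ h₁ h₂
  have hu := mul_pos hτ h.hu
  have hv := mul_pos hτ h.hv
  have hτs : τ * s + τ * t = τ * u + τ * v := by rw [← mul_add, ← mul_add, h.hst, h.huv]
  rw [e]
  rcases g₁.eq_or_lt with g₁ | g₁ <;> rcases g₂.eq_or_lt with g₂ | g₂
  · rw [← g₁, ← g₂]
    exact .inl (.inl ⟨a₃ + τ * u, τ * v, by positivity, hv, by linarith, by module⟩)
  · rw [← g₁]
    exact .inr ((mem_openTriangle h.flip.det_w).2 ⟨a₃ + τ * u, τ * v, _, by positivity, hv, g₂,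
      by linarith, by module⟩)
  · rw [← g₂]
    exact .inl (.inr ((mem_openTriangle h.flip.det).2 ⟨a₃ + τ * u, τ * v, _, by positivity, hv, g₁,
      by linarith, by module⟩))
  · rcases g0 with g0 | g0 <;> linarith

theorem exists_comb_of_mem (h : Crossing x y z w s t u v) {p : EPlane}
    (hp : p ∈ openQuad x y z w) : ∃ k ∈ ({z, w} : Set EPlane), ∃ a₁ a₂ a₃ : ℝ, 0 < a₁ ∧ 0 < a₂ ∧
      0 ≤ a₃ ∧ a₁ + a₂ + a₃ = 1 ∧ p = a₁ • x + a₂ • y + a₃ • k := by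
  rcases hp with (⟨c, d, hc, hd, hcd, rfl⟩ | hp) | hp
  · exact ⟨z, by simp, c, d, 0, hc, hd, le_rfl, by linarith, by simp⟩
  · obtain ⟨a₁, a₂, a₃, h₁, h₂, h₃, h1, rfl⟩ := (mem_openTriangle h.det).1 hp
    exact ⟨z, by simp, a₁, a₂, a₃, h₁, h₂, h₃.le, h1, rfl⟩
  · obtain ⟨a₁, a₂, a₃, h₁, h₂, h₃, h1, rfl⟩ := (mem_openTriangle h.det_w).1 hp
    exact ⟨w, by simp, a₁, a₂, a₃, h₁, h₂, h₃.le, h1, rfl⟩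

theorem openQuad_swap (x y z w : EPlane) : openQuad y x z w = openQuad x y z w := by
  rw [openQuad, openSegment_symm, openTriangle_swap x y z, openTriangle_swap x y w, openQuad]

theorem openQuad_subset (h : Crossing x y z w s t u v) : openQuad x y z w ⊆ openQuad z w x y := by
  intro p hp
  obtain ⟨k, rfl | rfl, a₁, a₂, a₃, h₁, h₂, h₃, h1, rfl⟩ := h.exists_comb_of_mem hp
  · exact h.mem_flip h₁ h₂ h₃ h1
  · rw [← openQuad_swap]
    exact h.swap_zw.mem_flip h₁ h₂ h₃ h1

theorem openQuad_eq (h : Crossing x y z w s t u v) : openQuad z w x y = openQuad x y z w :=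
  h.flip.openQuad_subset.antisymm h.openQuad_subset

/-- The weights of `z` and `w` have opposite signs: the two corners lie on opposite sides of the
line `x y`. -/
theorem third_coeff (h : Crossing x y z w s t u v) {a₁ a₂ a₃ c₁ c₂ c₃ : ℝ}
    (h1 : a₁ + a₂ + a₃ = 1) (h1' : c₁ + c₂ + c₃ = 1)
    (he : a₁ • x + a₂ • y + a₃ • z = c₁ • x + c₂ • y + c₃ • w) : a₃ = c₃ * (-u / v) := by
  refine (comb_inj h.det (a := a₁) (b := a₂) (a' := c₁ + c₃ * (s / v)) (b' := c₂ + c₃ * (t / v))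
    ?_ ?_).2.2
  · linear_combination h1 - h1' - c₃ * h.sum_w
  · rw [he, h.eq_w]; module

theorem disjoint_triangles (h : Crossing x y z w s t u v) :
    Disjoint (openTriangle x y z) (openTriangle x y w) := by
  rw [disjoint_left]
  intro p hp hp'
  obtain ⟨a₁, a₂, a₃, h₁, h₂, h₃, h1, rfl⟩ := (mem_openTriangle h.det).1 hp
  obtain ⟨c₁, c₂, c₃, g₁, g₂, g₃, g1, e⟩ := (mem_openTriangle h.det_w).1 hp'
  have h0 := h.third_coeff h1 g1 e
  have : 0 < u / v := div_pos h.hu h.hv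
  rw [neg_div] at h0
  nlinarith

theorem disjoint_segment (h : Crossing x y z w s t u v) :
    Disjoint (openSegment ℝ x y) (openTriangle x y z) := by
  rw [disjoint_left]
  rintro _ ⟨c, d, hc, hd, hcd, rfl⟩ hp
  obtain ⟨a₁, a₂, a₃, h₁, h₂, h₃, h1, e⟩ := (mem_openTriangle h.det).1 hp
  have := (comb_inj h.det (a := c) (b := d) (c := 0) (a' := a₁) (b' := a₂) (c' := a₃) (by linarith) (by simpa using e)).2.2
  linarith

end Crossing

namespace GeometricTriangulation

variable {T : GeometricTriangulation b V}

theorem IsEdge.exists_translate (hfin : V.Finite) {x y x' y' : EPlane} (h : T.IsEdge x y)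
    (h' : T.IsEdge x' y') (he : geodesic b x y = geodesic b x' y') :
    ∃ v ∈ lattice b, (x' + v = x ∧ y' + v = y) ∨ (x' + v = y ∧ y' + v = x) := by
  obtain ⟨z, hF⟩ := h.exists_isFace hfin
  have hm := mem_openSegment (x := x) (y := y) one_half_pos one_half_pos (add_halves 1)
  obtain ⟨_, ⟨s, t, hs, ht, hst, rfl⟩, hq⟩ := he.subset (mem_image_of_mem (proj b) hm)
  obtain ⟨v, hv, e⟩ := proj_eq_iff.1 hq
  refine ⟨v, hv, ?_⟩
  have hc := edge_comb hfin hF (h'.trans hv) one_half_pos one_half_pos (add_halves 1) hs ht hst (by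
    rw [e]
    obtain rfl : s = 1 - t := by linarith
    module)
  obtain ⟨h1 | h1, h2 | h2⟩ := segment_eq_of_comb one_half_pos one_half_pos hc
  · exact (h.ne (h1.trans h2.symm)).elim
  · exact .inl ⟨h1.symm, (mem_singleton_iff.1 h2).symm⟩
  · exact .inr ⟨h2.symm, (mem_singleton_iff.1 h1).symm⟩
  · exact (h.ne (h1.trans h2.symm)).elim

/-- Needed so that deleting the diagonal on the torus does not delete a boundary edge of the
quadrilateral as well. -/
theorem IsFace.side_ne (hfin : V.Finite) {x y z : EPlane} (h : T.IsFace x y z) :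
    geodesic b y z ≠ geodesic b x y := by
  intro he
  obtain ⟨v, -, ⟨h1, h2⟩ | ⟨h1, h2⟩⟩ := h.rot.isEdge.exists_translate hfin h.isEdge he
  · have := eq_zero_of_side (v := v) h.det_ne (by simp [h1]) (by simp [h2])
    subst this
    exact (ne_of_det3 h.det_ne).1 (by simpa using h1)
  · have := eq_zero_of_side (v := v) h.det_ne (by simp [h1]) (by simp [h2])
    subst this
    exact (ne_of_det3 h.det_ne).2.2 (by simpa using h1.symm)

/-- The only faces with a given side are those on either side of it. -/
theorem IsFace.eq_of_side (hfin : V.Finite) {x y z w : EPlane} {s t u v : ℝ}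
    (h : T.IsFace x y z) (h' : T.IsFace x y w) (hc : Crossing x y z w s t u v) {x' y' z' : EPlane}
    (hF : T.IsFace x' y' z') (he : geodesic b x' y' = geodesic b x y) :
    triangle b x' y' z' = triangle b x y z ∨ triangle b x' y' z' = triangle b x y w := by
  have hC := T.isComplex_isFace hfin
  obtain ⟨k, hk, e⟩ : ∃ k, T.IsFace x y k ∧ triangle b x' y' z' = triangle b x y k := by
    obtain ⟨v, hv, ⟨h1, h2⟩ | ⟨h1, h2⟩⟩ := h.isEdge.exists_translate hfin hF.isEdge he.symm
    · refine ⟨z' + v, ?_, ?_⟩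
      · have := hF.trans hv
        rwa [h1, h2] at this
      · rw [← triangle_add hF.det_ne hv, h1, h2]
    · refine ⟨z' + v, ?_, ?_⟩
      · have := (hF.trans hv).swap
        rwa [h1, h2] at this
      · rw [← triangle_add hF.det_ne hv, h1, h2, triangle_swap]
  rw [e]
  obtain ⟨α, β, γ, h1, hkz⟩ := exists_comb h.det_ne k
  rcases lt_trichotomy γ 0 with h0 | rfl | h0
  · right
    obtain ⟨α', β', γ', h1', hkw⟩ := exists_comb h'.det_ne k
    have h2 := hc.third_coeff h1 h1' (hkz.symm.trans hkw)
    have : 0 < u / v := div_pos hc.hu hc.hv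
    rw [neg_div] at h2
    have hγ' : 0 < γ' := by
      by_contra! hn
      nlinarith
    rw [hC.third_eq h' hk h1' hkw hγ']
  · refine (hk.det_ne ?_).elim
    rw [hkz, det3_comb h1, zero_mul]
  · left
    rw [hC.third_eq h hk h1 hkz h0]

/-- Every point of the open quadrilateral has positive weight at both `x` and `y`. Identifying two
points by a lattice vector would move this side onto corners of one of the two triangles, which
`eq_zero_of_side` excludes. -/
theorem IsFace.injOn_openQuad (hfin : V.Finite) {x y z w : EPlane} {s t u v : ℝ}
    (h : T.IsFace x y z) (h' : T.IsFace x y w) (hc : Crossing x y z w s t u v) :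
    InjOn (proj b) (openQuad x y z w) := by
  have hC := T.isComplex_isFace hfin
  intro p hp p' hp' he
  obtain ⟨v, hv, rfl⟩ := proj_eq_iff.1 he
  obtain ⟨k, hk, a₁, a₂, a₃, h₁, h₂, h₃, h1, e⟩ := hc.exists_comb_of_mem hp
  obtain ⟨k', hk', a₁', a₂', a₃', h₁', h₂', h₃', h1', e'⟩ := hc.exists_comb_of_mem hp'
  have hF : ∀ k ∈ ({z, w} : Set EPlane), T.IsFace x y k := by
    rintro k (rfl | rfl) <;> assumption
  have hu := hC.uniq ((hF k hk).trans hv) (hF k' hk') h₁.le h₂.le h₃ h1 h₁'.le h₂'.le h₃' h1' (by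
    rw [← e', e]
    obtain rfl : a₁ = 1 - a₂ - a₃ := by linarith
    module)
  have : v = 0 := eq_zero_of_side (hF k' hk').det_ne (mem_triple_of_comb h₁ h₂.le h₃ hu)
    (mem_triple_of_comb (y := k + v) (z := x + v) (a' := a₁') (b' := a₂') (c' := a₃') h₂ h₃ h₁.le
      fun f => by linarith [hu f])
  rw [this, add_zero]

theorem proj_image_openQuad (x y z w : EPlane) : proj b '' openQuad x y z w =
    geodesic b x y ∪ triangle b x y z ∪ triangle b x y w := by
  rw [openQuad, image_union, image_union]; rfl

/-- The triangulation obtained by flipping the diagonal `x y` of the quadrilateral `x z y w`. -/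
theorem exists_flip (hfin : V.Finite) {x y z w : EPlane} {s t u v : ℝ}
    (h : T.IsFace x y z) (h' : T.IsFace x y w) (hc : Crossing x y z w s t u v) :
    ∃ T' : GeometricTriangulation b V, IsFlip T T' ∧ T'.IsFace z w y ∧ T'.IsFace w z x ∧
      ∀ x' y' z', T.IsFace x' y' z' → triangle b x' y' z' ≠ triangle b x y z →
        triangle b x' y' z' ≠ triangle b x y w → T'.IsFace x' y' z' := by
  have hinj := h.injOn_openQuad hfin h' hc
  have hinj' := hinj
  rw [← hc.openQuad_eq] at hinj'
  have hzw : z ≠ w := (ne_of_det3 hc.det_zw).1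
  have hdy : det3 z w y ≠ 0 := hc.flip.det_w
  have hdx : det3 w z x ≠ 0 := by rw [det3_swap, neg_ne_zero]; exact hc.det_zw
  set E := (T.edges \ {geodesic b x y}) ∪ {geodesic b z w} with hE
  set Fa := (T.faces \ {triangle b x y z, triangle b y x w}) ∪
      {triangle b z w y, triangle b w z x} with hFa
  have hsub : ∀ {A : Set EPlane}, A ⊆ openQuad z w x y → InjOn (proj b) A :=
    fun hA => hinj'.mono hA
  have hxy' : triangle b y x w = triangle b x y w := triangle_swap _ _ _
  have hside : ∀ {x' y' z'}, T.IsFace x' y' z' → triangle b x' y' z' ≠ triangle b x y z →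
      triangle b x' y' z' ≠ triangle b x y w → geodesic b x' y' ∈ E := by
    intro x' y' z' hF n1 n2
    refine .inl ⟨hF.xy, fun he => ?_⟩
    rcases h.eq_of_side hfin h' hc hF he with e | e
    exacts [n1 e, n2 e]
  have hside3 : ∀ {x' y' z'}, T.IsFace x' y' z' → triangle b x' y' z' ≠ triangle b x y z →
      triangle b x' y' z' ≠ triangle b x y w →
      geodesic b x' y' ∈ E ∧ geodesic b y' z' ∈ E ∧ geodesic b z' x' ∈ E := by
    intro x' y' z' hF n1 n2
    refine ⟨hside hF n1 n2, hside hF.rot ?_ ?_, hside hF.rot.rot ?_ ?_⟩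
    · rwa [triangle_rot]
    · rwa [triangle_rot]
    · rwa [triangle_rot, triangle_rot]
    · rwa [triangle_rot, triangle_rot]
  have hyz : geodesic b y z ∈ E := .inl ⟨h.yz, h.side_ne hfin⟩
  have hyw : geodesic b y w ∈ E := .inl ⟨h'.yz, h'.side_ne hfin⟩
  have hxz : geodesic b x z ∈ E := .inl ⟨h.swap.yz, by
    rw [mem_singleton_iff, geodesic_symm x y]; exact h.swap.side_ne hfin⟩
  have hxw : geodesic b x w ∈ E := .inl ⟨h'.swap.yz, by
    rw [mem_singleton_iff, geodesic_symm x y]; exact h'.swap.side_ne hfin⟩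
  have hzwE : geodesic b z w ∈ E := .inr rfl
  have hQ : proj b '' openQuad z w x y = proj b '' openQuad x y z w := by rw [hc.openQuad_eq]
  rw [proj_image_openQuad, proj_image_openQuad] at hQ
  have hpart : Setoid.IsPartition ((fun v => ({v} : Set (FlatTorus b))) '' V ∪ E ∪ Fa) := by
    -- Vertices, edges and faces are cells of different kinds, so the removals from edges and from
    -- faces can be done at once from the whole partition.
    have hcells : (fun v => ({v} : Set (FlatTorus b))) '' V ∪ E ∪ Fa =
        (((fun v => ({v} : Set (FlatTorus b))) '' V ∪ T.edges ∪ T.faces) \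
          {geodesic b x y, triangle b x y z, triangle b x y w}) ∪
          {geodesic b z w, triangle b z w x, triangle b z w y} := by
      have ne1 : ∀ v ∈ V, ({v} : Set (FlatTorus b)) ≠ geodesic b x y := fun v hv he =>
        notMem_of_mem_edge h.xy (he.subset rfl) hv
      have ne2 : ∀ v ∈ V, ∀ f ∈ T.faces, ({v} : Set (FlatTorus b)) ≠ f := fun v hv f hf he =>
        notMem_face_of_mem hfin hf hv (he.subset rfl)
      have ne3 : ∀ e ∈ T.edges, ∀ f ∈ T.faces, e ≠ f := by
        intro e he f hf hef
        obtain ⟨p, hp⟩ : e.Nonempty := nonempty_iff_ne_empty.2 fun h0 =>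
          T.isPartition.1 (h0 ▸ .inl (.inr he))
        exact notMem_face_of_mem_edge hfin he hf hp (hef ▸ hp)
      have f1 := h.face
      have f2 := h'.face
      have f3 := h.xy
      rw [hE, hFa, hxy', triangle_swap z w x]
      ext c
      simp only [mem_union, Set.mem_sdiff, mem_image, mem_insert_iff, mem_singleton_iff]
      constructor
      · rintro ((⟨v, hv, rfl⟩ | (⟨hc1, hc2⟩ | hc)) | (⟨hc1, hc2⟩ | hc | hc))
        · refine .inl ⟨.inl (.inl ⟨v, hv, rfl⟩), ?_⟩
          rintro (e | e | e)
          exacts [ne1 v hv e, ne2 v hv _ f1 e, ne2 v hv _ f2 e]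
        · refine .inl ⟨.inl (.inr hc1), ?_⟩
          rintro (e | e | e)
          exacts [hc2 e, ne3 _ hc1 _ f1 e, ne3 _ hc1 _ f2 e]
        · exact .inr (.inl hc)
        · refine .inl ⟨.inr hc1, ?_⟩
          rintro (e | e | e)
          exacts [ne3 _ f3 _ hc1 e.symm, hc2 (.inl e), hc2 (.inr e)]
        · exact .inr (.inr (.inr hc))
        · exact .inr (.inr (.inl hc))
      · rintro (⟨(hv | hc) | hc, hn⟩ | hc | hc | hc)
        · exact .inl (.inl hv)
        · exact .inl (.inr (.inl ⟨hc, fun e => hn (.inl e)⟩))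
        · exact .inr (.inl ⟨hc, fun e => hn (.inr e)⟩)
        · exact .inl (.inr (.inr hc))
        · exact .inr (.inr (.inr hc))
        · exact .inr (.inr (.inl hc))
    rw [hcells]
    apply isPartition_replace T.isPartition
    · rintro c (rfl | rfl | rfl)
      exacts [.inl (.inr h.xy), .inr h.face, .inr h'.face]
    · simp only [sUnion_insert, sUnion_singleton]
      rw [← union_assoc, ← union_assoc, hQ]
    · have hne := fun (x y z : EPlane) (hd : det3 x y z ≠ 0) =>
        ((openTriangle_nonempty hd).image (proj b)).ne_empty
      rintro (he | he | he)
      · exact (Set.Nonempty.image (proj b) ⟨_, mem_openSegment (x := z) (y := w) one_half_pos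
          one_half_pos (add_halves 1)⟩).ne_empty he.symm
      · exact hne _ _ _ hc.det_zw he.symm
      · exact hne _ _ _ hdy he.symm
    · have hdis : ∀ {A B : Set EPlane}, A ⊆ openQuad z w x y → B ⊆ openQuad z w x y →
          Disjoint A B → ∀ a, a ∈ proj b '' A → a ∈ proj b '' B → False := by
        rintro A B hA hB hAB _ ⟨p, hp, rfl⟩ ⟨q, hq, hpq⟩
        obtain rfl := hinj' (hB hq) (hA hp) hpq
        exact disjoint_left.1 hAB hp hq
      have s1 : openSegment ℝ z w ⊆ openQuad z w x y := fun p hp => .inl (.inl hp)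
      have s2 : openTriangle z w x ⊆ openQuad z w x y := fun p hp => .inl (.inr hp)
      have s3 : openTriangle z w y ⊆ openQuad z w x y := fun p hp => .inr hp
      have d12 := hdis s1 s2 hc.flip.disjoint_segment
      have d13 := hdis s1 s3 hc.flip.swap_zw.disjoint_segment
      have d23 := hdis s2 s3 hc.flip.disjoint_triangles
      rintro c (rfl | rfl | rfl) c' (rfl | rfl | rfl) a ha ha'
      · rfl
      · exact (d12 a ha ha').elim
      · exact (d13 a ha ha').elim
      · exact (d12 a ha' ha).elim
      · rfl
      · exact (d23 a ha ha').elim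
      · exact (d13 a ha' ha).elim
      · exact (d23 a ha' ha).elim
      · rfl
  let T' : GeometricTriangulation b V :=
    { edges := E
      faces := Fa
      finite_edges := T.finite_edges.sdiff.union (toFinite _)
      finite_faces := T.finite_faces.sdiff.union (toFinite _)
      edge_geodesic := by
        rintro e (he | rfl)
        · exact T.edge_geodesic e he.1
        · exact ⟨z, w, hzw, h.memz, h'.memz, hsub fun p hp => .inl (.inl hp), rfl⟩
      face_triangle := by
        rintro f (hf | rfl | rfl)
        · obtain ⟨x', y', z', hF, hi, rfl⟩ := exists_isFace hf.1
          obtain ⟨e1, e2, e3⟩ := hside3 hF (fun e => hf.2 (.inl e))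
            (fun e => hf.2 (.inr (e.trans hxy'.symm)))
          exact ⟨x', y', z', affineIndependent_iff_det3.2 hF.det_ne, hF.memx, hF.memy, hF.memz,
            e1, e2, e3, hi, rfl⟩
        · exact ⟨z, w, y, affineIndependent_iff_det3.2 hdy, h.memz, h'.memz, h.memy, hzwE,
            geodesic_symm (b := b) y w ▸ hyw, hyz, hsub fun p hp => .inr hp, rfl⟩
        · exact ⟨w, z, x, affineIndependent_iff_det3.2 hdx, h'.memz, h.memz, h.memx,
            geodesic_symm (b := b) z w ▸ hzwE, geodesic_symm (b := b) x z ▸ hxz, hxw,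
            hsub (by rw [openTriangle_swap]; exact fun p hp => .inl (.inr hp)), rfl⟩
      isPartition := hpart }
  refine ⟨T', ⟨x, y, z, w, hzw, h.xy, h.face, hxy' ▸ h'.face, rfl, rfl⟩, ?_, ?_, ?_⟩
  · exact ⟨hdy, h.memz, h'.memz, h.memy, hzwE, geodesic_symm (b := b) y w ▸ hyw, hyz,
      .inr (.inl rfl)⟩
  · exact ⟨hdx, h'.memz, h.memz, h.memx, geodesic_symm (b := b) z w ▸ hzwE,
      geodesic_symm (b := b) x z ▸ hxz, hxw, .inr (.inr rfl)⟩
  · intro x' y' z' hF n1 n2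
    obtain ⟨e1, e2, e3⟩ := hside3 hF n1 n2
    exact ⟨hF.1, hF.2, hF.3, hF.4, e1, e2, e3, .inl ⟨hF.face, by
      rintro (e | e)
      exacts [n1 e, n2 (e.trans hxy')]⟩⟩

end GeometricTriangulation

/-! ### Heights under flips and finiteness. -/

theorem IsComplex.height_add {F : EPlane → EPlane → EPlane → Prop} (hF : IsComplex b V F) (s : ℝ)
    {v : EPlane} (hv : v ∈ lattice b) (p : EPlane) :
    height F (quad s) (p + v) - quad s (p + v) = height F (quad s) p - quad s p := by
  obtain ⟨x, y, z, a₁, a₂, a₃, h, h₁, h₂, h₃, h1, rfl⟩ := hF.cover p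
  have e : a₁ • x + a₂ • y + a₃ • z + v = a₁ • (x + v) + a₂ • (y + v) + a₃ • (z + v) := by
    obtain rfl : a₁ = 1 - a₂ - a₃ := by linarith
    module
  rw [e, hF.height_comb h h₁ h₂ h₃ h1, hF.height_comb (hF.trans hv h) h₁ h₂ h₃ h1,
    quad_comb s _ _ _ h1, quad_comb s _ _ _ h1]
  simp only [add_sub_add_right_eq_sub]

theorem quad_le_of_norm_le (s : ℝ) {p : EPlane} {C : ℝ} (h : ‖p‖ ≤ C) :
    quad s p ≤ ((1 + |s|) * C) ^ 2 := by
  rw [← norm_shear_sq]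
  refine pow_le_pow_left₀ (norm_nonneg _) ((norm_shear_le s p).trans ?_) 2
  gcongr

theorem norm_le_of_quad_le (s : ℝ) {p : EPlane} {K : ℝ} (h : quad s p ≤ K) :
    ‖p‖ ≤ (1 + |s|) * √K := by
  rw [← norm_shear_sq] at h
  exact (norm_le_shear s p).trans
    (mul_le_mul_of_nonneg_left (Real.le_sqrt_of_sq_le h) (by positivity))

theorem IsComplex.height_le {F : EPlane → EPlane → EPlane → Prop} (hF : IsComplex b V F) (s : ℝ) :
    ∃ K, ∀ p, height F (quad s) p - quad s p ≤ K := by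
  obtain ⟨C, hC⟩ := hF.bound
  refine ⟨3 * ((1 + |s|) * C) ^ 2, fun p => ?_⟩
  obtain ⟨x, y, z, a₁, a₂, a₃, h, h₁, h₂, h₃, h1, rfl⟩ := hF.cover p
  rw [hF.height_comb h h₁ h₂ h₃ h1, quad_comb s _ _ _ h1]
  have q1 := quad_le_of_norm_le s (hC h)
  have q2 := quad_le_of_norm_le s (hC (hF.rot h))
  have q3 := quad_le_of_norm_le s (hC (hF.rot (hF.rot h)))
  have key : ∀ {c d r : ℝ}, 0 ≤ c → c ≤ 1 → 0 ≤ d → d ≤ 1 → 0 ≤ r → c * d * r ≤ r := by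
    intro c d r hc hc' hd hd' hr
    exact mul_le_of_le_one_left hr (mul_le_one₀ hc' hd hd')
  have k1 := key h₁ (by linarith) h₂ (by linarith) (quad_nonneg s (x - y))
  have k2 := key h₂ (by linarith) h₃ (by linarith) (quad_nonneg s (y - z))
  have k3 := key h₃ (by linarith) h₁ (by linarith) (quad_nonneg s (z - x))
  linarith

namespace GeometricTriangulation

variable {T : GeometricTriangulation b V}

/-- Up to lattice translation there are finitely many short segments and triangles with corners over
`V`; a triangulation is given by subsets of their projections. -/
theorem finite_of_bound (hfin : V.Finite) (C : ℝ) :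
    {T : GeometricTriangulation b V | ∀ x y z, T.IsFace x y z → ‖x - y‖ ≤ C}.Finite := by
  let G : EPlane → EPlane → EPlane → Prop := fun x y z => det3 x y z ≠ 0 ∧
    (proj b x ∈ V ∧ proj b y ∈ V ∧ proj b z ∈ V) ∧ ‖x - y‖ ≤ C ∧ ‖y - z‖ ≤ C ∧ ‖z - x‖ ≤ C
  have hmem : ∀ {x y z}, G x y z → proj b x ∈ V := fun h => h.2.1.1
  have hrot : ∀ {x y z}, G x y z → G y z x := fun {x y z} h =>
    ⟨by rw [det3_rot]; exact h.1, ⟨h.2.1.2.1, h.2.1.2.2, h.2.1.1⟩, h.2.2.2.1, h.2.2.2.2, h.2.2.1⟩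
  have htrans : ∀ {x y z v}, v ∈ lattice b → G x y z → G (x + v) (y + v) (z + v) := by
    intro x y z v hv h
    simpa only [G, det3_add, proj_add hv, add_sub_add_right_eq_sub] using h
  have hC : ∃ C, ∀ {x y z}, G x y z → ‖x - y‖ ≤ C := ⟨C, fun h => h.2.2.1⟩
  have hA := finite_image hfin hmem hrot htrans hC (fun x y _ => geodesic b x y)
    fun _ hv => geodesic_add hv _ _
  have hB := finite_image hfin hmem hrot htrans hC (fun x y z => triangle b x y z)
    fun h hv => triangle_add h.1 hv
  refine ((hA.finite_subsets.prod hB.finite_subsets).preimage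
    (f := fun T : GeometricTriangulation b V => (T.edges, T.faces)) ?_).subset ?_
  · intro T _ T' _ h
    exact GeometricTriangulation.ext (congrArg Prod.fst h) (congrArg Prod.snd h)
  · intro T hT
    have hG : ∀ {x y z}, T.IsFace x y z → G x y z := fun h =>
      ⟨h.1, ⟨h.2, h.3, h.4⟩, hT _ _ _ h, hT _ _ _ h.rot, hT _ _ _ h.rot.rot⟩
    constructor
    · intro e he
      obtain ⟨x, y, hxy, hx, hy, -, rfl⟩ := T.edge_geodesic e he
      obtain ⟨z, hz⟩ := (IsEdge.mk hxy hx hy he).exists_isFace hfin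
      exact ⟨x, y, z, hG hz, rfl⟩
    · intro f hf
      obtain ⟨x, y, z, hF, -, rfl⟩ := exists_isFace hf
      exact ⟨x, y, z, hG hF, rfl⟩

/-- At the midpoint of an edge, height minus form is a quarter of the form on the edge vector. The
upper bound for `T₀` thus bounds every edge. -/
theorem finite_height_le (hfin : V.Finite) (s : ℝ) (T₀ : GeometricTriangulation b V) :
    {T : GeometricTriangulation b V |
      height T.IsFace (quad s) ≤ height T₀.IsFace (quad s)}.Finite := by
  obtain ⟨K, hK⟩ := (T₀.isComplex_isFace hfin).height_le s
  refine (finite_of_bound hfin ((1 + |s|) * √(4 * K))).subset fun T hT x y z h => ?_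
  apply norm_le_of_quad_le
  have h1 : (1 / 2 : ℝ) + 1 / 2 + 0 = 1 := by norm_num
  have h2 := hT ((1 / 2 : ℝ) • x + (1 / 2 : ℝ) • y + (0 : ℝ) • z)
  rw [(T.isComplex_isFace hfin).height_comb h (by norm_num) (by norm_num) le_rfl h1] at h2
  have h3 := hK ((1 / 2 : ℝ) • x + (1 / 2 : ℝ) • y + (0 : ℝ) • z)
  have h4 := quad_comb s x y z h1
  linarith

theorem exists_improving_flip (hfin : V.Finite) {s : ℝ}
    (hL : ¬ LocallyDelaunay T.IsFace (quad s)) :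
    ∃ T' : GeometricTriangulation b V, IsFlip T T' ∧
      height T'.IsFace (quad s) ≤ height T.IsFace (quad s) ∧
      ¬ height T.IsFace (quad s) ≤ height T'.IsFace (quad s) := by
  unfold LocallyDelaunay at hL
  push Not at hL
  obtain ⟨x, y, z, w, α, β, γ, h, h', h1, hw, hγ, hlt⟩ := hL
  -- If `α ≤ 0`, then `y` is a convex combination of `w`, `x`, `z`, and convexity of the form
  -- contradicts `hlt`. With the same for `β`, the quadrilateral is strictly convex.
  have hα : 0 < α := by
    by_contra! hα
    have hβ : 0 < β := by linarith
    have e : β⁻¹ • w + (-α / β) • x + (-γ / β) • z = y := by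
      have : w - α • x - γ • z = β • y := by rw [hw]; abel
      calc _ = β⁻¹ • (w - α • x - γ • z) := by module
        _ = y := by rw [this, smul_smul, inv_mul_cancel₀ hβ.ne', one_smul]
    have hq := quad_comb_le s w x z (a₁ := β⁻¹) (a₂ := -α / β) (a₃ := -γ / β) (by positivity)
      (div_nonneg (by linarith) hβ.le) (div_nonneg (by linarith) hβ.le) (by field_simp; linarith)
    rw [e] at hq
    have := mul_le_mul_of_nonneg_left hq hβ.le
    have e2 : β * (β⁻¹ * quad s w + -α / β * quad s x + -γ / β * quad s z) =
      quad s w - α * quad s x - γ * quad s z := by field_simp; ring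
    rw [e2] at this
    linarith
  have hβ : 0 < β := by
    by_contra! hβ
    have e : α⁻¹ • w + (-β / α) • y + (-γ / α) • z = x := by
      have : w - β • y - γ • z = α • x := by rw [hw]; abel
      calc _ = α⁻¹ • (w - β • y - γ • z) := by module
        _ = x := by rw [this, smul_smul, inv_mul_cancel₀ hα.ne', one_smul]
    have hq := quad_comb_le s w y z (a₁ := α⁻¹) (a₂ := -β / α) (a₃ := -γ / α) (by positivity)
      (div_nonneg (by linarith) hα.le) (div_nonneg (by linarith) hα.le) (by field_simp; linarith)
    rw [e] at hq
    have := mul_le_mul_of_nonneg_left hq hα.le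
    have e2 : α * (α⁻¹ * quad s w + -β / α * quad s y + -γ / α * quad s z) =
      quad s w - β * quad s y - γ * quad s z := by field_simp; ring
    rw [e2] at this
    linarith
  -- Since `1 - γ = α + β`, dividing `α • x + β • y = w - γ • z` by it gives the crossing point of
  -- the diagonals.
  set N := 1 - γ with hN
  have hN0 : 0 < N := by linarith
  have hc : Crossing x y z w (α / N) (β / N) (-γ / N) (1 / N) := by
    refine ⟨by positivity, by positivity, div_pos (by linarith) hN0, by positivity, ?_, ?_, ?_, h.1⟩
    · field_simp; linarith
    · field_simp; linarith
    · rw [hw]; module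
  have hval : -γ / N * quad s z + 1 / N * quad s w < α / N * quad s x + β / N * quad s y := by
    have := div_lt_div_of_pos_right hlt hN0
    rw [show (α * quad s x + β * quad s y + γ * quad s z) / N = α / N * quad s x + β / N * quad s y
      - -γ / N * quad s z by ring] at this
    rw [one_div_mul_eq_div]
    linarith
  set q := quad s
  generalize α / N = σ, β / N = τ', -γ / N = u, 1 / N = v at hc hval
  obtain ⟨T', hflip, hzwy, hwzx, hold⟩ := exists_flip hfin h h' hc
  have hC := T.isComplex_isFace hfin
  have hC' := T'.isComplex_isFace hfin
  have hquad : ∀ k ∈ ({z, w} : Set EPlane), ∀ a₁ a₂ a₃ : ℝ, 0 ≤ a₁ → 0 ≤ a₂ → 0 ≤ a₃ →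
      a₁ + a₂ + a₃ = 1 → height T'.IsFace q (a₁ • x + a₂ • y + a₃ • k) ≤
        a₁ * q x + a₂ * q y + a₃ * q k := by
    have key : ∀ (z w : EPlane) (u v : ℝ), Crossing x y z w σ τ' u v →
        u * q z + v * q w < σ * q x + τ' * q y → T'.IsFace z w y → T'.IsFace w z x →
        ∀ a₁ a₂ a₃ : ℝ, 0 ≤ a₁ → 0 ≤ a₂ → 0 ≤ a₃ →
        a₁ + a₂ + a₃ = 1 → height T'.IsFace q (a₁ • x + a₂ • y + a₃ • z) ≤
          a₁ * q x + a₂ * q y + a₃ * q z := by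
      intro z w u v hc hval hzwy hwzx a₁ a₂ a₃ h₁ h₂ h₃ h1
      obtain ⟨τ, hτ, -, g₁, g₂, g0, e⟩ := exchange hc.hs hc.ht hc.eq a₃ h₁ h₂
      have hτu := mul_nonneg hτ hc.hu.le
      have hτv := mul_nonneg hτ hc.hv.le
      have hs : τ * σ + τ * τ' = τ * u + τ * v := by rw [← mul_add, ← mul_add, hc.hst, hc.huv]
      have hv := mul_le_mul_of_nonneg_left hval.le hτ
      rw [e]
      rcases g0 with g0 | g0
      · have := hC'.height_comb (q := q) (a₁ := a₃ + τ * u) (a₂ := τ * v) (a₃ := a₂ - τ * τ')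
          hzwy (by positivity) hτv g₂ (by linarith)
        have e2 : (a₁ - τ * σ) • x + (a₂ - τ * τ') • y + (a₃ + τ * u) • z + (τ * v) • w =
          (a₃ + τ * u) • z + (τ * v) • w + (a₂ - τ * τ') • y := by rw [g0]; module
        rw [e2, this]
        have : a₁ * q x = τ * σ * q x := by rw [sub_eq_zero.1 g0]
        linarith
      · have := hC'.height_comb (q := q) (a₁ := τ * v) (a₂ := a₃ + τ * u) (a₃ := a₁ - τ * σ)
          hwzx hτv (by positivity) g₁ (by linarith)
        have e2 : (a₁ - τ * σ) • x + (a₂ - τ * τ') • y + (a₃ + τ * u) • z + (τ * v) • w =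
          (τ * v) • w + (a₃ + τ * u) • z + (a₁ - τ * σ) • x := by rw [g0]; module
        rw [e2, this]
        have : a₂ * q y = τ * τ' * q y := by rw [sub_eq_zero.1 g0]
        linarith
    rintro k (rfl | rfl)
    · exact key _ _ _ _ hc hval hzwy hwzx
    · exact key _ _ _ _ hc.swap_zw (by linarith) hzwy.swap hwzx.swap
  refine ⟨T', hflip, fun p => ?_, fun hle => ?_⟩
  · obtain ⟨x', y', z', a₁, a₂, a₃, hF, hp⟩ := hC.cover p
    have hpm := mem_convexHull_triple.2 ⟨_, _, _, hp⟩
    -- A face projecting to a removed triangle is a translate of it, and height minus form is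
    -- lattice periodic, so the estimate `hquad` carries over. Other faces persist and their heights
    -- do not change.
    by_cases hn : ∃ k ∈ ({z, w} : Set EPlane), triangle b x' y' z' = triangle b x y k
    · obtain ⟨k, hk, he⟩ := hn
      have hFk : T.IsFace x y k := by rcases hk with rfl | rfl <;> assumption
      obtain ⟨d, hd⟩ := openTriangle_nonempty hF.det_ne
      obtain ⟨d', hd', e⟩ := he.subset (mem_image_of_mem _ hd)
      obtain ⟨v, hv, rfl⟩ := proj_eq_iff.1 e.symm
      have hs := (hF.trans hv).vertices_eq hfin hFk (mem_openTriangle_add hF.det_ne hd) hd'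
      obtain ⟨h₁, h₂, h₃, h1, rfl⟩ := hp
      have hm : a₁ • x' + a₂ • y' + a₃ • z' + v ∈ convexHull ℝ {x' + v, y' + v, z' + v} := by
        refine mem_convexHull_triple.2 ⟨a₁, a₂, a₃, h₁, h₂, h₃, h1, ?_⟩
        obtain rfl : a₁ = 1 - a₂ - a₃ := by linarith
        module
      rw [hs] at hm
      obtain ⟨c₁, c₂, c₃, g₁, g₂, g₃, g, e⟩ := mem_convexHull_triple.1 hm
      have t1 := hC.height_add s hv (a₁ • x' + a₂ • y' + a₃ • z')
      have t2 := hC'.height_add s hv (a₁ • x' + a₂ • y' + a₃ • z')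
      have t3 := hquad k hk c₁ c₂ c₃ g₁ g₂ g₃ g
      rw [← hC.height_comb hFk g₁ g₂ g₃ g, ← e] at t3
      linarith
    · push Not at hn
      rw [hC.height_eq_interp hF hpm, hC'.height_eq_interp
        (hold _ _ _ hF (hn z (by simp)) (hn w (by simp))) hpm]
  -- The decrease is strict at the crossing point of the diagonals, by `hval`.
  · have h2 := hle (σ • x + τ' • y + (0 : ℝ) • z)
    rw [hC.height_comb h hc.hs.le hc.ht.le le_rfl (by linarith [hc.hst]), zero_smul, add_zero,
      hc.eq] at h2
    have := hC'.height_comb (q := q) (a₁ := u) (a₂ := v) (a₃ := 0) hzwy hc.hu.le hc.hv.le le_rfl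
      (by linarith [hc.huv])
    rw [zero_smul, add_zero] at this
    rw [this] at h2
    linarith

theorem reachable_of_isFlip {T T' : GeometricTriangulation b V} (h : IsFlip T T') :
    (geometricFlipGraph b V).Reachable T T' := by
  by_cases hne : T = T'
  · rw [hne]
  · exact SimpleGraph.Adj.reachable ((SimpleGraph.fromRel_adj _ _ _).2 ⟨hne, .inl h⟩)

/-! ### Reaching the Delaunay triangulation, its uniqueness, and connectedness. -/

/-- Every triangulation is transformed by flips into one all of whose faces are Delaunay. -/
theorem exists_reachable_isDelaunay (hfin : V.Finite) (s : ℝ) (T₀ : GeometricTriangulation b V) :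
    ∃ T : GeometricTriangulation b V, (geometricFlipGraph b V).Reachable T₀ T ∧
      ∀ x y z, T.IsFace x y z → IsDelaunay V (quad s) x y z := by
  obtain ⟨T, hT, hmin⟩ := Set.Finite.exists_minimalFor
    (fun T : GeometricTriangulation b V => height T.IsFace (quad s))
    {T | (geometricFlipGraph b V).Reachable T₀ T ∧
      height T.IsFace (quad s) ≤ height T₀.IsFace (quad s)}
    ((finite_height_le hfin s T₀).subset fun T hT => hT.2) ⟨T₀, .refl _, le_rfl⟩
  refine ⟨T, hT.1, fun x y z h => ⟨h.1, h.2, h.3, h.4, fun v hv => ?_⟩⟩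
  refine (T.isComplex_isFace hfin).interp_le hfin ?_ h hv
  by_contra hL
  obtain ⟨T', hflip, hle, hn⟩ := exists_improving_flip hfin hL
  exact hn (hmin ⟨hT.1.trans (reachable_of_isFlip hflip), hle.trans hT.2⟩ hle)

/-- At a point of the face off all lines through two vertices, all weights are positive in both
triangulations, so `IsDelaunay.uniq` identifies all three corners. -/
theorem isFace_of_isDelaunay (hfin : V.Finite) {q : EPlane → ℝ} (hq : Generic V q)
    {T T' : GeometricTriangulation b V} (hT : ∀ x y z, T.IsFace x y z → IsDelaunay V q x y z)
    (hT' : ∀ x y z, T'.IsFace x y z → IsDelaunay V q x y z) {x y z : EPlane}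
    (h : T.IsFace x y z) : T'.IsFace x y z := by
  obtain ⟨p, hp, hp'⟩ := h.exists_offLines hfin
  obtain ⟨x', y', z', a₁', a₂', a₃', h', h₁', h₂', h₃', h1', e'⟩ := T'.cover hfin p
  obtain ⟨a₁, a₂, a₃, h₁, h₂, h₃, h1, e⟩ := (mem_openTriangle h.det_ne).1 hp
  obtain ⟨-, g₁, g₂, g₃⟩ := comb_pos_of_mem_offLines hp' h'.2 h'.3 h'.4 h₁' h₂' h₃' h1' e'
  exact (T'.isComplex_isFace hfin).perm h' h.det_ne (triple_eq_of_comb h₁ h₂ h₃ g₁ g₂ g₃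
    ((hT _ _ _ h).uniq hq (hT' _ _ _ h') h₁.le h₂.le h₃.le h1 h₁' h₂' h₃' h1' (e.symm.trans e')))

theorem subset_of_isFace (hfin : V.Finite) {T T' : GeometricTriangulation b V}
    (h : ∀ {x y z}, T.IsFace x y z → T'.IsFace x y z) :
    T.edges ⊆ T'.edges ∧ T.faces ⊆ T'.faces := by
  constructor
  · intro e he
    obtain ⟨x, y, hxy, hx, hy, -, rfl⟩ := T.edge_geodesic e he
    obtain ⟨z, hz⟩ := (IsEdge.mk hxy hx hy he).exists_isFace hfin
    exact (h hz).xy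
  · intro f hf
    obtain ⟨x, y, z, hF, -, rfl⟩ := exists_isFace hf
    exact (h hF).face

theorem eq_of_isDelaunay (hfin : V.Finite) {q : EPlane → ℝ} (hq : Generic V q)
    {T T' : GeometricTriangulation b V} (hT : ∀ x y z, T.IsFace x y z → IsDelaunay V q x y z)
    (hT' : ∀ x y z, T'.IsFace x y z → IsDelaunay V q x y z) : T = T' := by
  obtain ⟨e1, f1⟩ := subset_of_isFace hfin (isFace_of_isDelaunay hfin hq hT hT')
  obtain ⟨e2, f2⟩ := subset_of_isFace hfin (isFace_of_isDelaunay hfin hq hT' hT)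
  exact GeometricTriangulation.ext (e1.antisymm e2) (f1.antisymm f2)

end GeometricTriangulation

end FlatTorus

theorem mainTheorem5 (b : Module.Basis (Fin 2) ℝ EPlane) (V : Set (FlatTorus b))
    (hfin : V.Finite) (hne : V.Nonempty) :
    (FlatTorus.geometricFlipGraph b V).Connected := by
  obtain ⟨s, hs⟩ := FlatTorus.exists_generic hfin
  refine (SimpleGraph.connected_iff _).2 ⟨fun T₁ T₂ => ?_,
    ⟨(FlatTorus.isComplex_isDelaunay hfin hne hs).toTriangulation hfin⟩⟩
  obtain ⟨D₁, h₁, hD₁⟩ := T₁.exists_reachable_isDelaunay hfin s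
  obtain ⟨D₂, h₂, hD₂⟩ := T₂.exists_reachable_isDelaunay hfin s
  obtain rfl := FlatTorus.GeometricTriangulation.eq_of_isDelaunay hfin hs hD₁ hD₂
  exact h₁.trans h₂.symm
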